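/- For $\sigma\ge 0$ let $H^\sigma(\mathbb R^d)$ be the space of complex-valued $f\in L^2(\mathbb R^d)$ with $\|f\|_{H^\sigma}=\|(1+|\xi|^2)^{\sigma/2}\hat f\|_{L^2}<\infty$. Consider the cubic focusing nonlinear Schrödinger equation $$i u_t+\Delta u+|u|^2u=0\quad\text{on }\mathbb R^d,\qquad u(0)=u_0. \tag{NLS}$$ The Cauchy problem (NLS) is called well-posed for data in $H^s(\mathbb R^d)$ if for every bounded set $B\subset H^s(\mathbb R^d)$ there exist $T>0$ and a Banach space $\mathcal X_T$ continuously embedded in $C([-T,T];H^s(\mathbb R^d))$ such that for every $u_0\in B$ there is a unique solution $u$ of (NLS) on $[-T,T]$ (in the sense of distributions, with $|u|^2u\in L^1([-T,T]\times K)$ for every compact $K\subset\mathbb R^d$) in the class $\mathcal X_T$, and moreover: (1) the flow map $u_0\mapsto u$ is continuous from $B$ (with the $H^s$ topology) to $C([-T,T];H^s(\mathbb R^d))$; (2) if $u_0\in B\cap H^\sigma(\mathbb R^d)$ with a real $\sigma\ge s$, then $u\in C([-T,T];H^\sigma(\mathbb R^d))$. **Theorem.** Let $d\ge 5$. (a)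 Let $s$ be a positive integer with $s<\frac{d-2}{2}$. Then there exist a sequence $(t_n)$ of positive numbers tending to zero and functions $u_n:[0,t_n]\times\mathbb R^d\to\mathbb C$, continuously differentiable in $(t,x)$, with $u_n(t,\cdot)\in C^\infty(\mathbb R^d)\cap H^s(\mathbb R^d)$ for every $t\in[0,t_n]$ and $u_n\in C([0,t_n];H^s(\mathbb R^d))$, which satisfy $$(i\partial_t+\Delta)u_n+|u_n|^2u_n=0$$ pointwise on $[0,t_n]\times\mathbb R^d$ (with one-sided time derivatives at the end points), such that $$\lim_{n\to\infty}\|u_n(0,\cdot)\|_{H^s(\mathbb R^d)}=0,\qquad \lim_{n\to\infty}\|u_n(t_n,\cdot)\|_{H^s(\mathbb R^d)}=\infty .$$ (b) For every such $s$, the Cauchy problem (NLS) is not well-posed for data in $H^s(\mathbb R^d)$. (c) In particular, (NLS) is not well-posed for data in $H^1(\mathbb R^d)$. -/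

import Mathlib

open MeasureTheory Filter Topology Set
open scoped NNReal ContDiff Laplacian

noncomputable section

namespace CubicNLS

/-- The Euclidean space `ℝ^d`. -/
abbrev E (d : ℕ) : Type := EuclideanSpace ℝ (Fin d)

/-- The complex Hilbert space `L²(ℝ^d)`. -/
abbrev L2 (d : ℕ) : Type := Lp ℂ 2 (volume : Measure (E d))

/-- The tempered distribution defined by an `L²` function, as a linear map. -/
abbrev toDistr (d : ℕ) : L2 d →L[ℂ] TemperedDistribution (E d) ℂ :=
  Lp.toTemperedDistributionCLM ℂ (volume : Measure (E d)) 2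

theorem toDistr_injective (d : ℕ) : Function.Injective (toDistr d) :=
  LinearMap.ker_eq_bot.mp Lp.ker_toTemperedDistributionCLM_eq_bot

/-- For `s ≥ 0`, the linear subspace `H^s(ℝ^d)` of `L²(ℝ^d)`: the functions `f` for which the
Fourier multiplier `(1 + |ξ|²)^{s/2}` maps `f` into `L²`. -/
def sobolevSubmodule (d : ℕ) (s : ℝ≥0) : Submodule ℂ (L2 d) where
  carrier := {f | TemperedDistribution.MemSobolev (s : ℝ) 2 (toDistr d f)}
  add_mem' hf hg := by
    simp only [Set.mem_ofPred_eq, map_add] at *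
    exact hf.add hg
  zero_mem' := by
    simp only [Set.mem_ofPred_eq, map_zero]
    exact TemperedDistribution.memSobolev_fun_zero _ _ _ _
  smul_mem' c f hf := by
    simp only [Set.mem_ofPred_eq, map_smul] at *
    exact hf.smul c

/-- The Sobolev space `H^s(ℝ^d)`, `s ≥ 0`, of complex valued functions. -/
def H (d : ℕ) (s : ℝ≥0) : Type := sobolevSubmodule d s

namespace H

instance (d : ℕ) (s : ℝ≥0) : AddCommGroup (H d s) :=
  inferInstanceAs (AddCommGroup (sobolevSubmodule d s))

instance (d : ℕ) (s : ℝ≥0) : Module ℂ (H d s) :=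
  inferInstanceAs (Module ℂ (sobolevSubmodule d s))

/-- The inclusion of `H^s` in `L²`. -/
def toL2 {d : ℕ} {s : ℝ≥0} : H d s →ₗ[ℂ] L2 d := (sobolevSubmodule d s).subtype

theorem toL2_injective {d : ℕ} {s : ℝ≥0} :
    Function.Injective (toL2 : H d s → L2 d) := Subtype.val_injective

theorem memSobolev {d : ℕ} {s : ℝ≥0} (f : H d s) :
    TemperedDistribution.MemSobolev (s : ℝ) 2 (toDistr d (toL2 f)) := f.2

/-- The `L²` function obtained from `f ∈ H^s` by the Fourier multiplier `(1 + |ξ|²)^{s/2}`. -/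
def bessel {d : ℕ} {s : ℝ≥0} (f : H d s) : L2 d := Classical.choose f.memSobolev

theorem toDistr_bessel {d : ℕ} {s : ℝ≥0} (f : H d s) :
    toDistr d f.bessel =
      TemperedDistribution.besselPotential (E d) ℂ (s : ℝ) (toDistr d (toL2 f)) :=
  (Classical.choose_spec f.memSobolev).symm

/-- `bessel` as a linear map. -/
def besselₗ (d : ℕ) (s : ℝ≥0) : H d s →ₗ[ℂ] L2 d where
  toFun := bessel
  map_add' f g := toDistr_injective d (by simp only [toDistr_bessel, map_add])
  map_smul' c f := toDistr_injective d (by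
    simp only [toDistr_bessel, map_smul, RingHom.id_apply])

theorem besselₗ_injective (d : ℕ) (s : ℝ≥0) : Function.Injective (besselₗ d s) := by
  intro f g h
  apply toL2_injective
  apply toDistr_injective d
  have h' : toDistr d f.bessel = toDistr d g.bessel := congrArg (toDistr d) h
  rw [toDistr_bessel, toDistr_bessel] at h'
  have := congrArg (TemperedDistribution.besselPotential (E d) ℂ (-(s : ℝ))) h'
  simpa using this

/-- The norm of `H^s` is `‖f‖ = ‖(1 + |ξ|²)^{s/2} 𝓕 f‖_{L²}` (by Plancherel this is the `L²` norm
of `bessel f`), with the normalization `𝓕 f(ξ) = ∫ e^{-2πi x·ξ} f(x) dx`. Other normalizations give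
an equivalent norm. -/
instance (d : ℕ) (s : ℝ≥0) : NormedAddCommGroup (H d s) :=
  NormedAddCommGroup.induced (H d s) (L2 d) (besselₗ d s) (besselₗ_injective d s)

theorem norm_def {d : ℕ} {s : ℝ≥0} (f : H d s) : ‖f‖ = ‖f.bessel‖ := rfl

instance (d : ℕ) (s : ℝ≥0) : NormedSpace ℂ (H d s) where
  norm_smul_le c f := by
    have h : (c • f).bessel = c • f.bessel := (besselₗ d s).map_smul c f
    rw [norm_def, norm_def, h, norm_smul]

/-- A (representative of the) function `ℝ^d → ℂ` given by an element of `H^s`. -/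
def fn {d : ℕ} {s : ℝ≥0} (f : H d s) : E d → ℂ := (toL2 f : E d → ℂ)

end H

/-- `u ∈ C([-T, T]; H^s)` is a (weak) solution on `[-T, T]` of the Cauchy problem
`i u_t + Δ u + |u|² u = 0`, `u(0) = u₀`: the function `|u|² u` is integrable on `[-T, T] × K` for
every compact `K ⊆ ℝ^d`, and, tested against any `φ ∈ C_c^∞(ℝ^d)`, the equation integrated from
time `0` to time `t` holds for every `t ∈ [-T, T]`. For such `u`, this is the same as `u(0) = u₀`
and the equation in the sense of distributions on `(-T, T) × ℝ^d`. -/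
def IsWeakSolution {d : ℕ} {s : ℝ≥0} {T : ℝ} (hT : 0 < T)
    (u : C(Icc (-T) T, H d s)) (u₀ : H d s) : Prop :=
  let U : ℝ → E d → ℂ := fun τ => (IccExtend (neg_le_self hT.le) u τ).fn
  (∀ K : Set (E d), IsCompact K →
    ∫⁻ τ in Icc (-T) T, ∫⁻ x in K, ‖U τ x‖ₑ ^ 3 < ⊤) ∧
  u ⟨0, by simp [hT.le]⟩ = u₀ ∧
  ∀ φ : E d → ℂ, ContDiff ℝ ∞ φ → HasCompactSupport φ → ∀ t ∈ Icc (-T) T,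
    Complex.I * ((∫ x, U t x * φ x) - ∫ x, u₀.fn x * φ x)
      + ∫ τ in (0 : ℝ)..t, ((∫ x, U τ x * Δ φ x)
        + ∫ x, ((‖U τ x‖ ^ 2 : ℝ) : ℂ) * U τ x * φ x) = 0

/-- Well-posedness of the Cauchy problem `i u_t + Δ u + |u|² u = 0`, `u(0) = u₀`, for data in
`H^s(ℝ^d)`. For every bounded set `B` of `H^s` there are `T > 0`, a Banach space `X` continuously
embedded (by `j`) in `C([-T, T]; H^s)` and a flow map `Φ : B → X` such that `Φ u₀` is the unique
solution with data `u₀` in the class `X`, the flow is continuous from `B` to `C([-T, T]; H^s)`, and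
`H^σ` regularity of the data is propagated for all real `σ ≥ s`. -/
def WellPosed (d : ℕ) (s : ℝ≥0) : Prop :=
  ∀ B : Set (H d s), Bornology.IsBounded B →
    ∃ (T : ℝ) (hT : 0 < T) (X : Type) (_ : NormedAddCommGroup X) (_ : NormedSpace ℝ X)
      (_ : CompleteSpace X) (j : X →L[ℝ] C(Icc (-T) T, H d s)) (Φ : B → X),
      Function.Injective j ∧
      (∀ u₀ : B, IsWeakSolution hT (j (Φ u₀)) u₀ ∧
        ∀ w : X, IsWeakSolution hT (j w) u₀ → w = Φ u₀) ∧
      Continuous (fun u₀ : B => j (Φ u₀)) ∧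
      ∀ (u₀ : B) (σ : ℝ≥0), s ≤ σ →
        (∃ v₀ : H d σ, v₀.toL2 = (u₀ : H d s).toL2) →
        ∃ v : C(Icc (-T) T, H d σ), ∀ t, (v t).toL2 = (j (Φ u₀) t).toL2

/-- `u : [0, t₀] × ℝ^d → ℂ` is a classical solution of `i u_t + Δ u + |u|² u = 0` on `[0, t₀]`
belonging to `C([0, t₀]; H^s)`: `u` is continuously differentiable in `(t, x)`, each `u(t, ·)` is
`C^∞`, the equation holds pointwise (with one-sided time derivatives at the end points), and
`t ↦ u(t, ·)` is the continuous curve `U` in `H^s`. -/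
structure IsSmoothSolution {d : ℕ} {s : ℝ≥0} {t₀ : ℝ} (u : ℝ → E d → ℂ)
    (U : C(Icc 0 t₀, H d s)) : Prop where
  contDiffOn : ContDiffOn ℝ 1 (fun p : ℝ × E d => u p.1 p.2) (Icc 0 t₀ ×ˢ univ)
  contDiff : ∀ t ∈ Icc 0 t₀, ContDiff ℝ ∞ (u t)
  equation : ∀ t ∈ Icc 0 t₀, ∀ x : E d,
    Complex.I * derivWithin (fun τ => u τ x) (Icc 0 t₀) t + Δ (u t) x
      + ((‖u t x‖ ^ 2 : ℝ) : ℂ) * u t x = 0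
  curve : ∀ t : Icc 0 t₀, (U t).fn =ᵐ[volume] u t

end CubicNLS

end

/-! The growth comes from the regime of small dispersion. If `w` solves i w_t + θ Δw + |w|²w = 0,
then u(t,x) = λ w(λ²t, νx) solves (NLS) as soon as θ = ν²/λ². At θ = 0 the equation is an ODE at
each point x; with Gaussian data g its solution is v = exp(it|g|²)g, whose gradient grows linearly
in t while its L² norm is conserved, so the homogeneous Ḣ^s norm of v(t) tends to infinity for every
integer s ≥ 1 (`exists_growth`). For fixed T and small θ, w stays close to v up to time T
(`exists_trajectory_near`). Rescaling multiplies the Ḣ^s norm by λν^{s-d/2}. With ν = m² and λ =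
κm^{d-2s} this factor is κ, while θ = κ⁻²m^{4-2(d-2s)} tends to zero as m grows precisely because d
- 2s > 2, and so does the lifespan T/λ². Choosing κ small, then T large, then m large gives norm
inflation (`exists_norm_inflation`).

The comparison with v takes place in `Spec d`: Fourier transforms are e^{-2|ξ|}(1+|ξ|)^{-d-1} times
a function in C₀. This weight makes the space an algebra under convolution, so the cubic term is
locally Lipschitz, and the free flow S acts by isometries, strongly continuously. In the interaction
picture p = S(-θt)w no unbounded operator is left: Picard–Lindelöf and Grönwall apply. The
exponential decay also gives smoothness and membership in every H^σ.

For ill-posedness, the inflating data tend to zero in H^s and lie in every H^σ. A well-posed flow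
would propagate H^σ regularity with σ large; its solutions would then be bounded and solve the
equation strongly in L², where an energy estimate gives uniqueness (`IsL2Solution.eqOn`). They would
therefore coincide with the inflating solutions, against the continuity of the flow at zero data. -/

namespace CubicNLS

/-! ### Perturbation of an ODE in a Banach space by a group of isometries -/

noncomputable section

section AbstractODE

variable {A : Type*} [NormedAddCommGroup A] [NormedSpace ℝ A]

/-- The radial retraction of a normed space onto the closed ball of radius `R`. -/
def radialRetraction (R : ℝ) (a : A) : A := (R / max R ‖a‖) • a

theorem radialRetraction_of_norm_le {R : ℝ} (hR : 0 < R) {a : A} (ha : ‖a‖ ≤ R) :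
    radialRetraction R a = a := by
  rw [radialRetraction, max_eq_left ha, div_self hR.ne', one_smul]

theorem norm_radialRetraction_le {R : ℝ} (hR : 0 < R) (a : A) : ‖radialRetraction R a‖ ≤ R := by
  have hm : 0 < max R ‖a‖ := lt_max_of_lt_left hR
  rw [radialRetraction, norm_smul, Real.norm_of_nonneg (by positivity), div_mul_eq_mul_div,
    div_le_iff₀ hm]
  exact mul_le_mul_of_nonneg_left (le_max_right _ _) hR.le

/-- Changing the scaling factor and changing the vector cost at most `‖a - b‖` each. This needs no
inner product, whence the constant 2. -/
theorem norm_radialRetraction_sub_le {R : ℝ} (hR : 0 < R) (a b : A) :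
    ‖radialRetraction R a - radialRetraction R b‖ ≤ 2 * ‖a - b‖ := by
  have hma : 0 < max R ‖a‖ := lt_max_of_lt_left hR
  have hmb : 0 < max R ‖b‖ := lt_max_of_lt_left hR
  have h1 : radialRetraction R a - radialRetraction R b
      = (R / max R ‖a‖ - R / max R ‖b‖) • a + (R / max R ‖b‖) • (a - b) := by
    simp only [radialRetraction, sub_smul, smul_sub]; abel
  have h2 : ‖(R / max R ‖b‖) • (a - b)‖ ≤ ‖a - b‖ := by
    rw [norm_smul, Real.norm_of_nonneg (by positivity)]
    refine mul_le_of_le_one_left (norm_nonneg _) ?_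
    rw [div_le_one hmb]; exact le_max_left _ _
  have h3 : ‖(R / max R ‖a‖ - R / max R ‖b‖) • a‖ ≤ ‖a - b‖ := by
    have h4 : |max R ‖b‖ - max R ‖a‖| ≤ ‖a - b‖ := by
      rw [max_comm R, max_comm R, norm_sub_rev]
      exact (abs_max_sub_max_le_abs _ _ _).trans (abs_norm_sub_norm_le b a)
    have h5 : R / max R ‖a‖ - R / max R ‖b‖
        = (R / max R ‖b‖) * ((max R ‖b‖ - max R ‖a‖) / max R ‖a‖) := by
      field_simp
    have h6 : R / max R ‖b‖ ≤ 1 := by rw [div_le_one hmb]; exact le_max_left _ _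
    rw [norm_smul, h5, norm_mul, Real.norm_of_nonneg (by positivity : 0 ≤ R / max R ‖b‖), norm_div,
      Real.norm_eq_abs, Real.norm_of_nonneg hma.le, mul_assoc]
    refine (mul_le_of_le_one_left (by positivity) h6).trans ?_
    rw [div_mul_eq_mul_div, div_le_iff₀ hma]
    exact mul_le_mul h4 (le_max_right _ _) (norm_nonneg _) (norm_nonneg _)
  rw [h1]
  linarith [norm_add_le ((R / max R ‖a‖ - R / max R ‖b‖) • a) ((R / max R ‖b‖) • (a - b))]

/-- Let `S` be a strongly continuous family of isometries, `N` a locally Lipschitz map of cubic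
type, and `v` a solution of `v' = N v`. For small `θ` the equation `p' = S(-θt) N(S(θt) p)`,
`p(0) = v(0)`, has a solution on `[0, T]` that stays close to `v`. -/
theorem exists_trajectory_near [CompleteSpace A] {S : ℝ → A → A}
    (hS : Continuous fun z : ℝ × A => S z.1 z.2)
    (hS_iso : ∀ τ a b, ‖S τ a - S τ b‖ = ‖a - b‖) (hS_norm : ∀ τ a, ‖S τ a‖ = ‖a‖)
    (hS_zero : ∀ a, S 0 a = a) {N : A → A} {C : ℝ} (hC : 0 ≤ C) (hN0 : N 0 = 0)
    (hN : ∀ a b, ‖N a - N b‖ ≤ C * (‖a‖ + ‖b‖) ^ 2 * ‖a - b‖)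
    {v : ℝ → A} (hv : ∀ t, HasDerivAt v (N (v t)) t) {T η : ℝ} (hT : 0 < T) (hη : 0 < η) :
    ∃ θ₀ > 0, ∀ θ ∈ Icc 0 θ₀, ∃ p p' : ℝ → A, p 0 = v 0 ∧
      ContinuousOn p' (Ioo (-1) (T + 1)) ∧
      (∀ t ∈ Ioo (-1) (T + 1), HasDerivAt p (p' t) t) ∧
      (∀ t ∈ Icc 0 T, p' t = S (-(θ * t)) (N (S (θ * t) (p t)))) ∧
      ‖p T - v T‖ ≤ η := by
  have hvc : Continuous v := continuous_iff_continuousAt.2 fun t => (hv t).continuousAt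
  obtain ⟨R₀, hR₀⟩ := (isCompact_Icc (a := (0 : ℝ)) (b := T)).exists_bound_of_continuousOn
    hvc.continuousOn
  -- The margin 1 leaves room for a trajectory within distance 1 of `v`: the truncation of `N` at
  -- radius `R` is inactive there, although it makes `N` bounded and globally Lipschitz.
  set R : ℝ := |R₀| + 1 with hRdef
  have hR : 0 < R := by positivity
  have hvR : ∀ t ∈ Icc 0 T, ‖v t‖ + 1 ≤ R := fun t ht => by
    have := hR₀ t ht
    have := le_abs_self R₀
    linarith
  let M : A → A := fun a => N (radialRetraction R a)
  have hM_eq : ∀ a, ‖a‖ ≤ R → M a = N a := fun a ha => by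
    simp only [M, radialRetraction_of_norm_le hR ha]
  set K : ℝ := C * (R + R) ^ 2 * 2 with hK
  have hK0 : 0 ≤ K := by positivity
  have hM_lip : ∀ a b, ‖M a - M b‖ ≤ K * ‖a - b‖ := fun a b => by
    refine (hN _ _).trans ?_
    have h1 := norm_radialRetraction_sub_le hR a b
    have h2 := norm_radialRetraction_le hR a
    have h3 := norm_radialRetraction_le hR b
    calc C * (‖radialRetraction R a‖ + ‖radialRetraction R b‖) ^ 2
          * ‖radialRetraction R a - radialRetraction R b‖
        ≤ C * (R + R) ^ 2 * (2 * ‖a - b‖) := by gcongr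
      _ = K * ‖a - b‖ := by rw [hK]; ring
  have hM_bd : ∀ a, ‖M a‖ ≤ C * R ^ 2 * R := fun a => by
    have := hN (radialRetraction R a) 0
    rw [hN0, sub_zero, norm_zero, sub_zero, add_zero] at this
    have h2 := norm_radialRetraction_le hR a
    exact this.trans (by gcongr)
  have hM_cont : Continuous M := by
    refine (LipschitzWith.of_dist_le_mul (K := ⟨K, hK0⟩) fun a b => ?_).continuous
    rw [dist_eq_norm, dist_eq_norm]
    exact hM_lip a b
  let F : ℝ → ℝ → A → A := fun θ t a => S (-(θ * t)) (M (S (θ * t) a))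
  have hF_cont : Continuous fun z : ℝ × ℝ × A => F z.1 z.2.1 z.2.2 := by
    have h1 : Continuous fun z : ℝ × ℝ × A => M (S (z.1 * z.2.1) z.2.2) :=
      hM_cont.comp (hS.comp (by fun_prop : Continuous fun z : ℝ × ℝ × A => (z.1 * z.2.1, z.2.2)))
    exact hS.comp ((by fun_prop : Continuous fun z : ℝ × ℝ × A => -(z.1 * z.2.1)).prodMk h1)
  have hF_lip : ∀ θ t, LipschitzWith ⟨K, hK0⟩ (F θ t) := fun θ t => by
    refine LipschitzWith.of_dist_le_mul fun a b => ?_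
    simp only [dist_eq_norm, F, hS_iso]
    exact (hM_lip _ _).trans (by rw [hS_iso]; exact le_rfl)
  have hF_bd : ∀ θ t a, ‖F θ t a‖ ≤ C * R ^ 2 * R := fun θ t a => by
    simp only [F, hS_norm]; exact hM_bd _
  -- the defect of `v`
  obtain ⟨ε, hε0, hε⟩ : ∃ ε > 0, gronwallBound 0 K (0 + ε) T ≤ min η 1 := by
    have h1 : Tendsto (fun ε => gronwallBound 0 K (0 + ε) T) (𝓝[>] 0) (𝓝 0) := by
      have := (gronwallBound_continuous_ε 0 K T).tendsto 0
      rw [gronwallBound_ε0_δ0] at this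
      simpa only [zero_add] using this.mono_left nhdsWithin_le_nhds
    have h2 : ∀ᶠ ε in 𝓝[>] (0 : ℝ), gronwallBound 0 K (0 + ε) T ≤ min η 1 :=
      h1.eventually_le_const (by positivity)
    obtain ⟨ε, h3, h4⟩ := (h2.and self_mem_nhdsWithin).exists
    exact ⟨ε, h4, h3⟩
  -- At `θ = 0` both maps agree since `S 0` is the identity. The tube lemma over the compact time
  -- interval makes the defect small uniformly in `t`, with strong continuity of `S` only.
  obtain ⟨θ₀, hθ₀, hdef⟩ : ∃ θ₀ > 0, ∀ θ ∈ Icc 0 θ₀, ∀ t ∈ Icc 0 T,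
      ‖M (v t) - F θ t (v t)‖ ≤ ε := by
    let G : ℝ × ℝ → ℝ := fun z => ‖M (v z.2) - F z.1 z.2 (v z.2)‖
    have hG : Continuous G := by
      refine (Continuous.sub (hM_cont.comp (hvc.comp continuous_snd)) ?_).norm
      exact hF_cont.comp (by fun_prop : Continuous fun z : ℝ × ℝ => (z.1, z.2, v z.2))
    have hsub : ({0} : Set ℝ) ×ˢ Icc 0 T ⊆ G ⁻¹' Iio ε := by
      rintro ⟨θ, t⟩ ⟨h1, -⟩
      simp only [mem_singleton_iff] at h1
      simp [G, F, h1, hS_zero, hε0]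
    obtain ⟨U, V, hU, -, h0U, hV, hUV⟩ := generalized_tube_lemma isCompact_singleton isCompact_Icc
      (isOpen_Iio.preimage hG) hsub
    obtain ⟨δ, hδ, hball⟩ := Metric.isOpen_iff.1 hU 0 (h0U rfl)
    refine ⟨δ / 2, by positivity, fun θ hθ t ht => ?_⟩
    have : (θ, t) ∈ U ×ˢ V := ⟨hball (by
      rw [Metric.mem_ball, Real.dist_eq, sub_zero, abs_of_nonneg hθ.1]; linarith [hθ.2]), hV ht⟩
    exact (hUV this).le
  refine ⟨θ₀, hθ₀, fun θ hθ => ?_⟩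
  set L : ℝ := C * R ^ 2 * R with hL
  have hL0 : 0 ≤ L := by positivity
  -- The interval is wider than `[0, T]` so that derivatives on `[0, T]` are two-sided. The speed is
  -- at most `L`, so the radius `L * (T + 1)` is never exceeded.
  have hpl : IsPicardLindelof (F θ) (tmin := -1) (tmax := T + 1) ⟨0, by constructor <;> linarith⟩
      (v 0) ⟨L * (T + 1), by positivity⟩ 0 ⟨L, hL0⟩ ⟨K, hK0⟩ :=
    { lipschitzOnWith := fun t _ => (hF_lip θ t).lipschitzOnWith
      continuousOn := fun a _ =>
        (hF_cont.comp (by fun_prop : Continuous fun t : ℝ => (θ, t, a))).continuousOn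
      norm_le := fun t _ a _ => hF_bd θ t a
      mul_max_le := by
        simp only [NNReal.coe_zero, sub_zero, zero_sub, neg_neg]
        rw [max_eq_left (by linarith)]
        exact le_rfl }
  obtain ⟨p, hp0, hp⟩ := hpl.exists_eq_forall_mem_Icc_hasDerivWithinAt₀
  have hp_at : ∀ t ∈ Ioo (-1) (T + 1), HasDerivAt p (F θ t (p t)) t := fun t ht =>
    (hp t (Ioo_subset_Icc_self ht)).hasDerivAt (Icc_mem_nhds ht.1 ht.2)
  have hp_cont : ContinuousOn p (Ioo (-1) (T + 1)) := fun t ht =>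
    (hp_at t ht).continuousAt.continuousWithinAt
  have hsub : Icc 0 T ⊆ Ioo (-1) (T + 1) := fun t ht => ⟨by linarith [ht.1], by linarith [ht.2]⟩
  -- Grönwall, with `p` exact and `v` solving up to the defect `ε`. The bound `η` is the one wanted;
  -- the bound 1 keeps `p` where `M = N`.
  have hdist : ∀ t ∈ Icc 0 T, ‖p t - v t‖ ≤ min η 1 := fun t ht => by
    have h1 := dist_le_of_approx_trajectories_ODE (v := F θ) (K := ⟨K, hK0⟩) (f := p) (g := v)
      (f' := fun t => F θ t (p t)) (g' := fun t => N (v t)) (a := 0) (b := T) (εf := 0) (εg := ε)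
      (δ := 0) (fun t => hF_lip θ t) (hp_cont.mono hsub)
      (fun t ht => (hp_at t (hsub (Ico_subset_Icc_self ht))).hasDerivWithinAt)
      (fun t _ => by rw [dist_self]) hvc.continuousOn (fun t _ => (hv t).hasDerivWithinAt)
      (fun t ht => by
        have h2 := hvR t (Ico_subset_Icc_self ht)
        rw [← hM_eq (v t) (by linarith), dist_eq_norm]
        exact hdef θ hθ t (Ico_subset_Icc_self ht))
      (by rw [hp0, dist_self]) t ht
    rw [dist_eq_norm, sub_zero] at h1
    refine (h1.trans ?_).trans hε
    exact gronwallBound_mono le_rfl (by positivity) hK0 ht.2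
  refine ⟨p, fun t => F θ t (p t), hp0, ?_, hp_at, fun t ht => ?_,
    (hdist T ⟨hT.le, le_rfl⟩).trans (min_le_left _ _)⟩
  · exact hF_cont.comp_continuousOn (continuousOn_const.prodMk (continuousOn_id.prodMk hp_cont))
  · have h1 : ‖S (θ * t) (p t)‖ ≤ R := by
      rw [hS_norm]
      have h2 := (hdist t ht).trans (min_le_right _ _)
      have h3 := hvR t ht
      have h4 := norm_le_norm_sub_add (p t) (v t)
      linarith
    simp only [F, hM_eq _ h1]

end AbstractODE

end


/-! ### Differentiability in sup norm of weighted oscillating exponentials -/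

noncomputable section

open scoped ZeroAtInfty BoundedContinuousFunction

section OscillatingExponential

theorem norm_cexp_I_mul_ofReal (a : ℝ) : ‖Complex.exp (Complex.I * a)‖ = 1 := by
  rw [mul_comm]; exact Complex.norm_exp_ofReal_mul_I a

theorem norm_cexp_I_mul_sub_le (a b : ℝ) :
    ‖Complex.exp (Complex.I * a) - Complex.exp (Complex.I * b)‖ ≤ |a - b| := by
  have h : Complex.exp (Complex.I * a) - Complex.exp (Complex.I * b)
      = Complex.exp (Complex.I * b) * (Complex.exp (Complex.I * ((a - b : ℝ) : ℂ)) - 1) := by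
    rw [mul_sub, ← Complex.exp_add]; push_cast; ring_nf
  rw [h, norm_mul, norm_cexp_I_mul_ofReal, one_mul]
  exact Real.norm_exp_I_mul_ofReal_sub_one_le

/-- Taylor's formula covers `|a| ≤ 1`; for `|a| > 1` the trivial bound `2|a|` is at most `2a²`. -/
theorem norm_cexp_I_mul_sub_one_sub_le (a : ℝ) :
    ‖Complex.exp (Complex.I * a) - 1 - Complex.I * a‖ ≤ 2 * a ^ 2 := by
  have hn : ‖Complex.I * (a : ℂ)‖ = |a| := by simp
  rcases le_or_gt |a| 1 with h | h
  · have := Complex.norm_exp_sub_one_sub_id_le (x := Complex.I * a) (by rw [hn]; exact h)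
    rw [hn, sq_abs] at this
    nlinarith [sq_nonneg a]
  · have h1 : ‖Complex.exp (Complex.I * a) - 1‖ ≤ |a| := Real.norm_exp_I_mul_ofReal_sub_one_le
    have h2 := norm_sub_le (Complex.exp (Complex.I * a) - 1) (Complex.I * a)
    rw [hn] at h2
    nlinarith [sq_abs a]

variable {X V : Type*} [NormedAddCommGroup V] [NormedSpace ℝ V] {θ : X → V →L[ℝ] ℝ} {w : X → ℝ}
  {B : ℝ}

theorem norm_oscExpDeriv_apply_le (hB : ∀ j ≤ 2, ∀ ξ, ‖θ ξ‖ ^ j * |w ξ| ≤ B) (z δ : V) (ξ : X) :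
    ‖Complex.I * (θ ξ δ : ℝ) * (Complex.exp (Complex.I * (θ ξ z : ℝ)) * w ξ)‖ ≤ B * ‖δ‖ := by
  rw [norm_mul, norm_mul, norm_mul, norm_cexp_I_mul_ofReal, one_mul, Complex.norm_I,
    one_mul, Complex.norm_real, Complex.norm_real, Real.norm_eq_abs, Real.norm_eq_abs]
  have h1 := hB 1 (by norm_num) ξ
  rw [pow_one] at h1
  calc |θ ξ δ| * |w ξ| ≤ ‖θ ξ‖ * ‖δ‖ * |w ξ| := by
        gcongr; exact (θ ξ).le_opNorm δ
    _ = ‖θ ξ‖ * |w ξ| * ‖δ‖ := by ring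
    _ ≤ B * ‖δ‖ := by gcongr

theorem oscExp_bound_nonneg [Nonempty X] (hB : ∀ j ≤ 2, ∀ ξ, ‖θ ξ‖ ^ j * |w ξ| ≤ B) : 0 ≤ B := by
  obtain ⟨ξ⟩ := ‹Nonempty X›
  exact (by positivity : (0 : ℝ) ≤ ‖θ ξ‖ ^ 0 * |w ξ|).trans (hB 0 (by norm_num) ξ)

variable [TopologicalSpace X]

/-- The weighted exponential `ξ ↦ w(ξ) e^{i θ(ξ) z}`. -/
def oscExp (hθ : Continuous θ) (hw : Continuous w) (hB : ∀ j ≤ 2, ∀ ξ, ‖θ ξ‖ ^ j * |w ξ| ≤ B)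
    (z : V) : X →ᵇ ℂ :=
  BoundedContinuousFunction.ofNormedAddCommGroup
    (fun ξ => Complex.exp (Complex.I * (θ ξ z : ℝ)) * w ξ) (by fun_prop) B (fun ξ => by
      rw [norm_mul, norm_cexp_I_mul_ofReal, one_mul, Complex.norm_real, Real.norm_eq_abs]
      simpa using hB 0 (by norm_num) ξ)

@[simp]
theorem oscExp_apply (hθ : Continuous θ) (hw : Continuous w)
    (hB : ∀ j ≤ 2, ∀ ξ, ‖θ ξ‖ ^ j * |w ξ| ≤ B) (z : V) (ξ : X) :
    oscExp hθ hw hB z ξ = Complex.exp (Complex.I * (θ ξ z : ℝ)) * w ξ := rfl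

variable [Nonempty X]

/-- The derivative of `oscExp`. -/
def oscExpDeriv (hθ : Continuous θ) (hw : Continuous w)
    (hB : ∀ j ≤ 2, ∀ ξ, ‖θ ξ‖ ^ j * |w ξ| ≤ B) (z : V) : V →L[ℝ] X →ᵇ ℂ :=
  LinearMap.mkContinuous
    { toFun := fun δ => BoundedContinuousFunction.ofNormedAddCommGroup
        (fun ξ => Complex.I * (θ ξ δ : ℝ) * (Complex.exp (Complex.I * (θ ξ z : ℝ)) * w ξ))
        (by fun_prop) (B * ‖δ‖) (norm_oscExpDeriv_apply_le hB z δ)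
      map_add' := fun a b => by
        ext ξ
        simp only [BoundedContinuousFunction.coe_ofNormedAddCommGroup,
          BoundedContinuousFunction.coe_add, Pi.add_apply, map_add, Complex.ofReal_add]
        ring
      map_smul' := fun c a => by
        ext ξ
        simp only [BoundedContinuousFunction.coe_ofNormedAddCommGroup,
          BoundedContinuousFunction.coe_smul, map_smul, smul_eq_mul, Complex.ofReal_mul,
          RingHom.id_apply, Complex.real_smul]
        ring }
    B (fun δ => (BoundedContinuousFunction.norm_le
      (mul_nonneg (oscExp_bound_nonneg hB) (norm_nonneg _))).2 (norm_oscExpDeriv_apply_le hB z δ))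

variable (hθ : Continuous θ) (hw : Continuous w) (hB : ∀ j ≤ 2, ∀ ξ, ‖θ ξ‖ ^ j * |w ξ| ≤ B)

@[simp]
theorem oscExpDeriv_apply (z δ : V) (ξ : X) : oscExpDeriv hθ hw hB z δ ξ
    = Complex.I * (θ ξ δ : ℝ) * (Complex.exp (Complex.I * (θ ξ z : ℝ)) * w ξ) := rfl

/-- The second-order Taylor remainder costs two factors of the phase, which the weight absorbs
uniformly in `ξ`. This is why the hypothesis controls the moments `j ≤ 2`. -/
theorem hasFDerivAt_oscExp (z : V) :
    HasFDerivAt (oscExp hθ hw hB) (oscExpDeriv hθ hw hB z) z := by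
  have hB0 := oscExp_bound_nonneg hB
  refine HasFDerivAt.of_isLittleO ?_
  have h : (fun y => oscExp hθ hw hB y - oscExp hθ hw hB z - oscExpDeriv hθ hw hB z (y - z))
      =O[𝓝 z] fun y => ‖y - z‖ ^ 2 := by
    refine Asymptotics.IsBigO.of_bound (2 * B) (Eventually.of_forall fun y => ?_)
    rw [norm_pow, norm_norm, BoundedContinuousFunction.norm_le (by positivity)]
    intro ξ
    have h1 : (oscExp hθ hw hB y - oscExp hθ hw hB z - oscExpDeriv hθ hw hB z (y - z)) ξ
        = Complex.exp (Complex.I * (θ ξ z : ℝ)) * w ξ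
          * (Complex.exp (Complex.I * (θ ξ (y - z) : ℝ)) - 1 - Complex.I * (θ ξ (y - z) : ℝ)) := by
      have h2 : Complex.exp (Complex.I * (θ ξ y : ℝ)) = Complex.exp (Complex.I * (θ ξ z : ℝ))
          * Complex.exp (Complex.I * (θ ξ (y - z) : ℝ)) := by
        rw [← Complex.exp_add, map_sub]; push_cast; ring_nf
      simp only [BoundedContinuousFunction.coe_sub, Pi.sub_apply, oscExp_apply,
        oscExpDeriv_apply, h2]
      ring
    rw [h1, norm_mul, norm_mul, norm_cexp_I_mul_ofReal, one_mul, Complex.norm_real,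
      Real.norm_eq_abs]
    have h3 := (θ ξ).le_opNorm (y - z)
    calc |w ξ| * _ ≤ |w ξ| * (2 * (θ ξ (y - z)) ^ 2) := by
          gcongr; exact norm_cexp_I_mul_sub_one_sub_le _
      _ = |w ξ| * (2 * ‖θ ξ (y - z)‖ ^ 2) := by rw [Real.norm_eq_abs, sq_abs]
      _ ≤ |w ξ| * (2 * (‖θ ξ‖ * ‖y - z‖) ^ 2) := by gcongr
      _ = 2 * (‖θ ξ‖ ^ 2 * |w ξ|) * ‖y - z‖ ^ 2 := by ring
      _ ≤ 2 * B * ‖y - z‖ ^ 2 := by gcongr; exact hB 2 le_rfl ξ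
  refine h.trans_isLittleO ?_
  have h4 : (fun y : V => ‖y - z‖ ^ 2) =o[𝓝 z] fun y => ‖y - z‖ := by
    have : Tendsto (fun y : V => ‖y - z‖) (𝓝 z) (𝓝 0) := by
      have : Continuous fun y : V => ‖y - z‖ := by fun_prop
      simpa using this.tendsto z
    exact (Asymptotics.isLittleO_pow_id one_lt_two).comp_tendsto this
  exact h4.of_norm_right

theorem continuous_oscExpDeriv : Continuous (oscExpDeriv hθ hw hB) := by
  have hB0 := oscExp_bound_nonneg hB
  refine (LipschitzWith.of_dist_le_mul (K := ⟨B, hB0⟩) fun z y => ?_).continuous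
  rw [dist_eq_norm, dist_eq_norm]
  refine ContinuousLinearMap.opNorm_le_bound _ (mul_nonneg hB0 (norm_nonneg _)) fun δ => ?_
  refine (BoundedContinuousFunction.norm_le
    (mul_nonneg (mul_nonneg hB0 (norm_nonneg _)) (norm_nonneg _))).2 fun ξ => ?_
  have h1 : (oscExpDeriv hθ hw hB z - oscExpDeriv hθ hw hB y) δ ξ = Complex.I * (θ ξ δ : ℝ)
      * ((Complex.exp (Complex.I * (θ ξ z : ℝ)) - Complex.exp (Complex.I * (θ ξ y : ℝ))) * w ξ) := by
    simp only [sub_apply, BoundedContinuousFunction.coe_sub, Pi.sub_apply,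
      oscExpDeriv_apply]
    ring
  rw [h1, norm_mul, norm_mul, norm_mul, Complex.norm_I, one_mul, Complex.norm_real,
    Complex.norm_real, Real.norm_eq_abs (w ξ)]
  have h2 : ‖Complex.exp (Complex.I * (θ ξ z : ℝ)) - Complex.exp (Complex.I * (θ ξ y : ℝ))‖
      ≤ ‖θ ξ‖ * ‖z - y‖ := by
    refine (norm_cexp_I_mul_sub_le _ _).trans ?_
    rw [← map_sub]
    exact (θ ξ).le_opNorm _
  calc _ ≤ ‖θ ξ‖ * ‖δ‖ * (‖θ ξ‖ * ‖z - y‖ * |w ξ|) := by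
        gcongr; exact (θ ξ).le_opNorm δ
    _ = ‖θ ξ‖ ^ 2 * |w ξ| * (‖z - y‖ * ‖δ‖) := by ring
    _ ≤ B * (‖z - y‖ * ‖δ‖) := by gcongr; exact hB 2 le_rfl ξ
    _ = B * ‖z - y‖ * ‖δ‖ := by ring

end OscillatingExponential

end


/-! ### The convolution algebra of spectral densities -/

noncomputable section

open scoped ZeroAtInfty BoundedContinuousFunction FourierTransform

variable {d : ℕ}

/-- The space of renormalized spectral densities: `h` stands for the function whose Fourier
transform is `specWeight * h`. -/
def Spec (d : ℕ) : Type := C₀(E d, ℂ)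

namespace Spec

instance : NormedAddCommGroup (Spec d) := inferInstanceAs (NormedAddCommGroup C₀(E d, ℂ))

instance : NormedSpace ℂ (Spec d) := inferInstanceAs (NormedSpace ℂ C₀(E d, ℂ))

instance : CompleteSpace (Spec d) := inferInstanceAs (CompleteSpace C₀(E d, ℂ))

instance : FunLike (Spec d) (E d) ℂ := inferInstanceAs (FunLike C₀(E d, ℂ) (E d) ℂ)

/-- Constructor for elements of `Spec d`. -/
def mk (f : E d → ℂ) (hf : Continuous f) (h0 : Tendsto f (cocompact (E d)) (𝓝 0)) : Spec d :=
  (⟨⟨f, hf⟩, h0⟩ : C₀(E d, ℂ))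

@[ext]
theorem ext {a b : Spec d} (h : ∀ ξ, a ξ = b ξ) : a = b := DFunLike.ext a b h

@[simp]
theorem add_apply (a b : Spec d) (ξ : E d) : (a + b) ξ = a ξ + b ξ := rfl

@[simp]
theorem sub_apply (a b : Spec d) (ξ : E d) : (a - b) ξ = a ξ - b ξ := rfl

@[simp]
theorem smul_apply (c : ℂ) (a : Spec d) (ξ : E d) : (c • a) ξ = c * a ξ := rfl

@[fun_prop]
theorem continuous (a : Spec d) : Continuous a := ContinuousMap.continuous a.toContinuousMap

theorem tendsto_zero (a : Spec d) : Tendsto a (cocompact (E d)) (𝓝 0) := a.zero_at_infty'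

theorem norm_apply_le (a : Spec d) (ξ : E d) : ‖a ξ‖ ≤ ‖a‖ :=
  BoundedContinuousFunction.norm_coe_le_norm (ZeroAtInftyContinuousMap.toBCF a) ξ

theorem norm_le {a : Spec d} {C : ℝ} (hC : 0 ≤ C) : ‖a‖ ≤ C ↔ ∀ ξ, ‖a ξ‖ ≤ C :=
  BoundedContinuousFunction.norm_le (f := ZeroAtInftyContinuousMap.toBCF a) hC

end Spec

/-- Multiplication by bounded continuous functions, as a continuous bilinear map. -/
def mulOp : (E d →ᵇ ℂ) →L[ℂ] Spec d →L[ℂ] Spec d :=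
  LinearMap.mkContinuous₂
    (LinearMap.mk₂ ℂ
      (fun m f => Spec.mk (fun ξ => m ξ * f ξ) (m.continuous.mul f.continuous) (by
        refine squeeze_zero_norm (a := fun ξ => ‖m‖ * ‖f ξ‖) (fun ξ => ?_) ?_
        · rw [norm_mul]
          exact mul_le_mul_of_nonneg_right (m.norm_coe_le_norm ξ) (norm_nonneg _)
        · simpa using (tendsto_zero_iff_norm_tendsto_zero.1 f.tendsto_zero).const_mul ‖m‖))
      (fun m m' f => by ext ξ; exact add_mul _ _ _)
      (fun c m f => by ext ξ; exact mul_assoc _ _ _)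
      (fun m f g => by ext ξ; exact mul_add _ _ _)
      (fun c m f => by ext ξ; exact mul_left_comm _ _ _)) 1
    (fun m f => by
      rw [one_mul, Spec.norm_le (by positivity)]
      intro ξ
      refine (norm_mul_le _ _).trans ?_
      exact mul_le_mul (m.norm_coe_le_norm ξ) (f.norm_apply_le ξ) (norm_nonneg _)
        (norm_nonneg _))

@[simp]
theorem mulOp_apply (m : E d →ᵇ ℂ) (f : Spec d) (ξ : E d) : mulOp m f ξ = m ξ * f ξ := rfl

/-- An integrable polynomial weight. -/
def polyWeight (ξ : E d) : ℝ := ((1 + ‖ξ‖) ^ (d + 1))⁻¹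

/-- An exponentially decaying weight, whose inverse is comparable with a submultiplicative
function. -/
def specWeight (ξ : E d) : ℝ := Real.exp (-2 * ‖ξ‖) * polyWeight ξ

theorem polyWeight_pos (ξ : E d) : 0 < polyWeight ξ := by unfold polyWeight; positivity

theorem polyWeight_le_one (ξ : E d) : polyWeight ξ ≤ 1 :=
  inv_le_one_of_one_le₀ (one_le_pow₀ (by linarith [norm_nonneg ξ]))

theorem specWeight_pos (ξ : E d) : 0 < specWeight ξ :=
  mul_pos (Real.exp_pos _) (polyWeight_pos ξ)

theorem specWeight_le_polyWeight (ξ : E d) : specWeight ξ ≤ polyWeight ξ :=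
  mul_le_of_le_one_left (polyWeight_pos ξ).le
    (Real.exp_le_one_iff.2 (by linarith [norm_nonneg ξ]))

@[fun_prop]
theorem continuous_polyWeight : Continuous (polyWeight (d := d)) :=
  Continuous.inv₀ (by fun_prop) fun ξ => by positivity

@[fun_prop]
theorem continuous_specWeight : Continuous (specWeight (d := d)) := by
  unfold specWeight; fun_prop

theorem specWeight_neg (ξ : E d) : specWeight (-ξ) = specWeight ξ := by
  simp [specWeight, polyWeight]

theorem integrable_polyWeight : Integrable (polyWeight (d := d)) := by
  have h := integrable_one_add_norm (E := E d) (μ := volume) (r := (d + 1 : ℕ))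
    (by simp)
  refine h.congr (Eventually.of_forall fun ξ => ?_)
  simp only [polyWeight]
  rw [Real.rpow_neg (by positivity), Real.rpow_natCast]

/-- The exponential factor is handled by the triangle inequality, the polynomial one by convexity of
the power `d + 1`, which produces `2 ^ d`. Since `polyWeight` is integrable, integrating in `η`
yields the algebra property. -/
theorem specWeight_mul_specWeight_sub_le (ξ η : E d) : specWeight η * specWeight (ξ - η)
    ≤ 2 ^ d * specWeight ξ * (polyWeight η + polyWeight (ξ - η)) := by
  have h1 : ‖ξ‖ ≤ ‖η‖ + ‖ξ - η‖ := by
    simpa using norm_add_le η (ξ - η)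
  have h2 : polyWeight η * polyWeight (ξ - η)
      ≤ 2 ^ d * polyWeight ξ * (polyWeight η + polyWeight (ξ - η)) := by
    simp only [polyWeight]
    set a := 1 + ‖η‖ with ha
    set c := 1 + ‖ξ - η‖ with hc
    have ha0 : 0 < a := by positivity
    have hc0 : 0 < c := by positivity
    have h3 : (1 + ‖ξ‖) ^ (d + 1) ≤ 2 ^ d * (a ^ (d + 1) + c ^ (d + 1)) := by
      refine (pow_le_pow_left₀ (by positivity) (?_ : 1 + ‖ξ‖ ≤ a + c) _).trans
        (add_pow_le ha0.le hc0.le (d + 1))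
      linarith
    have h4 : (0 : ℝ) < (1 + ‖ξ‖) ^ (d + 1) := by positivity
    have h5 : 2 ^ d * ((1 + ‖ξ‖) ^ (d + 1))⁻¹ * ((a ^ (d + 1))⁻¹ + (c ^ (d + 1))⁻¹)
        = (2 ^ d * (a ^ (d + 1) + c ^ (d + 1))) / (1 + ‖ξ‖) ^ (d + 1)
          * ((a ^ (d + 1))⁻¹ * (c ^ (d + 1))⁻¹) := by
      field_simp
      ring
    rw [h5]
    exact le_mul_of_one_le_left (by positivity) ((one_le_div h4).2 h3)
  have h6 : Real.exp (-2 * ‖η‖) * Real.exp (-2 * ‖ξ - η‖) ≤ Real.exp (-2 * ‖ξ‖) := by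
    rw [← Real.exp_add]; exact Real.exp_le_exp.2 (by linarith)
  have h7 := (polyWeight_pos η).le
  have h8 := (polyWeight_pos (ξ - η)).le
  calc specWeight η * specWeight (ξ - η)
      = (Real.exp (-2 * ‖η‖) * Real.exp (-2 * ‖ξ - η‖)) * (polyWeight η * polyWeight (ξ - η)) := by
        simp only [specWeight]; ring
    _ ≤ Real.exp (-2 * ‖ξ‖) * (2 ^ d * polyWeight ξ * (polyWeight η + polyWeight (ξ - η))) := by
        gcongr
    _ = _ := by simp only [specWeight]; ring

/-- The spectral density represented by `h`. -/
def density (h : Spec d) (ξ : E d) : ℂ := specWeight ξ * h ξ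

@[fun_prop]
theorem continuous_density (h : Spec d) : Continuous (density h) :=
  (Complex.continuous_ofReal.comp continuous_specWeight).mul h.continuous

theorem norm_density (h : Spec d) (ξ : E d) : ‖density h ξ‖ = specWeight ξ * ‖h ξ‖ := by
  rw [density, norm_mul, Complex.norm_real, Real.norm_of_nonneg (specWeight_pos ξ).le]

theorem norm_density_le (h : Spec d) (ξ : E d) : ‖density h ξ‖ ≤ ‖h‖ * specWeight ξ := by
  rw [norm_density, mul_comm]
  exact mul_le_mul_of_nonneg_right (Spec.norm_apply_le h ξ) (specWeight_pos ξ).le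

theorem integrable_density (h : Spec d) : Integrable (density h) := by
  refine (integrable_polyWeight.const_mul ‖h‖).mono' (by fun_prop) (Eventually.of_forall fun ξ => ?_)
  exact (norm_density_le h ξ).trans
    (mul_le_mul_of_nonneg_left (specWeight_le_polyWeight ξ) (norm_nonneg _))

theorem density_injective {a b : Spec d} (h : density a = density b) : a = b := by
  ext ξ
  have := congrFun h ξ
  have hw : (specWeight ξ : ℂ) ≠ 0 := by exact_mod_cast (specWeight_pos ξ).ne'
  exact mul_left_cancel₀ hw this

/-- The integral that controls convolutions of elements of `Spec d`. -/
def polyAverage (b : Spec d) (ξ : E d) : ℝ := ∫ η, polyWeight η * ‖b (ξ - η)‖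

theorem integrable_polyWeight_mul_norm (b : Spec d) (ξ : E d) :
    Integrable fun η => polyWeight η * ‖b (ξ - η)‖ := by
  refine (integrable_polyWeight.mul_const ‖b‖).mono'
    (Continuous.aestronglyMeasurable (by fun_prop)) (Eventually.of_forall fun η => ?_)
  rw [norm_mul, norm_norm, Real.norm_of_nonneg (polyWeight_pos η).le]
  exact mul_le_mul_of_nonneg_left (Spec.norm_apply_le b _) (polyWeight_pos η).le

theorem polyAverage_le (b : Spec d) (ξ : E d) :
    polyAverage b ξ ≤ (∫ η : E d, polyWeight η) * ‖b‖ := by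
  rw [← integral_mul_const]
  exact integral_mono (integrable_polyWeight_mul_norm b ξ) (integrable_polyWeight.mul_const _)
    fun η => mul_le_mul_of_nonneg_left (Spec.norm_apply_le b _) (polyWeight_pos η).le

/-- Dominated convergence along the cocompact filter, which is countably generated. It keeps
convolutions in C₀, not merely bounded. -/
theorem tendsto_polyAverage (b : Spec d) :
    Tendsto (polyAverage b) (cocompact (E d)) (𝓝 0) := by
  have h0 : (∫ η : E d, polyWeight η * (0 : ℝ)) = 0 := by simp
  have : (cocompact (E d)).IsCountablyGenerated := by
    rw [← Metric.cobounded_eq_cocompact, ← comap_norm_atTop]; infer_instance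
  rw [← h0]
  refine tendsto_integral_filter_of_dominated_convergence (fun η => polyWeight η * ‖b‖)
    (Eventually.of_forall fun ξ => (integrable_polyWeight_mul_norm b ξ).aestronglyMeasurable)
    (Eventually.of_forall fun ξ => Eventually.of_forall fun η => ?_)
    (integrable_polyWeight.mul_const _) (Eventually.of_forall fun η => ?_)
  · rw [norm_mul, norm_norm, Real.norm_of_nonneg (polyWeight_pos η).le]
    exact mul_le_mul_of_nonneg_left (Spec.norm_apply_le b _) (polyWeight_pos η).le
  · refine Tendsto.const_mul _ ?_
    have h1 : Tendsto (fun ξ : E d => ξ - η) (cocompact _) (cocompact _) :=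
      (Homeomorph.subRight η).isClosedEmbedding.tendsto_cocompact
    exact tendsto_zero_iff_norm_tendsto_zero.1 (b.tendsto_zero.comp h1)

/-- The convolution of two spectral densities. -/
def convDensity (a b : Spec d) (ξ : E d) : ℂ := ∫ η, density a η * density b (ξ - η)

theorem integrable_density_mul_density (a b : Spec d) (ξ : E d) :
    Integrable fun η => density a η * density b (ξ - η) := by
  refine ((integrable_density a).norm.mul_const ‖b‖).mono'
    (Continuous.aestronglyMeasurable (by fun_prop)) (Eventually.of_forall fun η => ?_)
  rw [norm_mul]
  refine mul_le_mul_of_nonneg_left ((norm_density_le b _).trans ?_) (norm_nonneg _)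
  exact mul_le_of_le_one_right (norm_nonneg _)
    ((specWeight_le_polyWeight _).trans (polyWeight_le_one _))

theorem continuous_convDensity (a b : Spec d) : Continuous (convDensity a b) := by
  refine continuous_of_dominated (bound := fun η => ‖density a η‖ * ‖b‖)
    (fun ξ => (integrable_density_mul_density a b ξ).aestronglyMeasurable)
    (fun ξ => Eventually.of_forall fun η => ?_) ((integrable_density a).norm.mul_const ‖b‖)
    (Eventually.of_forall fun η => by fun_prop)
  rw [norm_mul]
  refine mul_le_mul_of_nonneg_left ((norm_density_le b _).trans ?_) (norm_nonneg _)
  exact mul_le_of_le_one_right (norm_nonneg _)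
    ((specWeight_le_polyWeight _).trans (polyWeight_le_one _))

/-- The bound retains the averages at `ξ`, so that it yields both the algebra inequality and the
vanishing at infinity of the renormalized convolution. -/
theorem norm_convDensity_le (a b : Spec d) (ξ : E d) : ‖convDensity a b ξ‖
    ≤ specWeight ξ * (2 ^ d * (‖a‖ * polyAverage b ξ + ‖b‖ * polyAverage a ξ)) := by
  have h1 : Integrable fun η => polyWeight (ξ - η) * ‖a η‖ := by
    have := (integrable_polyWeight_mul_norm a ξ).comp_sub_left ξ
    simpa using this
  have h2 : ∫ η, polyWeight (ξ - η) * ‖a η‖ = polyAverage a ξ := by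
    rw [polyAverage, ← integral_sub_left_eq_self _ volume ξ]
    simp
  have h3 : ‖a‖ * polyAverage b ξ + ‖b‖ * polyAverage a ξ
      = ∫ η, (‖a‖ * (polyWeight η * ‖b (ξ - η)‖) + ‖b‖ * (polyWeight (ξ - η) * ‖a η‖)) := by
    rw [integral_add ((integrable_polyWeight_mul_norm b ξ).const_mul _) (h1.const_mul _),
      integral_const_mul, integral_const_mul, h2, polyAverage]
  rw [convDensity, h3, ← mul_assoc, ← integral_const_mul]
  refine norm_integral_le_of_norm_le ((((integrable_polyWeight_mul_norm b ξ).const_mul _).add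
    (h1.const_mul _)).const_mul _) (Eventually.of_forall fun η => ?_)
  rw [norm_mul, norm_density, norm_density]
  have h4 := specWeight_mul_specWeight_sub_le ξ η
  have h5 := (polyWeight_pos η).le
  have h6 := (polyWeight_pos (ξ - η)).le
  have h7 := (specWeight_pos ξ).le
  calc specWeight η * ‖a η‖ * (specWeight (ξ - η) * ‖b (ξ - η)‖)
      = specWeight η * specWeight (ξ - η) * (‖a η‖ * ‖b (ξ - η)‖) := by ring
    _ ≤ 2 ^ d * specWeight ξ * (polyWeight η + polyWeight (ξ - η)) * (‖a η‖ * ‖b (ξ - η)‖) := by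
        gcongr
    _ = specWeight ξ * 2 ^ d * (‖a η‖ * (polyWeight η * ‖b (ξ - η)‖)
          + ‖b (ξ - η)‖ * (polyWeight (ξ - η) * ‖a η‖)) := by ring
    _ ≤ _ := by
        gcongr
        · exact Spec.norm_apply_le a η
        · exact Spec.norm_apply_le b _

/-- The renormalized convolution product on `Spec d`. -/
def specConv (a b : Spec d) : Spec d :=
  Spec.mk (fun ξ => (specWeight ξ : ℂ)⁻¹ * convDensity a b ξ)
    (by
      refine Continuous.mul (Continuous.inv₀ (by fun_prop) fun ξ => ?_) (continuous_convDensity a b)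
      exact_mod_cast (specWeight_pos ξ).ne')
    (by
      refine squeeze_zero_norm
        (a := fun ξ => 2 ^ d * (‖a‖ * polyAverage b ξ + ‖b‖ * polyAverage a ξ)) (fun ξ => ?_) ?_
      · rw [norm_mul, norm_inv, Complex.norm_real, Real.norm_of_nonneg (specWeight_pos ξ).le,
          inv_mul_le_iff₀ (specWeight_pos ξ)]
        exact norm_convDensity_le a b ξ
      · simpa using (((tendsto_polyAverage b).const_mul ‖a‖).add
          ((tendsto_polyAverage a).const_mul ‖b‖)).const_mul (2 ^ d))

@[simp]
theorem specConv_apply (a b : Spec d) (ξ : E d) :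
    specConv a b ξ = (specWeight ξ : ℂ)⁻¹ * convDensity a b ξ := rfl

theorem density_specConv (a b : Spec d) : density (specConv a b) = convDensity a b := by
  ext ξ
  have hw : (specWeight ξ : ℂ) ≠ 0 := by exact_mod_cast (specWeight_pos ξ).ne'
  rw [density, specConv_apply, mul_inv_cancel_left₀ hw]

theorem norm_specConv_le (a b : Spec d) :
    ‖specConv a b‖ ≤ (2 ^ (d + 1) * ∫ η : E d, polyWeight η) * ‖a‖ * ‖b‖ := by
  have hJ : 0 ≤ ∫ η : E d, polyWeight η := integral_nonneg fun η => (polyWeight_pos η).le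
  rw [Spec.norm_le (by positivity)]
  intro ξ
  rw [specConv_apply, norm_mul, norm_inv, Complex.norm_real,
    Real.norm_of_nonneg (specWeight_pos ξ).le, inv_mul_le_iff₀ (specWeight_pos ξ)]
  refine (norm_convDensity_le a b ξ).trans
    (mul_le_mul_of_nonneg_left ?_ (specWeight_pos ξ).le)
  calc 2 ^ d * (‖a‖ * polyAverage b ξ + ‖b‖ * polyAverage a ξ)
      ≤ 2 ^ d * (‖a‖ * ((∫ η : E d, polyWeight η) * ‖b‖)
          + ‖b‖ * ((∫ η : E d, polyWeight η) * ‖a‖)) := by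
        gcongr
        · exact polyAverage_le b ξ
        · exact polyAverage_le a ξ
    _ = _ := by ring

theorem density_add (a b : Spec d) : density (a + b) = density a + density b := by
  ext ξ; exact mul_add _ _ _

theorem density_smul (c : ℂ) (a : Spec d) : density (c • a) = c • density a := by
  ext ξ; exact mul_left_comm _ _ _

/-- The renormalized convolution product as a continuous bilinear map. -/
def specConvL : Spec d →L[ℂ] Spec d →L[ℂ] Spec d :=
  LinearMap.mkContinuous₂
    (LinearMap.mk₂ ℂ specConv
      (fun a a' b => density_injective (by
        rw [density_add]; simp only [density_specConv]
        ext ξ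
        simp only [convDensity, density_add, Pi.add_apply, add_mul]
        exact integral_add (integrable_density_mul_density a b ξ)
          (integrable_density_mul_density a' b ξ)))
      (fun c a b => density_injective (by
        rw [density_smul]; simp only [density_specConv]
        ext ξ
        simp only [convDensity, density_smul, Pi.smul_apply, smul_eq_mul, mul_assoc]
        exact integral_const_mul _ _))
      (fun a b b' => density_injective (by
        rw [density_add]; simp only [density_specConv]
        ext ξ
        simp only [convDensity, density_add, Pi.add_apply, mul_add]
        exact integral_add (integrable_density_mul_density a b ξ)
          (integrable_density_mul_density a b' ξ)))
      (fun c a b => density_injective (by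
        rw [density_smul]; simp only [density_specConv]
        ext ξ
        simp only [convDensity, density_smul, Pi.smul_apply, smul_eq_mul, mul_left_comm _ c]
        exact integral_const_mul _ _)))
    (2 ^ (d + 1) * ∫ η : E d, polyWeight η) norm_specConv_le

theorem specConvL_apply (a b : Spec d) : specConvL a b = specConv a b := rfl

/-- The operation on spectral densities that corresponds to complex conjugation. -/
def sharp (a : Spec d) : Spec d :=
  Spec.mk (fun ξ => starRingEnd ℂ (a (-ξ)))
    (Complex.continuous_conj.comp (a.continuous.comp continuous_neg))
    (by
      have h1 : Tendsto (fun ξ : E d => -ξ) (cocompact _) (cocompact _) :=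
        (Homeomorph.neg (E d)).isClosedEmbedding.tendsto_cocompact
      have h2 := tendsto_zero_iff_norm_tendsto_zero.1 (a.tendsto_zero.comp h1)
      refine tendsto_zero_iff_norm_tendsto_zero.2 (h2.congr fun ξ => ?_)
      exact (RCLike.norm_conj _).symm)

@[simp]
theorem sharp_apply (a : Spec d) (ξ : E d) : sharp a ξ = starRingEnd ℂ (a (-ξ)) := rfl

theorem norm_sharp_le (a : Spec d) : ‖sharp a‖ ≤ ‖a‖ := by
  rw [Spec.norm_le (norm_nonneg _)]
  intro ξ
  rw [sharp_apply, RCLike.norm_conj]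
  exact Spec.norm_apply_le a _

theorem sharp_sub (a b : Spec d) : sharp (a - b) = sharp a - sharp b := by
  ext ξ; simp

theorem density_sharp (a : Spec d) (ξ : E d) :
    density (sharp a) ξ = starRingEnd ℂ (density a (-ξ)) := by
  simp [density, specWeight_neg]

/-- The function represented by an element of `Spec d`. -/
def phys (a : Spec d) : E d → ℂ := 𝓕⁻ (density a)

theorem phys_specConv (a b : Spec d) (x : E d) :
    phys (specConv a b) x = phys a x * phys b x := by
  simp only [phys, Real.fourierInv_eq_fourier_neg]
  rw [← Real.fourier_mul_convolution_eq (integrable_density a) (integrable_density b),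
    density_specConv]
  rfl

theorem phys_eq_integral (a : Spec d) (x : E d) : phys a x
    = ∫ ξ, Complex.exp (Complex.I * (2 * Real.pi * inner ℝ ξ x : ℝ)) * density a ξ := by
  simp only [phys, Real.fourierInv_eq', smul_eq_mul]
  congr 1; ext ξ
  rw [mul_comm Complex.I]

theorem phys_sharp (a : Spec d) (x : E d) : phys (sharp a) x = starRingEnd ℂ (phys a x) := by
  rw [phys_eq_integral, phys_eq_integral, ← integral_conj, ← integral_neg_eq_self]
  congr 1; ext ξ
  rw [density_sharp, map_mul, neg_neg, ← Complex.exp_conj]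
  simp [map_ofNat]

/-- Fourier inversion applies to the difference: its density is continuous and integrable and its
transform is zero. Identities in `Spec d` can thus be checked pointwise in physical space. -/
theorem phys_injective {a b : Spec d} (h : phys a = phys b) : a = b := by
  refine density_injective ?_
  have h1 : density a - density b = density (a - b) := by
    ext ξ; exact (mul_sub _ _ _).symm
  have h2 : phys (a - b) = 0 := by
    ext x
    simp only [phys_eq_integral]
    have h3 := congrFun h x
    simp only [phys_eq_integral] at h3
    have hi : ∀ c : Spec d, Integrable fun ξ =>
        Complex.exp (Complex.I * (2 * Real.pi * inner ℝ ξ x : ℝ)) * density c ξ := fun c =>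
      (integrable_density c).bdd_mul (c := 1) (Continuous.aestronglyMeasurable (by fun_prop))
        (Eventually.of_forall fun ξ => (norm_cexp_I_mul_ofReal _).le)
    rw [← h1]
    simp only [Pi.sub_apply, mul_sub]
    rw [integral_sub (hi a) (hi b), h3, sub_self]
    rfl
  have h4 : density (a - b) = 0 := by
    have := (continuous_density (a - b)).fourier_fourierInv_eq (integrable_density (a - b)) (by
      have h5 : 𝓕 (density (a - b)) = 0 := by
        ext x
        have := congrFun h2 (-x)
        rwa [phys, Real.fourierInv_eq_fourier_neg, neg_neg] at this
      rw [h5]; exact integrable_zero _ _ _)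
    change 𝓕 (phys (a - b)) = _ at this
    rw [← this, h2]
    ext ξ
    simp [Real.fourier_eq]
  rw [← sub_eq_zero, h1, h4]

end


/-! ### The cubic nonlinearity and the free flow on spectral densities -/

noncomputable section

open scoped ZeroAtInfty BoundedContinuousFunction FourierTransform

variable {d : ℕ}

theorem integrable_specWeight : Integrable (specWeight (d := d)) :=
  integrable_polyWeight.mono' (by fun_prop) (Eventually.of_forall fun ξ => by
    rw [Real.norm_of_nonneg (specWeight_pos ξ).le]; exact specWeight_le_polyWeight ξ)

theorem integrable_cexp_mul_density (a : Spec d) (x : E d) : Integrable fun ξ =>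
    Complex.exp (Complex.I * (2 * Real.pi * inner ℝ ξ x : ℝ)) * density a ξ :=
  (integrable_density a).bdd_mul (c := 1) (Continuous.aestronglyMeasurable (by fun_prop))
    (Eventually.of_forall fun _ => (norm_cexp_I_mul_ofReal _).le)

/-- Evaluation of the represented function at a point. -/
def physL (x : E d) : Spec d →L[ℂ] ℂ :=
  LinearMap.mkContinuous
    { toFun := fun a => phys a x
      map_add' := fun a b => by
        simp only [phys_eq_integral, density_add, Pi.add_apply, mul_add]
        exact integral_add (integrable_cexp_mul_density a x) (integrable_cexp_mul_density b x)
      map_smul' := fun c a => by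
        simp only [phys_eq_integral, density_smul, Pi.smul_apply, smul_eq_mul, mul_left_comm _ c]
        exact integral_const_mul _ _ }
    (∫ ξ : E d, specWeight ξ) (fun a => by
      change ‖phys a x‖ ≤ _
      rw [phys_eq_integral, mul_comm (∫ ξ : E d, specWeight ξ), ← integral_const_mul]
      refine norm_integral_le_of_norm_le (integrable_specWeight.const_mul _)
        (Eventually.of_forall fun ξ => ?_)
      rw [norm_mul, norm_cexp_I_mul_ofReal, one_mul]
      exact norm_density_le a ξ)

theorem physL_apply (x : E d) (a : Spec d) : physL x a = phys a x := rfl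

/-- The cubic nonlinearity `u ↦ i|u|²u` in terms of spectral densities. -/
def specNonlin (a : Spec d) : Spec d := Complex.I • specConv (specConv a (sharp a)) a

theorem phys_specNonlin (a : Spec d) (x : E d) :
    phys (specNonlin a) x = Complex.I * ((‖phys a x‖ ^ 2 : ℝ) * phys a x) := by
  rw [specNonlin, ← physL_apply, map_smul, physL_apply, phys_specConv, phys_specConv, phys_sharp,
    Complex.mul_conj, Complex.normSq_eq_norm_sq, smul_eq_mul]

theorem specNonlin_zero : specNonlin (0 : Spec d) = 0 := by
  rw [specNonlin, ← specConvL_apply, map_zero, smul_zero]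

/-- Telescoping of the trilinear form: `a a# a - b b# b = a a# (a - b) + a (a - b)# b + (a - b) b#
b`, with `#` for `sharp`. The norms of the three terms add up to a multiple of `‖a‖² + ‖a‖‖b‖ +
‖b‖²`. -/
theorem exists_norm_specNonlin_sub_le (d : ℕ) : ∃ C : ℝ, 0 ≤ C ∧ ∀ a b : Spec d,
    ‖specNonlin a - specNonlin b‖ ≤ C * (‖a‖ + ‖b‖) ^ 2 * ‖a - b‖ := by
  set c : ℝ := 2 ^ (d + 1) * ∫ η : E d, polyWeight η with hc
  have hJ : 0 ≤ ∫ η : E d, polyWeight η := integral_nonneg fun η => (polyWeight_pos η).le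
  have hc0 : 0 ≤ c := by positivity
  have hcv : ∀ a b : Spec d, ‖specConvL a b‖ ≤ c * ‖a‖ * ‖b‖ := norm_specConv_le
  refine ⟨c ^ 2, by positivity, fun a b => ?_⟩
  have h1 : specNonlin a - specNonlin b = Complex.I • (specConvL (specConvL a (sharp a)) (a - b)
      + specConvL (specConvL a (sharp (a - b)) + specConvL (a - b) (sharp b)) b) := by
    rw [specNonlin, specNonlin, ← smul_sub]
    simp only [← specConvL_apply, sharp_sub, map_sub, map_add, add_apply, sub_apply]
    congr 1
    abel
  have h2 : ‖specConvL a (sharp a)‖ ≤ c * ‖a‖ * ‖a‖ :=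
    (hcv _ _).trans (by gcongr; exact norm_sharp_le a)
  have h3 : ‖specConvL a (sharp (a - b)) + specConvL (a - b) (sharp b)‖
      ≤ c * ‖a‖ * ‖a - b‖ + c * ‖a - b‖ * ‖b‖ := by
    refine (norm_add_le _ _).trans (add_le_add ?_ ?_)
    · exact (hcv _ _).trans (by gcongr; exact norm_sharp_le _)
    · exact (hcv _ _).trans (by gcongr; exact norm_sharp_le _)
  rw [h1, norm_smul, Complex.norm_I, one_mul]
  calc _ ≤ c * (c * ‖a‖ * ‖a‖) * ‖a - b‖ + c * (c * ‖a‖ * ‖a - b‖ + c * ‖a - b‖ * ‖b‖) * ‖b‖ := by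
        refine (norm_add_le _ _).trans (add_le_add ?_ ?_)
        · exact (hcv _ _).trans (by gcongr)
        · exact (hcv _ _).trans (by gcongr)
    _ = c ^ 2 * ‖a - b‖ * (‖a‖ ^ 2 + ‖a‖ * ‖b‖ + ‖b‖ ^ 2) := by ring
    _ ≤ c ^ 2 * ‖a - b‖ * (‖a‖ + ‖b‖) ^ 2 := by
        gcongr
        nlinarith [norm_nonneg a, norm_nonneg b]
    _ = _ := by ring

/-- The symbol `e^{-4π²i|ξ|²τ}` of the free Schrödinger flow. -/
def freePhase (τ : ℝ) : E d →ᵇ ℂ :=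
  BoundedContinuousFunction.ofNormedAddCommGroup
    (fun ξ => Complex.exp (Complex.I * (-(4 * Real.pi ^ 2 * ‖ξ‖ ^ 2 * τ) : ℝ))) (by fun_prop) 1
    (fun _ => (norm_cexp_I_mul_ofReal _).le)

/-- The free Schrödinger flow. -/
def freeFlow (τ : ℝ) (a : Spec d) : Spec d := mulOp (freePhase τ) a

theorem freeFlow_apply (τ : ℝ) (a : Spec d) (ξ : E d) : freeFlow τ a ξ
    = Complex.exp (Complex.I * (-(4 * Real.pi ^ 2 * ‖ξ‖ ^ 2 * τ) : ℝ)) * a ξ := rfl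

theorem norm_freeFlow (τ : ℝ) (a : Spec d) : ‖freeFlow τ a‖ = ‖a‖ := by
  have h : ∀ ξ, ‖freeFlow τ a ξ‖ = ‖a ξ‖ := fun ξ => by
    rw [freeFlow_apply, norm_mul, norm_cexp_I_mul_ofReal, one_mul]
  refine le_antisymm ((Spec.norm_le (norm_nonneg _)).2 fun ξ => ?_)
    ((Spec.norm_le (norm_nonneg _)).2 fun ξ => ?_)
  · rw [h]; exact Spec.norm_apply_le a ξ
  · rw [← h]; exact Spec.norm_apply_le _ ξ

theorem freeFlow_sub (τ : ℝ) (a b : Spec d) : freeFlow τ (a - b) = freeFlow τ a - freeFlow τ b :=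
  map_sub (mulOp (freePhase τ)) a b

theorem freeFlow_zero (a : Spec d) : freeFlow 0 a = a := by
  ext ξ; simp [freeFlow_apply]

theorem freeFlow_freeFlow_neg (τ : ℝ) (a : Spec d) : freeFlow τ (freeFlow (-τ) a) = a := by
  ext ξ
  rw [freeFlow_apply, freeFlow_apply, ← mul_assoc, ← Complex.exp_add]
  simp

/-- At high frequencies `a` itself is small; at frequencies `‖ξ‖ ≤ R` the phase is Lipschitz in `τ`.
The decay built into C₀ is essential here. -/
theorem continuous_freeFlow_left (a : Spec d) : Continuous fun τ => freeFlow τ a := by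
  refine continuous_iff_continuousAt.2 fun τ₀ => ?_
  rw [ContinuousAt, tendsto_iff_norm_sub_tendsto_zero]
  rw [Metric.tendsto_nhds]
  intro ε hε
  have h1 : ∀ᶠ ξ in cocompact (E d), ‖a ξ‖ < ε / 8 :=
    (tendsto_zero_iff_norm_tendsto_zero.1 a.tendsto_zero).eventually_lt_const (by positivity)
  rw [← Metric.cobounded_eq_cocompact, ← comap_norm_atTop, eventually_comap] at h1
  obtain ⟨R, hR⟩ := eventually_atTop.1 h1
  have h2 : Tendsto (fun τ : ℝ => 4 * Real.pi ^ 2 * R ^ 2 * |τ - τ₀| * ‖a‖) (𝓝 τ₀) (𝓝 0) := by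
    have : Continuous fun τ : ℝ => 4 * Real.pi ^ 2 * R ^ 2 * |τ - τ₀| * ‖a‖ := by fun_prop
    simpa using this.tendsto τ₀
  filter_upwards [h2.eventually_lt_const (half_pos hε)] with τ hτ
  rw [Real.dist_0_eq_abs, abs_norm]
  refine lt_of_le_of_lt ((Spec.norm_le (half_pos hε).le).2 fun ξ => ?_) (half_lt_self hε)
  have h3 : (freeFlow τ a - freeFlow τ₀ a) ξ
      = (Complex.exp (Complex.I * (-(4 * Real.pi ^ 2 * ‖ξ‖ ^ 2 * τ) : ℝ))
        - Complex.exp (Complex.I * (-(4 * Real.pi ^ 2 * ‖ξ‖ ^ 2 * τ₀) : ℝ))) * a ξ := by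
    rw [Spec.sub_apply, freeFlow_apply, freeFlow_apply, sub_mul]
  rw [h3, norm_mul]
  rcases le_total R ‖ξ‖ with h | h
  · have h4 := hR _ h ξ rfl
    have h5 := norm_sub_le (Complex.exp (Complex.I * (-(4 * Real.pi ^ 2 * ‖ξ‖ ^ 2 * τ) : ℝ)))
      (Complex.exp (Complex.I * (-(4 * Real.pi ^ 2 * ‖ξ‖ ^ 2 * τ₀) : ℝ)))
    rw [norm_cexp_I_mul_ofReal, norm_cexp_I_mul_ofReal] at h5
    nlinarith [norm_nonneg (a ξ)]
  · refine le_trans ?_ hτ.le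
    refine mul_le_mul ?_ (Spec.norm_apply_le a ξ) (norm_nonneg _) (by positivity)
    refine (norm_cexp_I_mul_sub_le _ _).trans ?_
    have h6 : -(4 * Real.pi ^ 2 * ‖ξ‖ ^ 2 * τ) - -(4 * Real.pi ^ 2 * ‖ξ‖ ^ 2 * τ₀)
        = -(4 * Real.pi ^ 2 * ‖ξ‖ ^ 2 * (τ - τ₀)) := by ring
    rw [h6, abs_neg, abs_mul, abs_of_nonneg (by positivity : 0 ≤ 4 * Real.pi ^ 2 * ‖ξ‖ ^ 2)]
    gcongr

theorem continuous_freeFlow : Continuous fun z : ℝ × Spec d => freeFlow z.1 z.2 := by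
  refine continuous_prod_of_continuous_lipschitzWith' _ 1 (fun τ => ?_) continuous_freeFlow_left
  refine LipschitzWith.of_dist_le_mul fun a b => ?_
  rw [dist_eq_norm, dist_eq_norm, ← freeFlow_sub, norm_freeFlow, NNReal.coe_one, one_mul]

end


/-! ### The dispersionless solution with Gaussian data -/

noncomputable section

open scoped ZeroAtInfty BoundedContinuousFunction FourierTransform

variable {d : ℕ}

theorem tendsto_one_add_pow_mul_exp_neg (n : ℕ) :
    Tendsto (fun r : ℝ => (1 + r) ^ n * Real.exp (-r)) atTop (𝓝 0) := by
  have h1 : Tendsto (fun r : ℝ => 1 + r) atTop atTop := tendsto_atTop_add_const_left _ 1 tendsto_id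
  have h2 := ((Real.tendsto_pow_mul_exp_neg_atTop_nhds_zero n).comp h1).const_mul (Real.exp 1)
  rw [mul_zero] at h2
  refine h2.congr fun r => ?_
  simp only [Function.comp]
  rw [mul_left_comm, ← Real.exp_add]
  ring_nf

/-- The Gaussian `e^{-π|x|²}`, which is its own Fourier transform. -/
def gaussian (d : ℕ) : Spec d :=
  Spec.mk (fun ξ => (Real.exp (2 * ‖ξ‖ - Real.pi * ‖ξ‖ ^ 2) * (1 + ‖ξ‖) ^ (d + 1) : ℝ))
    (by fun_prop)
    (by
      refine squeeze_zero_norm' (a := fun ξ => (1 + ‖ξ‖) ^ (d + 1) * Real.exp (-‖ξ‖)) ?_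
        ((tendsto_one_add_pow_mul_exp_neg (d + 1)).comp tendsto_norm_cocompact_atTop)
      filter_upwards [tendsto_norm_cocompact_atTop.eventually_ge_atTop 1] with ξ hξ
      rw [Complex.norm_real, Real.norm_of_nonneg (by positivity), mul_comm]
      refine mul_le_mul_of_nonneg_left (Real.exp_le_exp.2 ?_) (by positivity)
      nlinarith [Real.pi_gt_three])

theorem density_gaussian (ξ : E d) :
    density (gaussian d) ξ = Complex.exp (-Real.pi * ‖ξ‖ ^ 2) := by
  have h1 : (0 : ℝ) < (1 + ‖ξ‖) ^ (d + 1) := by positivity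
  have h2 : specWeight ξ * (Real.exp (2 * ‖ξ‖ - Real.pi * ‖ξ‖ ^ 2) * (1 + ‖ξ‖) ^ (d + 1))
      = Real.exp (-Real.pi * ‖ξ‖ ^ 2) := by
    have h3 : Real.exp (-Real.pi * ‖ξ‖ ^ 2)
        = Real.exp (-2 * ‖ξ‖) * Real.exp (2 * ‖ξ‖ - Real.pi * ‖ξ‖ ^ 2) := by
      rw [← Real.exp_add]; ring_nf
    rw [h3, specWeight, polyWeight]
    field_simp
  change (specWeight ξ : ℂ) * ((Real.exp (2 * ‖ξ‖ - Real.pi * ‖ξ‖ ^ 2) * (1 + ‖ξ‖) ^ (d + 1) : ℝ) : ℂ)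
    = _
  rw [← Complex.ofReal_mul, h2]
  push_cast
  rfl

theorem phys_gaussian (x : E d) : phys (gaussian d) x = Real.exp (-Real.pi * ‖x‖ ^ 2) := by
  have h1 : density (gaussian d) = fun ξ => Complex.exp (-(Real.pi : ℂ) * ‖ξ‖ ^ 2) :=
    funext density_gaussian
  have hpi : (Real.pi : ℂ) ≠ 0 := by exact_mod_cast Real.pi_ne_zero
  rw [phys, Real.fourierInv_eq_fourier_neg, h1,
    fourier_gaussian_innerProductSpace (by simpa using Real.pi_pos), div_self hpi, Complex.one_cpow,
    one_mul, norm_neg]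
  push_cast
  congr 1
  field_simp

/-- The solution of `v' = i|v|²v` with Gaussian data. -/
def profile (t : ℝ) : Spec d :=
  NormedSpace.exp (t • (Complex.I • specConvL (specConv (gaussian d) (sharp (gaussian d)))))
    (gaussian d)

theorem profile_zero : profile (d := d) 0 = gaussian d := by
  simp [profile, NormedSpace.exp_zero]

/-- The modulus is conserved by `v' = i|v|²v`, so `|v|²` may be frozen at its initial value. The
equation becomes linear with a bounded generator, which is why `profile` is an operator exponential.
-/
theorem hasDerivAt_profile' (t : ℝ) : HasDerivAt (profile (d := d))
    (Complex.I • specConv (specConv (gaussian d) (sharp (gaussian d))) (profile t)) t := by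
  have h := hasDerivAt_exp_smul_const' (𝕂 := ℝ)
    (Complex.I • specConvL (specConv (gaussian d) (sharp (gaussian d)))) t
  have h2 := ((ContinuousLinearMap.apply ℂ (Spec d) (gaussian d)).restrictScalars ℝ).hasFDerivAt.comp_hasDerivAt t h
  exact h2

/-- At fixed `x` the frozen equation is a scalar linear ODE, solved by an integrating factor. -/
theorem phys_profile (t : ℝ) (x : E d) : phys (profile t) x
    = Complex.exp (Complex.I * (t * Real.exp (-Real.pi * ‖x‖ ^ 2) ^ 2 : ℝ))
      * Real.exp (-Real.pi * ‖x‖ ^ 2) := by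
  set g := Real.exp (-Real.pi * ‖x‖ ^ 2) with hg
  have h1 : ∀ t, HasDerivAt (fun t => phys (profile t) x)
      (Complex.I * (g ^ 2 : ℝ) * phys (profile t) x) t := fun t => by
    have h2 := ((physL x).restrictScalars ℝ).hasFDerivAt.comp_hasDerivAt t (hasDerivAt_profile' t)
    refine h2.congr_deriv ?_
    rw [ContinuousLinearMap.coe_restrictScalars', map_smul, physL_apply, phys_specConv,
      phys_specConv, phys_sharp, phys_gaussian, ← hg, Complex.conj_ofReal, smul_eq_mul]
    push_cast; ring
  have h3 : ∀ t : ℝ, HasDerivAt (fun t : ℝ => Complex.exp (-(Complex.I * (g ^ 2 : ℝ) * t)))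
      (Complex.exp (-(Complex.I * (g ^ 2 : ℝ) * t)) * (-(Complex.I * (g ^ 2 : ℝ)))) t := fun t => by
    have h4 : HasDerivAt (fun t : ℝ => -(Complex.I * (g ^ 2 : ℝ) * (t : ℂ)))
        (-(Complex.I * (g ^ 2 : ℝ) * 1)) t :=
      ((Complex.ofRealCLM.hasDerivAt (x := t)).const_mul _).neg
    simpa using h4.cexp
  have h5 : ∀ t : ℝ, HasDerivAt (fun t : ℝ => Complex.exp (-(Complex.I * (g ^ 2 : ℝ) * t))
      * phys (profile t) x) 0 t := fun t => ((h3 t).mul (h1 t)).congr_deriv (by ring)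
  have h6 := is_const_of_deriv_eq_zero (fun t => (h5 t).differentiableAt)
    (fun t => (h5 t).deriv) t 0
  simp only [profile_zero, phys_gaussian, Complex.ofReal_zero, mul_zero, neg_zero, Complex.exp_zero,
    one_mul, Complex.exp_neg] at h6
  rw [inv_mul_eq_iff_eq_mul₀ (Complex.exp_ne_zero _)] at h6
  rw [h6, ← hg]
  congr 2
  push_cast; ring

theorem norm_phys_profile (t : ℝ) (x : E d) :
    ‖phys (profile t) x‖ = Real.exp (-Real.pi * ‖x‖ ^ 2) := by
  rw [phys_profile, norm_mul, norm_cexp_I_mul_ofReal, one_mul, Complex.norm_real,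
    Real.norm_of_nonneg (Real.exp_pos _).le]

/-- The explicit formula shows that the modulus is still the Gaussian, so the frozen equation is the
nonlinear one; `phys_injective` carries the pointwise identity back to `Spec d`. -/
theorem hasDerivAt_profile (t : ℝ) :
    HasDerivAt (profile (d := d)) (specNonlin (profile t)) t := by
  refine (hasDerivAt_profile' t).congr_deriv (phys_injective (funext fun x => ?_))
  rw [phys_specNonlin, ← physL_apply, map_smul, physL_apply, phys_specConv, phys_specConv,
    phys_sharp, phys_gaussian, norm_phys_profile, Complex.conj_ofReal, smul_eq_mul]
  push_cast; ring

end


/-! ### Fourier analysis of rapidly decaying functions -/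

noncomputable section

open scoped FourierTransform SchwartzMap

variable {d : ℕ}

/-- Continuous functions that decay faster than any power. -/
structure RapidDecay (f : E d → ℂ) : Prop where
  continuous : Continuous f
  decay : ∀ n : ℕ, ∃ C, ∀ ξ, (1 + ‖ξ‖) ^ n * ‖f ξ‖ ≤ C

namespace RapidDecay

variable {f g : E d → ℂ}

theorem integrable_pow_mul (hf : RapidDecay f) (n : ℕ) :
    Integrable fun ξ => ‖ξ‖ ^ n * ‖f ξ‖ := by
  obtain ⟨C, hC⟩ := hf.decay (n + (d + 1))
  have hc := hf.continuous
  refine (integrable_polyWeight.const_mul C).mono' (Continuous.aestronglyMeasurable (by fun_prop))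
    (Eventually.of_forall fun ξ => ?_)
  rw [Real.norm_of_nonneg (by positivity), polyWeight, ← div_eq_mul_inv, le_div_iff₀ (by positivity)]
  refine le_trans ?_ (hC ξ)
  rw [pow_add _ n]
  have : ‖ξ‖ ^ n ≤ (1 + ‖ξ‖) ^ n := pow_le_pow_left₀ (norm_nonneg _) (by linarith) n
  calc ‖ξ‖ ^ n * ‖f ξ‖ * (1 + ‖ξ‖) ^ (d + 1) = ‖ξ‖ ^ n * (1 + ‖ξ‖) ^ (d + 1) * ‖f ξ‖ := by ring
    _ ≤ _ := by gcongr

theorem integrable (hf : RapidDecay f) : Integrable f := by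
  have h := hf.integrable_pow_mul 0
  simp only [pow_zero, one_mul] at h
  exact (integrable_norm_iff hf.continuous.aestronglyMeasurable).1 h

theorem memLp_two (hf : RapidDecay f) : MemLp f 2 := by
  rw [memLp_two_iff_integrable_sq_norm hf.continuous.aestronglyMeasurable]
  obtain ⟨C, hC⟩ := hf.decay 0
  have hc := hf.continuous
  refine (hf.integrable.norm.const_mul C).mono' (Continuous.aestronglyMeasurable (by fun_prop))
    (Eventually.of_forall fun ξ => ?_)
  rw [norm_pow, norm_norm, sq]
  have := hC ξ
  rw [pow_zero, one_mul] at this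
  gcongr

theorem mul_left (hf : RapidDecay f) (hg : Continuous g) {C : ℝ} {m : ℕ}
    (hgC : ∀ ξ, ‖g ξ‖ ≤ C * (1 + ‖ξ‖) ^ m) : RapidDecay fun ξ => g ξ * f ξ := by
  refine ⟨hg.mul hf.continuous, fun n => ?_⟩
  obtain ⟨K, hK⟩ := hf.decay (n + m)
  refine ⟨|C| * K, fun ξ => ?_⟩
  rw [norm_mul]
  calc (1 + ‖ξ‖) ^ n * (‖g ξ‖ * ‖f ξ‖)
      ≤ (1 + ‖ξ‖) ^ n * (|C| * (1 + ‖ξ‖) ^ m * ‖f ξ‖) := by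
        gcongr
        exact (hgC ξ).trans (by gcongr; exact le_abs_self C)
    _ = |C| * ((1 + ‖ξ‖) ^ (n + m) * ‖f ξ‖) := by rw [pow_add]; ring
    _ ≤ |C| * K := by gcongr; exact hK ξ

theorem comp_smul (hf : RapidDecay f) {r : ℝ} (hr : 0 < r) : RapidDecay fun ξ => f (r • ξ) := by
  refine ⟨hf.continuous.comp (continuous_const_smul r), fun n => ?_⟩
  obtain ⟨K, hK⟩ := hf.decay n
  refine ⟨(1 + r⁻¹) ^ n * K, fun ξ => ?_⟩
  have h1 : 1 + ‖ξ‖ ≤ (1 + r⁻¹) * (1 + ‖r • ξ‖) := by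
    rw [norm_smul, Real.norm_of_nonneg hr.le]
    have h2 : r⁻¹ * (r * ‖ξ‖) = ‖ξ‖ := inv_mul_cancel_left₀ hr.ne' _
    have h3 : 0 ≤ r * ‖ξ‖ := by positivity
    have h4 : 0 < r⁻¹ := by positivity
    linarith [mul_add (1 + r⁻¹) 1 (r * ‖ξ‖)]
  calc (1 + ‖ξ‖) ^ n * ‖f (r • ξ)‖ ≤ ((1 + r⁻¹) * (1 + ‖r • ξ‖)) ^ n * ‖f (r • ξ)‖ := by gcongr
    _ = (1 + r⁻¹) ^ n * ((1 + ‖r • ξ‖) ^ n * ‖f (r • ξ)‖) := by rw [mul_pow]; ring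
    _ ≤ _ := by gcongr; exact hK _

theorem comp_neg (hf : RapidDecay f) : RapidDecay fun ξ => f (-ξ) :=
  ⟨hf.continuous.comp continuous_neg, fun n => (hf.decay n).imp fun C hC ξ => by
    simpa using hC (-ξ)⟩

theorem const_mul (hf : RapidDecay f) (c : ℂ) : RapidDecay fun ξ => c * f ξ :=
  hf.mul_left (C := ‖c‖) (m := 0) continuous_const (by simp)

/-- The inverse Fourier transform of a rapidly decaying function is smooth. -/
theorem contDiff_fourierInv (hf : RapidDecay f) : ContDiff ℝ ∞ (𝓕⁻ f) := by
  rw [Real.fourierInv_eq_fourier_comp_neg]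
  exact Real.contDiff_fourier (N := ⊤) fun n _ => hf.comp_neg.integrable_pow_mul n

/-- The Laplacian is the trace of the second derivative in an orthonormal basis. Under the integral
each basis vector contributes the square of a coordinate of the frequency, and these sum to `‖ξ‖²`.
-/
theorem laplacian_fourierInv (hf : RapidDecay f) (x : E d) :
    Δ (𝓕⁻ f) x = 𝓕⁻ (fun ξ => -(4 * Real.pi ^ 2 * ‖ξ‖ ^ 2 : ℝ) * f ξ) x := by
  rw [Real.fourierInv_eq_fourier_comp_neg, Real.fourierInv_eq_fourier_comp_neg]
  simp only [norm_neg]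
  have hg := hf.comp_neg
  set g : E d → ℂ := fun ξ => f (-ξ)
  rw [InnerProductSpace.laplacian_eq_iteratedFDeriv_stdOrthonormalBasis]
  have h1 : ∀ n : ℕ, n ≤ (2 : ℕ∞) → Integrable fun v => ‖v‖ ^ n * ‖g v‖ :=
    fun n _ => hg.integrable_pow_mul n
  simp only [Real.iteratedFDeriv_fourier (N := 2) h1 hg.continuous.aestronglyMeasurable
    (n := 2) le_rfl]
  have h2 : Integrable fun v => VectorFourier.fourierPowSMulRight (innerSL ℝ) g v 2 :=
    VectorFourier.integrable_fourierPowSMulRight _ (hg.integrable_pow_mul 2)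
      hg.continuous.aestronglyMeasurable
  have h3 : ∀ i : Fin (Module.finrank ℝ (E d)), Integrable fun v =>
      VectorFourier.fourierPowSMulRight (innerSL ℝ) g v 2
        ![stdOrthonormalBasis ℝ (E d) i, stdOrthonormalBasis ℝ (E d) i] := fun i =>
    (ContinuousMultilinearMap.apply ℝ (fun _ : Fin 2 => E d) ℂ
        ![stdOrthonormalBasis ℝ (E d) i, stdOrthonormalBasis ℝ (E d) i]).integrable_comp h2
  simp only [Real.fourier_continuousMultilinearMap_apply h2]
  simp only [Real.fourier_eq]
  rw [← integral_finsetSum]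
  · congr 1; ext v
    rw [← Finset.smul_sum]
    congr 1
    simp only [VectorFourier.fourierPowSMulRight_apply, Fin.prod_univ_two, Matrix.cons_val_zero,
      Matrix.cons_val_one]
    rw [← Finset.smul_sum, ← Finset.sum_smul]
    have h4 := (stdOrthonormalBasis ℝ (E d)).sum_sq_inner_left v
    simp only [sq] at h4
    have h5 : ∑ i, innerSL ℝ v (stdOrthonormalBasis ℝ (E d) i)
        * innerSL ℝ v (stdOrthonormalBasis ℝ (E d) i) = ‖v‖ * ‖v‖ := h4
    rw [h5, Complex.real_smul, smul_eq_mul]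
    push_cast
    rw [neg_sq, mul_pow, Complex.I_sq]
    ring
  · intro i _
    exact (Real.fourierIntegral_convergent_iff x).2 (h3 i)

/-- Comparison with the derivative of the explicit profile then gives, through Plancherel, a lower
bound for weighted integrals of its density. -/
theorem hasDerivAt_fourierInv_line (hf : RapidDecay f) (x y : E d) :
    HasDerivAt (fun s : ℝ => 𝓕⁻ f (x + s • y))
      (𝓕⁻ (fun ξ => (2 * Real.pi * inner ℝ ξ y : ℝ) * Complex.I * f ξ) x) 0 := by
  rw [Real.fourierInv_eq_fourier_comp_neg, Real.fourierInv_eq_fourier_comp_neg]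
  have hg := hf.comp_neg
  set g : E d → ℂ := fun ξ => f (-ξ)
  have hi : Integrable fun v => ‖v‖ * ‖g v‖ := by simpa using hg.integrable_pow_mul 1
  have h1 : HasDerivAt (fun s : ℝ => x + s • y) y 0 := by
    simpa using ((hasDerivAt_id (0 : ℝ)).smul_const y).const_add x
  have h2 := Real.hasFDerivAt_fourier hg.integrable hi x
  have h3 : HasFDerivAt (𝓕 g) (𝓕 (VectorFourier.fourierSMulRight (innerSL ℝ) g) x)
      (x + (0 : ℝ) • y) := by simpa using h2
  refine (h3.comp_hasDerivAt (0 : ℝ) h1).congr_deriv ?_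
  rw [Real.fourier_continuousLinearMap_apply]
  · refine congrArg (fun h : E d → ℂ => 𝓕 h x) (funext fun v => ?_)
    rw [VectorFourier.fourierSMulRight_apply]
    have h4 : innerSL ℝ v y = inner ℝ v y := rfl
    simp only [h4, inner_neg_left, Complex.real_smul, smul_eq_mul, g]
    push_cast; ring
  · refine (hi.const_mul (2 * Real.pi * ‖innerSL ℝ (E := E d)‖)).mono'
      hg.continuous.aestronglyMeasurable.fourierSMulRight (Eventually.of_forall fun v => ?_)
    rw [← mul_assoc]
    exact VectorFourier.norm_fourierSMulRight_le _ _ _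

end RapidDecay

theorem integral_fourierInv_mul_eq_flip {f g : E d → ℂ} (hf : Integrable f) (hg : Integrable g) :
    ∫ ξ, 𝓕⁻ f ξ * g ξ = ∫ x, f x * 𝓕⁻ g x := by
  have h : ∀ f : E d → ℂ, 𝓕⁻ f = 𝓕 (fun ξ => f (-ξ)) := Real.fourierInv_eq_fourier_comp_neg
  have h1 := VectorFourier.integral_fourierIntegral_smul_eq_flip (L := innerₗ (E d))
    Real.continuous_fourierChar continuous_inner hf.comp_neg hg
  rw [flip_innerₗ] at h1
  change ∫ ξ, 𝓕 (fun ξ => f (-ξ)) ξ • g ξ = ∫ x, f (-x) • 𝓕 g x at h1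
  simp only [smul_eq_mul] at h1
  rw [h, h1, ← integral_neg_eq_self]
  simp only [neg_neg, Real.fourierInv_eq_fourier_neg]

theorem toDistr_apply (f : L2 d) (φ : 𝓢(E d, ℂ)) : toDistr d f φ = ∫ x, φ x * f x :=
  Lp.toTemperedDistribution_apply f φ

/-- On `L¹ ∩ L²` the `L²` inverse Fourier transform is given by the Fourier integral. -/
theorem coeFn_fourierInv_toLp {f : E d → ℂ} (hf : Integrable f) (hf2 : MemLp f 2) :
    (𝓕⁻ (hf2.toLp f) : L2 d) =ᵐ[volume] 𝓕⁻ f := by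
  have hc : Continuous (𝓕⁻ f) := by
    rw [Real.fourierInv_eq_fourier_comp_neg]
    exact VectorFourier.fourierIntegral_continuous Real.continuous_fourierChar continuous_inner
      hf.comp_neg
  -- The L² transform is known through its distribution only, so both sides are tested against
  -- smooth compactly supported functions and the transform is moved onto the test function.
  refine ae_eq_of_integral_contDiff_smul_eq
    ((Lp.memLp _).locallyIntegrable one_le_two) hc.locallyIntegrable fun g hg hgs => ?_
  have hs : HasCompactSupport fun x => (g x : ℂ) := hgs.comp_left Complex.ofReal_zero
  set ψ : 𝓢(E d, ℂ) := hs.toSchwartzMap (Complex.ofRealCLM.contDiff.comp hg) with hψ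
  have h1 : ∀ F : E d → ℂ, ∫ x, g x • F x = ∫ x, ψ x * F x := fun F => by
    congr 1
  rw [h1, h1, ← toDistr_apply]
  have h2 : toDistr d (𝓕⁻ (hf2.toLp f)) = 𝓕⁻ (toDistr d (hf2.toLp f)) :=
    (Lp.fourierInv_toTemperedDistribution_eq _).symm
  rw [h2, TemperedDistribution.fourierInv_apply, toDistr_apply]
  rw [← integral_fourierInv_mul_eq_flip ψ.integrable hf, SchwartzMap.fourierInv_coe]
  refine integral_congr_ae ?_
  filter_upwards [hf2.coeFn_toLp] with x hx
  rw [hx]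

end


/-! ### Sobolev spaces in terms of the L² Fourier transform -/

noncomputable section

open scoped FourierTransform SchwartzMap BoundedContinuousFunction

variable {d : ℕ}

/-- The symbol `(1 + |ξ|²)^{s/2}`. -/
def besselSymbol (s : ℝ) (ξ : E d) : ℝ := (1 + ‖ξ‖ ^ 2) ^ (s / 2)

theorem besselSymbol_pos (s : ℝ) (ξ : E d) : 0 < besselSymbol s ξ :=
  Real.rpow_pos_of_pos (by positivity) _

@[fun_prop]
theorem continuous_besselSymbol (s : ℝ) : Continuous (besselSymbol (d := d) s) :=
  Continuous.rpow_const (by fun_prop) fun ξ => Or.inl (by positivity)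

theorem hasTemperateGrowth_besselSymbol (s : ℝ) :
    (fun ξ : E d => (besselSymbol s ξ : ℂ)).HasTemperateGrowth := by
  unfold besselSymbol
  fun_prop

theorem besselSymbol_le (s : ℝ≥0) (ξ : E d) : besselSymbol s ξ ≤ (1 + ‖ξ‖) ^ ⌈(s : ℝ)⌉₊ := by
  have h1 : (1 : ℝ) ≤ 1 + ‖ξ‖ := by linarith [norm_nonneg ξ]
  calc besselSymbol s ξ ≤ ((1 + ‖ξ‖) ^ 2) ^ ((s : ℝ) / 2) := by
        refine Real.rpow_le_rpow (by positivity) ?_ (by positivity)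
        nlinarith [norm_nonneg ξ]
    _ = (1 + ‖ξ‖) ^ (s : ℝ) := by
        rw [← Real.rpow_natCast, ← Real.rpow_mul (by positivity)]
        congr 1; push_cast; ring
    _ ≤ (1 + ‖ξ‖) ^ (⌈(s : ℝ)⌉₊ : ℝ) := Real.rpow_le_rpow_of_exponent_le h1 (Nat.le_ceil _)
    _ = _ := Real.rpow_natCast _ _

theorem besselSymbol_sq (s : ℕ) (ξ : E d) : besselSymbol s ξ ^ 2 = (1 + ‖ξ‖ ^ 2) ^ s := by
  rw [besselSymbol, ← Real.rpow_natCast, ← Real.rpow_mul (by positivity), Nat.cast_ofNat,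
    div_mul_cancel₀ _ two_ne_zero, Real.rpow_natCast]

theorem besselPotential_eq (s : ℝ) : TemperedDistribution.besselPotential (E d) ℂ s
    = TemperedDistribution.fourierMultiplierCLM ℂ fun ξ => (besselSymbol s ξ : ℂ) := rfl

theorem toDistr_fourierInv (f : L2 d) : toDistr d (𝓕⁻ f) = 𝓕⁻ (toDistr d f) :=
  (Lp.fourierInv_toTemperedDistribution_eq f).symm

theorem toDistr_fourier (f : L2 d) : toDistr d (𝓕 f) = 𝓕 (toDistr d f) :=
  (Lp.fourier_toTemperedDistribution_eq f).symm

/-- Together with its converse `eq_smulLeftCLM_toDistr`, this translates the distributional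
definition of H^s into almost everywhere identities between Fourier transforms. -/
theorem smulLeftCLM_toDistr {m : E d → ℂ} (hm : m.HasTemperateGrowth) {g b : L2 d}
    (h : ∀ᵐ ξ, b ξ = m ξ * g ξ) :
    TemperedDistribution.smulLeftCLM ℂ m (toDistr d g) = toDistr d b := by
  ext φ
  rw [TemperedDistribution.smulLeftCLM_apply_apply, toDistr_apply, toDistr_apply]
  refine integral_congr_ae ?_
  filter_upwards [h] with ξ hξ
  rw [hξ, SchwartzMap.smulLeftCLM_apply_apply hm, smul_eq_mul]
  ring

/-- Elements of `L²` agree with locally integrable functions that define the same distribution. -/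
theorem ae_eq_of_forall_integral_schwartz {F G : E d → ℂ} (hF : LocallyIntegrable F)
    (hG : LocallyIntegrable G) (h : ∀ φ : 𝓢(E d, ℂ), ∫ x, φ x * F x = ∫ x, φ x * G x) :
    F =ᵐ[volume] G := by
  refine ae_eq_of_integral_contDiff_smul_eq hF hG fun g hg hgs => ?_
  have hs : HasCompactSupport fun x => (g x : ℂ) := hgs.comp_left Complex.ofReal_zero
  exact h (hs.toSchwartzMap (Complex.ofRealCLM.contDiff.comp hg))

theorem eq_smulLeftCLM_toDistr {m : E d → ℂ} (hm : m.HasTemperateGrowth) {g b : L2 d}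
    (h : TemperedDistribution.smulLeftCLM ℂ m (toDistr d g) = toDistr d b) :
    ∀ᵐ ξ, b ξ = m ξ * g ξ := by
  have hg : LocallyIntegrable (g : E d → ℂ) := (Lp.memLp g).locallyIntegrable one_le_two
  have hmc : Continuous m := hm.1.continuous
  refine ae_eq_of_forall_integral_schwartz ((Lp.memLp b).locallyIntegrable one_le_two) ?_
    fun φ => ?_
  · rw [← locallyIntegrableOn_univ] at hg ⊢
    exact hg.continuousOn_mul hmc.continuousOn isOpen_univ.isLocallyClosed
  · rw [← toDistr_apply, ← h, TemperedDistribution.smulLeftCLM_apply_apply, toDistr_apply]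
    congr 1; ext ξ
    rw [SchwartzMap.smulLeftCLM_apply_apply hm, smul_eq_mul]
    ring

namespace H

/-- An element of `H^s` with prescribed Fourier transform `g`. -/
theorem exists_of_fourier {s : ℝ≥0} {g b : L2 d} (h : ∀ᵐ ξ, b ξ = besselSymbol s ξ * g ξ) :
    ∃ f : H d s, toL2 f = 𝓕⁻ g ∧ f.bessel = 𝓕⁻ b := by
  have h1 : TemperedDistribution.besselPotential (E d) ℂ s (toDistr d (𝓕⁻ g))
      = toDistr d (𝓕⁻ b) := by
    rw [besselPotential_eq, TemperedDistribution.fourierMultiplierCLM_apply, toDistr_fourierInv,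
      FourierTransform.fourier_fourierInv_eq,
      smulLeftCLM_toDistr (hasTemperateGrowth_besselSymbol s) h, toDistr_fourierInv]
  let f : H d s := (⟨𝓕⁻ g, 𝓕⁻ b, h1⟩ : sobolevSubmodule d s)
  refine ⟨f, rfl, toDistr_injective d ?_⟩
  rw [toDistr_bessel, ← h1]
  rfl

theorem fourier_bessel {s : ℝ≥0} (f : H d s) :
    ∀ᵐ ξ, (𝓕 f.bessel : L2 d) ξ = besselSymbol s ξ * (𝓕 (toL2 f) : L2 d) ξ := by
  refine eq_smulLeftCLM_toDistr (hasTemperateGrowth_besselSymbol s) ?_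
  rw [toDistr_fourier, toDistr_fourier, toDistr_bessel, besselPotential_eq,
    TemperedDistribution.fourierMultiplierCLM_apply, FourierTransform.fourier_fourierInv_eq]

theorem bessel_sub {s : ℝ≥0} (f g : H d s) : (f - g).bessel = f.bessel - g.bessel :=
  map_sub (besselₗ d s) f g

theorem isometry_bessel (d : ℕ) (s : ℝ≥0) : Isometry (bessel : H d s → L2 d) :=
  Isometry.of_dist_eq fun f g => by rw [dist_eq_norm, dist_eq_norm, norm_def, bessel_sub]

/-- A family in `H^s` is continuous if the weighted Fourier transforms are continuous in `L²`. -/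
theorem continuous_of_bessel {X : Type*} [TopologicalSpace X] {s : ℝ≥0} {u : X → H d s}
    (h : Continuous fun x => (u x).bessel) : Continuous u :=
  (isometry_bessel d s).isEmbedding.continuous_iff.2 h

end H

theorem memLp_mul_comp {k : E d → ℂ} (hk : MemLp k 2) (a : Spec d) (r : ℝ) :
    MemLp (fun ξ => k ξ * a (r • ξ)) 2 :=
  MemLp.of_le_mul (c := ‖a‖) hk
    (hk.aestronglyMeasurable.mul (Continuous.aestronglyMeasurable (by fun_prop)))
    (Eventually.of_forall fun ξ => by
      rw [norm_mul, mul_comm]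
      exact mul_le_mul_of_nonneg_right (a.norm_apply_le _) (norm_nonneg _))

/-- The map `a ↦ k(ξ) a(rξ)` from `Spec d` to `L²`. -/
def specL2 {k : E d → ℂ} (hk : MemLp k 2) (r : ℝ) : Spec d →L[ℂ] L2 d :=
  LinearMap.mkContinuous
    { toFun := fun a => (memLp_mul_comp hk a r).toLp _
      map_add' := fun a b => by
        rw [← MemLp.toLp_add]
        refine MemLp.toLp_congr _ _ (Eventually.of_forall fun ξ => ?_)
        simp [mul_add]
      map_smul' := fun c a => by
        rw [RingHom.id_apply, ← MemLp.toLp_const_smul]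
        refine MemLp.toLp_congr _ _ (Eventually.of_forall fun ξ => ?_)
        simp [mul_left_comm] }
    ‖hk.toLp k‖ (fun a => by
      rw [mul_comm]
      refine Lp.norm_le_mul_norm_of_ae_le_mul ?_
      filter_upwards [(memLp_mul_comp hk a r).coeFn_toLp, hk.coeFn_toLp] with ξ h1 h2
      rw [h2]
      refine (congrArg norm h1).le.trans ?_
      rw [norm_mul, mul_comm]
      exact mul_le_mul_of_nonneg_right (a.norm_apply_le _) (norm_nonneg _))

theorem specL2_eq {k : E d → ℂ} (hk : MemLp k 2) (r : ℝ) (a : Spec d) :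
    specL2 hk r a = (memLp_mul_comp hk a r).toLp _ := rfl

theorem coeFn_specL2 {k : E d → ℂ} (hk : MemLp k 2) (r : ℝ) (a : Spec d) :
    specL2 hk r a =ᵐ[volume] fun ξ => k ξ * a (r • ξ) := (memLp_mul_comp hk a r).coeFn_toLp

theorem norm_sq_toLp {f : E d → ℂ} (hf : MemLp f 2) : ‖hf.toLp f‖ ^ 2 = ∫ ξ, ‖f ξ‖ ^ 2 := by
  have h1 : ∫ ξ, ‖(hf.toLp f : E d → ℂ) ξ‖ ^ 2 = ∫ ξ, ‖f ξ‖ ^ 2 := integral_congr_ae (by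
    filter_upwards [hf.coeFn_toLp] with ξ hξ
    rw [hξ])
  rw [← h1, ← Complex.ofReal_inj, ← integral_complex_ofReal]
  have h2 := inner_self_eq_norm_sq_to_K (𝕜 := ℂ) (hf.toLp f)
  rw [L2.inner_def] at h2
  simp only [inner_self_eq_norm_sq_to_K] at h2
  push_cast
  exact h2.symm

theorem one_add_pow_mul_exp_neg_le (n : ℕ) {r : ℝ} (hr : 0 ≤ r) :
    (1 + r) ^ n * Real.exp (-r) ≤ n.factorial * Real.exp 1 := by
  have h := Real.pow_div_factorial_le_exp (1 + r) (by positivity) n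
  rw [div_le_iff₀ (by positivity), Real.exp_add] at h
  calc (1 + r) ^ n * Real.exp (-r)
      ≤ Real.exp 1 * Real.exp r * n.factorial * Real.exp (-r) := by gcongr
    _ = n.factorial * Real.exp 1 * (Real.exp r * Real.exp (-r)) := by ring
    _ = _ := by rw [← Real.exp_add, add_neg_cancel, Real.exp_zero, mul_one]

theorem rapidDecay_of_norm_le_exp {f : E d → ℂ} (hf : Continuous f) {C : ℝ}
    (hC : ∀ ξ, ‖f ξ‖ ≤ C * Real.exp (-‖ξ‖)) : RapidDecay f := by
  refine ⟨hf, fun n => ⟨|C| * (n.factorial * Real.exp 1), fun ξ => ?_⟩⟩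
  calc (1 + ‖ξ‖) ^ n * ‖f ξ‖ ≤ (1 + ‖ξ‖) ^ n * (|C| * Real.exp (-‖ξ‖)) := by
        gcongr
        exact (hC ξ).trans (by gcongr; exact le_abs_self C)
    _ = |C| * ((1 + ‖ξ‖) ^ n * Real.exp (-‖ξ‖)) := by ring
    _ ≤ _ := mul_le_mul_of_nonneg_left (one_add_pow_mul_exp_neg_le n (norm_nonneg ξ)) (abs_nonneg C)

theorem specWeight_le_exp (ξ : E d) : specWeight ξ ≤ Real.exp (-‖ξ‖) :=
  (mul_le_of_le_one_right (Real.exp_pos _).le (polyWeight_le_one ξ)).trans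
    (Real.exp_le_exp.2 (by linarith [norm_nonneg ξ]))

theorem rapidDecay_density (a : Spec d) : RapidDecay (density a) :=
  rapidDecay_of_norm_le_exp (continuous_density a) fun ξ => (norm_density_le a ξ).trans
    (mul_le_mul_of_nonneg_left (specWeight_le_exp ξ) (norm_nonneg _))

theorem rapidDecay_specWeight : RapidDecay fun ξ : E d => (specWeight ξ : ℂ) :=
  rapidDecay_of_norm_le_exp (C := 1) (by fun_prop) fun ξ => by
    rw [Complex.norm_real, Real.norm_of_nonneg (specWeight_pos ξ).le, one_mul]
    exact specWeight_le_exp ξ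

theorem RapidDecay.besselSymbol_mul {f : E d → ℂ} (hf : RapidDecay f) (s : ℝ≥0) :
    RapidDecay fun ξ => besselSymbol s ξ * f ξ :=
  hf.mul_left (g := fun ξ => (besselSymbol s ξ : ℂ)) (C := 1) (m := ⌈(s : ℝ)⌉₊) (by fun_prop)
    fun ξ => by
      rw [Complex.norm_real, Real.norm_of_nonneg (besselSymbol_pos _ _).le, one_mul]
      exact besselSymbol_le s ξ

end


/-! ### Growth of the Sobolev norm of the dispersionless solution -/

noncomputable section

open scoped FourierTransform

variable {d : ℕ}

theorem RapidDecay.memLp_fourierInv {f : E d → ℂ} (hf : RapidDecay f) : MemLp (𝓕⁻ f) 2 :=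
  (memLp_congr_ae (coeFn_fourierInv_toLp hf.integrable hf.memLp_two)).1 (Lp.memLp _)

/-- Plancherel's identity for rapidly decaying functions. -/
theorem RapidDecay.integral_norm_sq_fourierInv {f : E d → ℂ} (hf : RapidDecay f) :
    ∫ x, ‖𝓕⁻ f x‖ ^ 2 = ∫ ξ, ‖f ξ‖ ^ 2 := by
  rw [← norm_sq_toLp hf.memLp_fourierInv, ← norm_sq_toLp hf.memLp_two]
  have h1 : hf.memLp_fourierInv.toLp _ = 𝓕⁻ (hf.memLp_two.toLp f) := by
    refine Lp.ext ?_
    exact hf.memLp_fourierInv.coeFn_toLp.trans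
      (coeFn_fourierInv_toLp hf.integrable hf.memLp_two).symm
  rw [h1]
  congr 1
  exact (Lp.fourierTransformₗᵢ (E d) ℂ).symm.norm_map _

theorem memLp_norm_pow_mul_specWeight (s : ℕ) :
    MemLp (fun ξ : E d => ((‖ξ‖ ^ s : ℝ) : ℂ) * specWeight ξ) 2 :=
  (rapidDecay_specWeight.mul_left (g := fun ξ : E d => ((‖ξ‖ ^ s : ℝ) : ℂ)) (C := 1) (m := s)
    (by fun_prop) fun ξ => by
      rw [Complex.norm_real, Real.norm_of_nonneg (by positivity), one_mul]
      gcongr; linarith).memLp_two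

/-- The map `a ↦ |ξ|^s a^`, whose norm is the homogeneous Sobolev norm. -/
def homSpecL2 (d s : ℕ) : Spec d →L[ℂ] L2 d := specL2 (memLp_norm_pow_mul_specWeight s) 1

theorem norm_sq_homSpecL2 (s : ℕ) (a : Spec d) :
    ‖homSpecL2 d s a‖ ^ 2 = ∫ ξ, ‖ξ‖ ^ (2 * s) * ‖density a ξ‖ ^ 2 := by
  rw [homSpecL2, specL2_eq, norm_sq_toLp]
  congr 1; ext ξ
  rw [one_smul, mul_assoc, ← density, norm_mul, Complex.norm_real,
    Real.norm_of_nonneg (by positivity), mul_pow, ← pow_mul, mul_comm s]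

theorem integrable_pow_mul_norm_sq_density (s : ℕ) (a : Spec d) :
    Integrable fun ξ => ‖ξ‖ ^ (2 * s) * ‖density a ξ‖ ^ 2 := by
  have h := (memLp_mul_comp (memLp_norm_pow_mul_specWeight s) a 1)
  rw [memLp_two_iff_integrable_sq_norm h.aestronglyMeasurable] at h
  refine h.congr (Eventually.of_forall fun ξ => ?_)
  simp only
  rw [one_smul, mul_assoc, ← density, norm_mul, Complex.norm_real,
    Real.norm_of_nonneg (by positivity), mul_pow, ← pow_mul, mul_comm s]

/-- Differentiating the phase `t g²` produces the term linear in `t` that drives the growth. -/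
theorem hasDerivAt_phys_profile_line (t : ℝ) (x e : E d) :
    HasDerivAt (fun s : ℝ => phys (profile t) (x + s • e))
      (Complex.exp (Complex.I * (t * Real.exp (-Real.pi * ‖x‖ ^ 2) ^ 2 : ℝ))
        * ((-2 * Real.pi * inner ℝ x e * Real.exp (-Real.pi * ‖x‖ ^ 2) : ℝ)
          * (1 + (2 * t * Real.exp (-Real.pi * ‖x‖ ^ 2) ^ 2 : ℝ) * Complex.I))) 0 := by
  set g := Real.exp (-Real.pi * ‖x‖ ^ 2) with hg
  have h1 : HasDerivAt (fun s : ℝ => x + s • e) e 0 := by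
    simpa using ((hasDerivAt_id (0 : ℝ)).smul_const e).const_add x
  have h2 : HasDerivAt (fun s : ℝ => Real.exp (-Real.pi * ‖x + s • e‖ ^ 2))
      (-2 * Real.pi * inner ℝ x e * g) 0 := by
    have := (h1.norm_sq.const_mul (-Real.pi)).exp
    simp only [zero_smul, add_zero] at this
    refine this.congr_deriv ?_
    rw [← hg]; ring
  have h3 : HasDerivAt (fun s : ℝ => Complex.exp (Complex.I
      * (t * Real.exp (-Real.pi * ‖x + s • e‖ ^ 2) ^ 2 : ℝ))) _ 0 :=
    (((h2.pow 2).const_mul t).ofReal_comp.const_mul Complex.I).cexp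
  have h4 := h3.mul h2.ofReal_comp
  simp only [phys_profile]
  refine h4.congr_deriv ?_
  simp only [zero_smul, add_zero, ← hg, Pi.pow_apply]
  push_cast
  ring

/-- The derivative in a fixed unit direction `e` has squared modulus at least `t² k(x)` with `k`
independent of `t`. By Plancherel this bounds `∫ ⟨ξ,e⟩²|v^|²` from below, and `⟨ξ,e⟩² ≤ 1 +
‖ξ‖^(2s)` splits it into the conserved L² norm, which becomes `B`, and the Ḣ^s norm. -/
theorem exists_growth (hd : 0 < d) : ∃ c > 0, ∃ B, ∀ s : ℕ, 0 < s → ∀ t : ℝ,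
    c * t ^ 2 - B ≤ ‖homSpecL2 d s (profile t)‖ ^ 2 := by
  let e : E d := EuclideanSpace.single ⟨0, hd⟩ 1
  have he : ‖e‖ = 1 := by simp [e]
  let k : E d → ℝ := fun x =>
    (4 * Real.pi * inner ℝ x e * Real.exp (-Real.pi * ‖x‖ ^ 2) ^ 3) ^ 2
  have hkc : Continuous k := by fun_prop
  let D : ℝ → E d → ℂ := fun t ξ => (2 * Real.pi * inner ℝ ξ e : ℝ) * Complex.I
    * density (profile t) ξ
  have hD : ∀ t, RapidDecay (D t) := fun t =>
    (rapidDecay_density _).mul_left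
      (g := fun ξ => ((2 * Real.pi * inner ℝ ξ e : ℝ) : ℂ) * Complex.I) (C := 2 * Real.pi) (m := 1)
      (by fun_prop) fun ξ => by
        rw [norm_mul, Complex.norm_I, mul_one, Complex.norm_real, norm_mul,
          Real.norm_of_nonneg (by positivity), pow_one]
        have := norm_inner_le_norm (𝕜 := ℝ) ξ e
        rw [he, mul_one] at this
        gcongr
        linarith
  have hDk : ∀ t x, t ^ 2 * k x ≤ ‖𝓕⁻ (D t) x‖ ^ 2 := fun t x => by
    have h1 := (hasDerivAt_phys_profile_line t x e).unique
      ((rapidDecay_density (profile t)).hasDerivAt_fourierInv_line x e)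
    rw [← h1, norm_mul, norm_cexp_I_mul_ofReal, one_mul, norm_mul, mul_pow, Complex.norm_real,
      Real.norm_eq_abs, sq_abs, ← Complex.normSq_eq_norm_sq,
      ← Complex.ofReal_one, Complex.normSq_add_mul_I]
    set g := Real.exp (-Real.pi * ‖x‖ ^ 2)
    simp only [k]
    have h2 : 0 ≤ (-2 * Real.pi * inner ℝ x e * g) ^ 2 := sq_nonneg _
    have h3 : t ^ 2 * (4 * Real.pi * inner ℝ x e * g ^ 3) ^ 2
        = (-2 * Real.pi * inner ℝ x e * g) ^ 2 * (2 * t * g ^ 2) ^ 2 := by ring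
    rw [h3]
    exact mul_le_mul_of_nonneg_left (by linarith) h2
  have hDi : ∀ t, Integrable fun x => ‖𝓕⁻ (D t) x‖ ^ 2 := fun t =>
    (memLp_two_iff_integrable_sq_norm (hD t).memLp_fourierInv.aestronglyMeasurable).1
      (hD t).memLp_fourierInv
  have hk0 : ∀ x, 0 ≤ k x := fun x => sq_nonneg _
  -- The lower bound at `t = 1` dominates `k` by an integrable function.
  have hki : Integrable k := (hDi 1).mono' hkc.aestronglyMeasurable
    (Eventually.of_forall fun x => by
      rw [Real.norm_of_nonneg (hk0 x)]
      simpa using hDk 1 x)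
  have hkpos : 0 < ∫ x, k x := by
    rw [integral_pos_iff_support_of_nonneg hk0 hki]
    refine hkc.isOpen_support.measure_pos volume ⟨e, ?_⟩
    rw [Function.mem_support]
    simp only [k]
    rw [real_inner_self_eq_norm_sq, he]
    positivity
  refine ⟨(∫ x, k x) / (4 * Real.pi ^ 2), by positivity,
    ∫ x : E d, Real.exp (-Real.pi * ‖x‖ ^ 2) ^ 2, fun s hs t => ?_⟩
  have hB : ∫ x : E d, Real.exp (-Real.pi * ‖x‖ ^ 2) ^ 2 = ∫ ξ, ‖density (profile (d := d) t) ξ‖ ^ 2 := by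
    rw [← (rapidDecay_density _).integral_norm_sq_fourierInv]
    congr 1; ext x
    rw [← norm_phys_profile t x]
    rfl
  have h1 : t ^ 2 * ∫ x, k x ≤ ∫ ξ, ‖D t ξ‖ ^ 2 := by
    rw [← (hD t).integral_norm_sq_fourierInv, ← integral_const_mul]
    exact integral_mono (hki.const_mul _) (hDi t) (hDk t)
  have hI0 : Integrable fun ξ => ‖density (profile (d := d) t) ξ‖ ^ 2 := by
    simpa using integrable_pow_mul_norm_sq_density 0 (profile (d := d) t)
  have hIs := integrable_pow_mul_norm_sq_density s (profile (d := d) t)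
  have h2 : ∫ ξ, ‖D t ξ‖ ^ 2 ≤ 4 * Real.pi ^ 2 * ((∫ ξ, ‖density (profile (d := d) t) ξ‖ ^ 2)
      + ∫ ξ, ‖ξ‖ ^ (2 * s) * ‖density (profile (d := d) t) ξ‖ ^ 2) := by
    rw [← integral_add hI0 hIs, ← integral_const_mul]
    refine integral_mono ((memLp_two_iff_integrable_sq_norm
      (hD t).continuous.aestronglyMeasurable).1 (hD t).memLp_two) ((hI0.add hIs).const_mul _)
      fun ξ => ?_
    simp only [D]
    rw [norm_mul, norm_mul, Complex.norm_I, mul_one, Complex.norm_real, mul_pow, Real.norm_eq_abs,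
      sq_abs]
    have h3 : inner ℝ ξ e ^ 2 ≤ 1 + ‖ξ‖ ^ (2 * s) := by
      have h4 := abs_real_inner_le_norm ξ e
      rw [he, mul_one] at h4
      have h5 : inner ℝ ξ e ^ 2 ≤ ‖ξ‖ ^ 2 := by
        rw [← sq_abs]; gcongr
      rcases le_total ‖ξ‖ 1 with h | h
      · have : ‖ξ‖ ^ 2 ≤ 1 := pow_le_one₀ (norm_nonneg _) h
        have : 0 ≤ ‖ξ‖ ^ (2 * s) := by positivity
        linarith
      · have : ‖ξ‖ ^ 2 ≤ ‖ξ‖ ^ (2 * s) := pow_le_pow_right₀ h (by omega)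
        linarith
    calc (2 * Real.pi * inner ℝ ξ e) ^ 2 * ‖density (profile t) ξ‖ ^ 2
        = 4 * Real.pi ^ 2 * (inner ℝ ξ e ^ 2 * ‖density (profile t) ξ‖ ^ 2) := by ring
      _ ≤ 4 * Real.pi ^ 2 * ((1 + ‖ξ‖ ^ (2 * s)) * ‖density (profile t) ξ‖ ^ 2) := by gcongr
      _ = _ := by ring
  rw [norm_sq_homSpecL2, hB, div_mul_eq_mul_div, sub_le_iff_le_add, div_le_iff₀ (by positivity)]
  linarith

theorem tendsto_norm_homSpecL2_profile (hd : 0 < d) {s : ℕ} (hs : 0 < s) :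
    Tendsto (fun t : ℝ => ‖homSpecL2 d s (profile t)‖) atTop atTop := by
  obtain ⟨c, hc, B, h⟩ := exists_growth hd
  have h1 : Tendsto (fun t : ℝ => c * t ^ 2 - B) atTop atTop :=
    tendsto_atTop_add_const_right _ _ ((tendsto_pow_atTop two_ne_zero).const_mul_atTop hc)
  have h2 := Real.tendsto_sqrt_atTop.comp (tendsto_atTop_mono (h s hs) h1)
  refine h2.congr fun t => ?_
  exact Real.sqrt_sq (norm_nonneg _)

end


/-! ### Dilations and space-time plane waves -/

noncomputable section

open scoped FourierTransform BoundedContinuousFunction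

variable {d : ℕ}

theorem integral_comp_inv_smul {F : Type*} [NormedAddCommGroup F] [NormedSpace ℝ F] {ν : ℝ}
    (hν : 0 < ν) (f : E d → F) : ∫ ξ, f (ν⁻¹ • ξ) = ν ^ d • ∫ ξ, f ξ := by
  rw [Measure.integral_comp_smul, finrank_euclideanSpace_fin, inv_pow, inv_inv,
    abs_of_pos (by positivity)]

/-- The operation on Fourier transforms that corresponds to `u ↦ lam * u (ν x)`. -/
def dilate (lam ν : ℝ) (f : E d → ℂ) (ξ : E d) : ℂ := (lam * (ν ^ d)⁻¹ : ℝ) * f (ν⁻¹ • ξ)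

theorem RapidDecay.dilate {f : E d → ℂ} (hf : RapidDecay f) (lam : ℝ) {ν : ℝ} (hν : 0 < ν) :
    RapidDecay (dilate lam ν f) :=
  (hf.comp_smul (inv_pos.2 hν)).const_mul _

theorem fourierInv_dilate (lam : ℝ) {ν : ℝ} (hν : 0 < ν) (f : E d → ℂ) (x : E d) :
    𝓕⁻ (dilate lam ν f) x = lam * 𝓕⁻ f (ν • x) := by
  rw [Real.fourierInv_eq', Real.fourierInv_eq']
  set F : E d → ℂ := fun η =>
    Complex.exp (↑(2 * Real.pi * inner ℝ η (ν • x)) * Complex.I) • f η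
  have h1 : ∀ ξ : E d, Complex.exp (↑(2 * Real.pi * inner ℝ ξ x) * Complex.I)
      • dilate lam ν f ξ = (lam * (ν ^ d)⁻¹ : ℝ) * F (ν⁻¹ • ξ) := fun ξ => by
    simp only [F, dilate, smul_eq_mul]
    rw [inner_smul_left, inner_smul_right]
    have : (starRingEnd ℝ) ν⁻¹ * (ν * inner ℝ ξ x) = inner ℝ ξ x := inv_mul_cancel_left₀ hν.ne' _
    rw [this]
    ring
  rw [integral_congr_ae (Eventually.of_forall h1), integral_const_mul,
    integral_comp_inv_smul hν F, Complex.real_smul]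
  push_cast
  have : (ν : ℂ) ≠ 0 := by exact_mod_cast hν.ne'
  field_simp

theorem laplacianSymbol_mul_dilate (lam : ℝ) {ν : ℝ} (hν : 0 < ν) (f : E d → ℂ) (ξ : E d) :
    -(4 * Real.pi ^ 2 * ‖ξ‖ ^ 2 : ℝ) * dilate lam ν f ξ
      = dilate (lam * ν ^ 2) ν (fun η => -(4 * Real.pi ^ 2 * ‖η‖ ^ 2 : ℝ) * f η) ξ := by
  simp only [dilate]
  rw [norm_smul, Real.norm_of_nonneg (inv_pos.2 hν).le]
  push_cast
  have : (ν : ℂ) ≠ 0 := by exact_mod_cast hν.ne'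
  field_simp

theorem integral_mul_norm_sq_dilate (lam : ℝ) {ν : ℝ} (hν : 0 < ν) (f : E d → ℂ)
    (k : E d → ℝ) : ∫ ξ, k ξ * ‖dilate lam ν f ξ‖ ^ 2
      = lam ^ 2 * (ν ^ d)⁻¹ * ∫ η, k (ν • η) * ‖f η‖ ^ 2 := by
  set F : E d → ℝ := fun η => k (ν • η) * ‖f η‖ ^ 2
  have h1 : ∀ ξ : E d, k ξ * ‖dilate lam ν f ξ‖ ^ 2 = (lam * (ν ^ d)⁻¹) ^ 2
      * F (ν⁻¹ • ξ) := fun ξ => by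
    simp only [F, dilate]
    rw [norm_mul, Complex.norm_real, mul_pow, Real.norm_eq_abs, sq_abs,
      smul_inv_smul₀ hν.ne']
    ring
  rw [integral_congr_ae (Eventually.of_forall h1), integral_const_mul,
    integral_comp_inv_smul hν F, smul_eq_mul]
  field_simp

/-- The phase of the space-time exponentials `e^{i(2π⟨ξ,x⟩ - 4π²|ξ|²t)}`. -/
def wavePhase (ξ : E d) : ℝ × E d →L[ℝ] ℝ :=
  (2 * Real.pi) • (innerSL ℝ ξ).comp (ContinuousLinearMap.snd ℝ ℝ (E d))
    - (4 * Real.pi ^ 2 * ‖ξ‖ ^ 2) • ContinuousLinearMap.fst ℝ ℝ (E d)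

theorem wavePhase_apply (ξ : E d) (z : ℝ × E d) :
    wavePhase ξ z = 2 * Real.pi * inner ℝ ξ z.2 - 4 * Real.pi ^ 2 * ‖ξ‖ ^ 2 * z.1 := rfl

theorem continuous_wavePhase : Continuous (wavePhase (d := d)) := by
  unfold wavePhase
  have h : Continuous fun ξ : E d => (innerSL ℝ ξ).comp (ContinuousLinearMap.snd ℝ ℝ (E d)) :=
    ((ContinuousLinearMap.compL ℝ (ℝ × E d) (E d) ℝ).flip
      (ContinuousLinearMap.snd ℝ ℝ (E d))).continuous.comp (innerSL ℝ).continuous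
  fun_prop

theorem norm_wavePhase_le (ξ : E d) : ‖wavePhase ξ‖ ≤ 4 * Real.pi ^ 2 * (1 + ‖ξ‖) ^ 2 := by
  refine ContinuousLinearMap.opNorm_le_bound _ (by positivity) fun z => ?_
  rw [wavePhase_apply]
  have h1 : |inner ℝ ξ z.2| ≤ ‖ξ‖ * ‖z‖ :=
    (abs_real_inner_le_norm _ _).trans (mul_le_mul_of_nonneg_left (norm_snd_le z) (norm_nonneg _))
  have h2 : |z.1| ≤ ‖z‖ := norm_fst_le z
  have h3 : (2 : ℝ) * Real.pi ≤ 4 * Real.pi ^ 2 := by nlinarith [Real.pi_gt_three]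
  calc ‖2 * Real.pi * inner ℝ ξ z.2 - 4 * Real.pi ^ 2 * ‖ξ‖ ^ 2 * z.1‖
      ≤ 2 * Real.pi * |inner ℝ ξ z.2| + 4 * Real.pi ^ 2 * ‖ξ‖ ^ 2 * |z.1| := by
        refine (norm_sub_le _ _).trans (le_of_eq ?_)
        rw [norm_mul, norm_mul _ z.1, Real.norm_of_nonneg (r := 2 * Real.pi) (by positivity),
          Real.norm_of_nonneg (r := 4 * Real.pi ^ 2 * ‖ξ‖ ^ 2) (by positivity)]
        rfl
    _ ≤ 4 * Real.pi ^ 2 * (‖ξ‖ * ‖z‖) + 4 * Real.pi ^ 2 * ‖ξ‖ ^ 2 * ‖z‖ := by gcongr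
    _ = 4 * Real.pi ^ 2 * (‖ξ‖ + ‖ξ‖ ^ 2) * ‖z‖ := by ring
    _ ≤ _ := by gcongr; nlinarith [norm_nonneg ξ]

/-- The phase is quadratic in `ξ`, so two powers of it cost `(1 + ‖ξ‖) ^ 4`; this is the source of
the factor `4!`. -/
theorem wavePhase_bound (d : ℕ) : ∀ j ≤ 2, ∀ ξ : E d, ‖wavePhase ξ‖ ^ j * |Real.exp (-‖ξ‖)|
    ≤ (4 * Real.pi ^ 2) ^ 2 * (Nat.factorial 4 * Real.exp 1) := by
  intro j hj ξ
  have h0 : 1 ≤ 1 + ‖ξ‖ := by linarith [norm_nonneg ξ]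
  have h1 : 1 ≤ 4 * Real.pi ^ 2 * (1 + ‖ξ‖) ^ 2 :=
    one_le_mul_of_one_le_of_one_le (by nlinarith [Real.pi_gt_three]) (one_le_pow₀ h0)
  have h2 := one_add_pow_mul_exp_neg_le 4 (norm_nonneg ξ)
  rw [abs_of_pos (Real.exp_pos _)]
  calc ‖wavePhase ξ‖ ^ j * Real.exp (-‖ξ‖)
      ≤ (4 * Real.pi ^ 2 * (1 + ‖ξ‖) ^ 2) ^ 2 * Real.exp (-‖ξ‖) := by
        gcongr
        exact (pow_le_pow_left₀ (norm_nonneg _) (norm_wavePhase_le ξ) j).trans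
          (pow_le_pow_right₀ h1 hj)
    _ = (4 * Real.pi ^ 2) ^ 2 * ((1 + ‖ξ‖) ^ 4 * Real.exp (-‖ξ‖)) := by ring
    _ ≤ _ := by gcongr

theorem continuous_exp_neg_norm : Continuous fun ξ : E d => Real.exp (-‖ξ‖) := by fun_prop

/-- The damped plane waves `e^{-|ξ|} e^{i(2π⟨ξ,x⟩ - 4π²|ξ|²t)}`, as functions of `ξ`. -/
def wave (z : ℝ × E d) : E d →ᵇ ℂ :=
  oscExp continuous_wavePhase continuous_exp_neg_norm (wavePhase_bound d) z

/-- The derivative of `wave`. -/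
def waveDeriv (z : ℝ × E d) : ℝ × E d →L[ℝ] (E d →ᵇ ℂ) :=
  oscExpDeriv continuous_wavePhase continuous_exp_neg_norm (wavePhase_bound d) z

theorem wave_apply (z : ℝ × E d) (ξ : E d) :
    wave z ξ = Complex.exp (Complex.I * (wavePhase ξ z : ℝ)) * Real.exp (-‖ξ‖) := rfl

theorem wave_eq (z : ℝ × E d) (ξ : E d) :
    wave z ξ = Complex.exp (Complex.I * (2 * Real.pi * inner ℝ ξ z.2 : ℝ))
      * Complex.exp (Complex.I * (-(4 * Real.pi ^ 2 * ‖ξ‖ ^ 2 * z.1) : ℝ)) * Real.exp (-‖ξ‖) := by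
  rw [wave_apply, wavePhase_apply, ← Complex.exp_add]
  push_cast
  ring_nf

theorem waveDeriv_apply (z δ : ℝ × E d) (ξ : E d) :
    waveDeriv z δ ξ = Complex.I * (wavePhase ξ δ : ℝ) * wave z ξ := rfl

theorem hasFDerivAt_wave (z : ℝ × E d) : HasFDerivAt wave (waveDeriv z) z :=
  hasFDerivAt_oscExp _ _ _ z

theorem contDiff_wave : ContDiff ℝ 1 (wave (d := d)) := by
  rw [contDiff_one_iff_hasFDerivAt]
  exact ⟨waveDeriv, continuous_oscExpDeriv continuous_wavePhase continuous_exp_neg_norm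
    (wavePhase_bound d), hasFDerivAt_wave⟩

theorem integrable_exp_mul_polyWeight_mul (a : Spec d) : Integrable fun ξ : E d =>
    ((Real.exp (-‖ξ‖) * polyWeight ξ : ℝ) : ℂ) * a ξ := by
  refine (integrable_polyWeight.mul_const ‖a‖).mono'
    (Continuous.aestronglyMeasurable (by fun_prop)) (Eventually.of_forall fun ξ => ?_)
  rw [norm_mul, Complex.norm_real, Real.norm_of_nonneg
    (mul_pos (Real.exp_pos _) (polyWeight_pos ξ)).le]
  refine mul_le_mul (mul_le_of_le_one_left (polyWeight_pos ξ).le ?_) (a.norm_apply_le ξ)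
    (norm_nonneg _) (polyWeight_pos ξ).le
  exact Real.exp_le_one_iff.2 (neg_nonpos.2 (norm_nonneg _))

/-- Integration against `e^{-|ξ|}(1+|ξ|)^{-d-1}`. -/
def specInt (d : ℕ) : Spec d →L[ℂ] ℂ :=
  LinearMap.mkContinuous
    { toFun := fun a => ∫ ξ, ((Real.exp (-‖ξ‖) * polyWeight ξ : ℝ) : ℂ) * a ξ
      map_add' := fun a b => by
        rw [← integral_add (integrable_exp_mul_polyWeight_mul a)
          (integrable_exp_mul_polyWeight_mul b)]
        simp only [Spec.add_apply, mul_add]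
      map_smul' := fun c a => by
        simp only [Spec.smul_apply, RingHom.id_apply, smul_eq_mul]
        rw [← integral_const_mul]
        simp only [mul_left_comm] }
    (∫ ξ : E d, polyWeight ξ) (fun a => by
      rw [← integral_mul_const]
      refine norm_integral_le_of_norm_le (integrable_polyWeight.mul_const _)
        (Eventually.of_forall fun ξ => ?_)
      rw [norm_mul, Complex.norm_real, Real.norm_of_nonneg
        (mul_pos (Real.exp_pos _) (polyWeight_pos ξ)).le]
      refine mul_le_mul (mul_le_of_le_one_left (polyWeight_pos ξ).le ?_) (a.norm_apply_le ξ)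
        (norm_nonneg _) (polyWeight_pos ξ).le
      exact Real.exp_le_one_iff.2 (neg_nonpos.2 (norm_nonneg _)))

theorem specInt_apply (a : Spec d) :
    specInt d a = ∫ ξ, ((Real.exp (-‖ξ‖) * polyWeight ξ : ℝ) : ℂ) * a ξ := rfl

theorem exp_mul_exp_mul_polyWeight (ξ : E d) :
    (Real.exp (-‖ξ‖) * polyWeight ξ) * Real.exp (-‖ξ‖) = specWeight ξ := by
  rw [specWeight, show -2 * ‖ξ‖ = -‖ξ‖ + -‖ξ‖ by ring, Real.exp_add]; ring

/-- The factor `e^{-2|ξ|}` of the weight is shared: one half makes `wave` differentiable in sup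
norm, the other stays in `specInt`. The free evolution at `(t, x)` is thus a continuous linear
functional of a bounded bilinear expression in the C¹ map `wave` and in `a`, which gives joint
regularity in `(t, x)` even when `a` moves with time. -/
theorem specInt_wave (z : ℝ × E d) (a : Spec d) :
    specInt d (mulOp (wave z) a) = phys (freeFlow z.1 a) z.2 := by
  rw [specInt_apply, phys_eq_integral]
  congr 1; ext ξ
  rw [density, freeFlow_apply, mulOp_apply, wave_eq, ← exp_mul_exp_mul_polyWeight]
  push_cast
  ring

/-- The time derivative of a plane wave brings down the symbol of `iΔ`; this is how the dispersive
term reappears from the interaction picture. -/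
theorem specInt_waveDeriv_time (z : ℝ × E d) (c : ℝ) (a : Spec d) :
    specInt d (mulOp (waveDeriv z (c, 0)) a) = Complex.I * c *
      𝓕⁻ (fun ξ => -(4 * Real.pi ^ 2 * ‖ξ‖ ^ 2 : ℝ) * density (freeFlow z.1 a) ξ) z.2 := by
  rw [specInt_apply, Real.fourierInv_eq', ← integral_const_mul]
  congr 1; ext ξ
  rw [density, freeFlow_apply, mulOp_apply, waveDeriv_apply, wave_eq, wavePhase_apply,
    ← exp_mul_exp_mul_polyWeight, inner_zero_right, smul_eq_mul, mul_comm _ Complex.I]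
  push_cast
  ring

end


/-! ### The rescaled curve as a classical solution of (NLS) -/

noncomputable section

open scoped FourierTransform BoundedContinuousFunction

variable {d : ℕ}

theorem norm_phys_le (a : Spec d) (x : E d) : ‖phys a x‖ ≤ ‖a‖ * ∫ ξ : E d, specWeight ξ := by
  rw [phys_eq_integral, ← integral_const_mul]
  refine norm_integral_le_of_norm_le (integrable_specWeight.const_mul _)
    (Eventually.of_forall fun ξ => ?_)
  rw [norm_mul, norm_cexp_I_mul_ofReal, one_mul]
  exact norm_density_le a ξ

theorem RapidDecay.coeFn_fourierInv {F : E d → ℂ} (hF : RapidDecay F) {g : L2 d}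
    (h : g =ᵐ[volume] F) : (𝓕⁻ g : L2 d) =ᵐ[volume] 𝓕⁻ F := by
  have : g = hF.memLp_two.toLp F := Lp.ext (h.trans hF.memLp_two.coeFn_toLp.symm)
  rw [this]
  exact coeFn_fourierInv_toLp hF.integrable hF.memLp_two

/-- Functions `x ↦ lam * phys a (ν x)` as elements of `H^σ`, depending continuously on `a`. -/
theorem exists_continuous_toH (σ : ℝ≥0) (lam : ℝ) {ν : ℝ} (hν : 0 < ν) :
    ∃ J : Spec d → H d σ, Continuous J ∧
      (∀ a, (J a).fn =ᵐ[volume] fun x => lam * phys a (ν • x)) ∧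
      ∀ a, ‖J a‖ ^ 2 = lam ^ 2 * (ν ^ d)⁻¹ *
        ∫ η, besselSymbol σ (ν • η) ^ 2 * ‖density a η‖ ^ 2 := by
  -- The dilated weight, with or without the Bessel symbol, is a fixed L² kernel that multiplies
  -- `a`. Continuity in `a` is then that of the bounded operator `specL2`.
  have hk := rapidDecay_specWeight.dilate (d := d) lam hν
  have hkσ := hk.besselSymbol_mul σ
  have hg : ∀ a : Spec d, specL2 hk.memLp_two ν⁻¹ a =ᵐ[volume] dilate lam ν (density a) := fun a => by
    filter_upwards [coeFn_specL2 hk.memLp_two ν⁻¹ a] with ξ hξ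
    rw [hξ, dilate, dilate, density, mul_assoc]
  have hb : ∀ a : Spec d, ∀ᵐ ξ, specL2 hkσ.memLp_two ν⁻¹ a ξ
      = besselSymbol σ ξ * dilate lam ν (density a) ξ := fun a => by
    filter_upwards [coeFn_specL2 hkσ.memLp_two ν⁻¹ a] with ξ hξ
    rw [hξ, dilate, dilate, density, mul_assoc, mul_assoc]
  have h : ∀ a : Spec d, ∃ f : H d σ, H.toL2 f = 𝓕⁻ (specL2 hk.memLp_two ν⁻¹ a)
      ∧ f.bessel = 𝓕⁻ (specL2 hkσ.memLp_two ν⁻¹ a) := fun a => H.exists_of_fourier (by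
    filter_upwards [hg a, hb a] with ξ h1 h2
    rw [h1, h2])
  choose J hJ hJb using h
  refine ⟨J, H.continuous_of_bessel ?_, fun a => ?_, fun a => ?_⟩
  · simp_rw [hJb]
    exact (Lp.fourierTransformₗᵢ (E d) ℂ).symm.continuous.comp (specL2 _ _).continuous
  · have h1 := ((rapidDecay_density a).dilate lam hν).coeFn_fourierInv (hg a)
    rw [← hJ a] at h1
    refine h1.trans (Eventually.of_forall fun x => ?_)
    exact fourierInv_dilate lam hν _ x
  · rw [H.norm_def, hJb, ← integral_mul_norm_sq_dilate lam hν _ fun ξ => besselSymbol σ ξ ^ 2]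
    have h1 : ‖(𝓕⁻ (specL2 hkσ.memLp_two ν⁻¹ a) : L2 d)‖ = ‖specL2 hkσ.memLp_two ν⁻¹ a‖ :=
      (Lp.fourierTransformₗᵢ (E d) ℂ).symm.norm_map _
    rw [h1, specL2_eq, norm_sq_toLp]
    refine integral_congr_ae (Eventually.of_forall fun ξ => ?_)
    simp only [dilate, density]
    rw [← mul_pow, mul_assoc, norm_mul, Complex.norm_real,
      Real.norm_of_nonneg (besselSymbol_pos _ _).le]
    simp only [mul_assoc]

/-- Curves in `L²` that solve `i Y' + Δ Y + |Y|² Y = 0` and are bounded functions. -/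
structure IsL2Solution (t₀ : ℝ) (Y : ℝ → L2 d) : Prop where
  continuousOn : ContinuousOn Y (Icc 0 t₀)
  equation : ∀ t ∈ Ico 0 t₀, ∃ L N : L2 d,
    HasDerivWithinAt Y (Complex.I • (L + N)) (Ici t) t ∧
    (∀ᵐ ξ, (𝓕 L : L2 d) ξ = -(4 * Real.pi ^ 2 * ‖ξ‖ ^ 2 : ℝ) * (𝓕 (Y t) : L2 d) ξ) ∧
    ∀ᵐ x, N x = (‖Y t x‖ ^ 2 : ℝ) * Y t x
  bounded : ∃ M : ℝ, ∀ t ∈ Icc 0 t₀, ∀ᵐ x, ‖Y t x‖ ≤ M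

/-- Curves of spectral densities that solve the cubic equation with dispersion `θ`, in the
interaction picture. -/
structure IsInteractionCurve (θ T : ℝ) (p p' : ℝ → Spec d) : Prop where
  continuousOn : ContinuousOn p' (Ioo (-1) (T + 1))
  hasDerivAt : ∀ t ∈ Ioo (-1) (T + 1), HasDerivAt p (p' t) t
  equation : ∀ t ∈ Icc 0 T, p' t = freeFlow (-(θ * t)) (specNonlin (freeFlow (θ * t) (p t)))

/-- The spectral density of the rescaled solution. -/
def scaledSpec (lam ν : ℝ) (p : ℝ → Spec d) (t : ℝ) : Spec d :=
  freeFlow (ν ^ 2 * t) (p (lam ^ 2 * t))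

/-- The rescaled solution. -/
def scaledSol (lam ν : ℝ) (p : ℝ → Spec d) (t : ℝ) (x : E d) : ℂ :=
  lam * phys (scaledSpec lam ν p t) (ν • x)

theorem scaledSol_eq_fourierInv (lam : ℝ) {ν : ℝ} (hν : 0 < ν) (p : ℝ → Spec d) (t : ℝ) :
    scaledSol lam ν p t = 𝓕⁻ (dilate lam ν (density (scaledSpec lam ν p t))) := by
  ext x
  exact (fourierInv_dilate lam hν _ x).symm

theorem scaledSol_eq_specInt (lam ν : ℝ) (p : ℝ → Spec d) (t : ℝ) (x : E d) :
    scaledSol lam ν p t x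
      = lam * specInt d (mulOp (wave (ν ^ 2 * t, ν • x)) (p (lam ^ 2 * t))) := by
  rw [specInt_wave]; rfl

theorem laplacian_scaledSol (lam : ℝ) {ν : ℝ} (hν : 0 < ν) (p : ℝ → Spec d) (t : ℝ) (x : E d) :
    Δ (scaledSol lam ν p t) x = (lam * ν ^ 2 : ℝ) * 𝓕⁻ (fun ξ =>
      -(4 * Real.pi ^ 2 * ‖ξ‖ ^ 2 : ℝ) * density (scaledSpec lam ν p t) ξ) (ν • x) := by
  rw [scaledSol_eq_fourierInv lam hν, ((rapidDecay_density _).dilate lam hν).laplacian_fourierInv,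
    ← fourierInv_dilate _ hν]
  refine congrFun (congrArg _ (funext fun ξ => ?_)) _
  exact laplacianSymbol_mul_dilate lam hν _ ξ

theorem phys_freeFlow_specNonlin_neg (τ : ℝ) (a : Spec d) (x : E d) :
    phys (freeFlow τ (freeFlow (-τ) (specNonlin a))) x
      = Complex.I * ((‖phys a x‖ ^ 2 : ℝ) * phys a x) := by
  rw [freeFlow_freeFlow_neg, phys_specNonlin]

theorem isBoundedBilinearMap_mulOp :
    IsBoundedBilinearMap ℂ fun z : (E d →ᵇ ℂ) × Spec d => mulOp z.1 z.2 :=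
  mulOp.isBoundedBilinearMap

section

variable {θ T lam ν : ℝ} {p p' : ℝ → Spec d}

theorem IsInteractionCurve.contDiffOn (hp : IsInteractionCurve θ T p p') :
    ContDiffOn ℝ 1 p (Ioo (-1) (T + 1)) := by
  rw [show (1 : WithTop ℕ∞) = 0 + 1 from rfl, contDiffOn_succ_iff_deriv_of_isOpen isOpen_Ioo]
  refine ⟨fun t ht => (hp.hasDerivAt t ht).differentiableAt.differentiableWithinAt, by simp, ?_⟩
  rw [contDiffOn_zero]
  exact hp.continuousOn.congr fun t ht => (hp.hasDerivAt t ht).deriv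

theorem IsInteractionCurve.contDiffOn_scaledSol (hp : IsInteractionCurve θ T p p') :
    ContDiffOn ℝ 1 (fun z : ℝ × E d => scaledSol lam ν p z.1 z.2)
      (((fun t => lam ^ 2 * t) ⁻¹' Ioo (-1) (T + 1)) ×ˢ univ) := by
  simp only [scaledSol_eq_specInt]
  have h1 : ContDiff ℝ 1 fun z : ℝ × E d => wave (ν ^ 2 * z.1, ν • z.2) :=
    contDiff_wave.comp (by fun_prop)
  have h2 : ContDiffOn ℝ 1 (fun z : ℝ × E d => p (lam ^ 2 * z.1))
      (((fun t => lam ^ 2 * t) ⁻¹' Ioo (-1) (T + 1)) ×ˢ univ) :=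
    hp.contDiffOn.comp (ContDiff.contDiffOn (by fun_prop)) fun z hz => hz.1
  have h3 : ContDiff ℝ 1 fun z : (E d →ᵇ ℂ) × Spec d => mulOp z.1 z.2 :=
    isBoundedBilinearMap_mulOp.contDiff.restrict_scalars ℝ
  have h4 : ContDiff ℝ 1 (specInt d) := (specInt d).contDiff.restrict_scalars ℝ
  exact contDiffOn_const.mul (h4.comp_contDiffOn (h3.comp_contDiffOn (h1.contDiffOn.prodMk h2)))

/-- The product rule in `Spec d`, before any functional is applied. With `y = ν • x` it gives the
pointwise time derivative, with `y = 0` the derivative in L². -/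
theorem IsInteractionCurve.hasDerivAt_wave_mul (hp : IsInteractionCurve θ T p p') {t : ℝ}
    (ht : lam ^ 2 * t ∈ Ioo (-1) (T + 1)) (y : E d) :
    HasDerivAt (fun t : ℝ => mulOp (wave (ν ^ 2 * t, y)) (p (lam ^ 2 * t)))
      (mulOp (waveDeriv (ν ^ 2 * t, y) (ν ^ 2, 0)) (p (lam ^ 2 * t))
        + ((lam ^ 2 : ℝ) : ℂ) • mulOp (wave (ν ^ 2 * t, y)) (p' (lam ^ 2 * t))) t := by
  have h1 : HasDerivAt (fun t : ℝ => wave (ν ^ 2 * t, y))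
      (waveDeriv (ν ^ 2 * t, y) (ν ^ 2, 0)) t := by
    have h := ((hasDerivAt_id t).const_mul (ν ^ 2)).prodMk (hasDerivAt_const t y)
    rw [mul_one] at h
    exact (hasFDerivAt_wave _).comp_hasDerivAt t h
  have h2 : HasDerivAt (fun t : ℝ => p (lam ^ 2 * t)) ((lam ^ 2 : ℝ) • p' (lam ^ 2 * t)) t := by
    have h := (hasDerivAt_id t).const_mul (lam ^ 2)
    rw [mul_one] at h
    exact (hp.hasDerivAt _ ht).scomp t h
  have h3 := ((isBoundedBilinearMap_mulOp.hasFDerivAt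
    (wave (ν ^ 2 * t, y), p (lam ^ 2 * t))).restrictScalars ℝ).comp_hasDerivAt t (h1.prodMk h2)
  refine h3.congr_deriv ?_
  change mulOp (wave (ν ^ 2 * t, y)) ((lam ^ 2 : ℝ) • p' (lam ^ 2 * t))
    + mulOp (waveDeriv (ν ^ 2 * t, y) (ν ^ 2, 0)) (p (lam ^ 2 * t)) = _
  rw [add_comm, ← Complex.coe_smul, map_smul]

/-- The relation `θ * lam ^ 2 = ν ^ 2` matches the time of the outer free flow with that in the
equation for `p'`, so the two flows cancel and the cubic term appears with the factor `lam ^ 3`. -/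
theorem IsInteractionCurve.hasDerivAt_scaledSol (hp : IsInteractionCurve θ T p p')
    (hθ : θ * lam ^ 2 = ν ^ 2) {t : ℝ} (ht : lam ^ 2 * t ∈ Icc 0 T) (x : E d) :
    HasDerivAt (fun t : ℝ => scaledSol lam ν p t x)
      (Complex.I * ((lam * ν ^ 2 : ℝ) * 𝓕⁻ (fun ξ =>
        -(4 * Real.pi ^ 2 * ‖ξ‖ ^ 2 : ℝ) * density (scaledSpec lam ν p t) ξ) (ν • x)
        + (‖scaledSol lam ν p t x‖ ^ 2 : ℝ) * scaledSol lam ν p t x)) t := by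
  have ht' : lam ^ 2 * t ∈ Ioo (-1) (T + 1) := ⟨by linarith [ht.1], by linarith [ht.2]⟩
  have h1 := ((((specInt d).restrictScalars ℝ).hasFDerivAt.comp_hasDerivAt t
    (hp.hasDerivAt_wave_mul (ν := ν) ht' (ν • x))).const_mul (lam : ℂ))
  simp only [scaledSol_eq_specInt lam ν p _ x]
  refine h1.congr_deriv ?_
  change (lam : ℂ) * specInt d _ = _
  rw [map_add, map_smul, specInt_waveDeriv_time, specInt_wave, specInt_wave, hp.equation _ ht]
  have h2 : θ * (lam ^ 2 * t) = ν ^ 2 * t := by rw [← mul_assoc, hθ]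
  have h3 : freeFlow (ν ^ 2 * t) (p (lam ^ 2 * t)) = scaledSpec lam ν p t := rfl
  simp only [h2, phys_freeFlow_specNonlin_neg, h3]
  rw [norm_mul, Complex.norm_real, mul_pow, Real.norm_eq_abs, sq_abs, smul_eq_mul]
  push_cast
  ring

theorem IsInteractionCurve.isSmoothSolution (hp : IsInteractionCurve θ T p p') (hlam : 0 < lam)
    (hν : 0 < ν) (hθ : θ * lam ^ 2 = ν ^ 2) (hT : 0 < T) {s : ℝ≥0} {J : Spec d → H d s}
    (hJ : ∀ a, (J a).fn =ᵐ[volume] fun x => lam * phys a (ν • x))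
    (U : C(Icc 0 (T / lam ^ 2), H d s)) (hU : ∀ t, U t = J (scaledSpec lam ν p t)) :
    IsSmoothSolution (scaledSol lam ν p) U := by
  have hl : 0 < lam ^ 2 := by positivity
  have hmem : ∀ t ∈ Icc 0 (T / lam ^ 2), lam ^ 2 * t ∈ Icc 0 T := fun t ht =>
    ⟨mul_nonneg hl.le ht.1, by rw [mul_comm]; exact (le_div_iff₀ hl).1 ht.2⟩
  refine ⟨hp.contDiffOn_scaledSol.mono fun z hz => ⟨?_, hz.2⟩, fun t _ => ?_, fun t ht x => ?_,
    fun t => ?_⟩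
  · have := hmem _ hz.1
    exact ⟨by linarith [this.1], by linarith [this.2]⟩
  · rw [scaledSol_eq_fourierInv lam hν]
    exact ((rapidDecay_density _).dilate lam hν).contDiff_fourierInv
  · have h1 := (hp.hasDerivAt_scaledSol hθ (hmem t ht) x).hasDerivWithinAt.derivWithin
      (uniqueDiffOn_Icc (div_pos hT hl) t ht)
    rw [h1, laplacian_scaledSol lam hν, ← mul_assoc, Complex.I_mul_I]
    ring
  · rw [hU]
    exact hJ _

end

end


/-! ### The rescaled curve as a strong solution in L² -/

noncomputable section

open scoped FourierTransform BoundedContinuousFunction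

variable {d : ℕ} {θ T lam ν : ℝ} {p p' : ℝ → Spec d}

theorem IsInteractionCurve.continuousOn_scaledSpec (hp : IsInteractionCurve θ T p p')
    (hlam : 0 < lam) : ContinuousOn (scaledSpec lam ν p) (Icc 0 (T / lam ^ 2)) := by
  have hl : 0 < lam ^ 2 := by positivity
  have h1 : ContinuousOn (fun t => p (lam ^ 2 * t)) (Icc 0 (T / lam ^ 2)) :=
    hp.contDiffOn.continuousOn.comp (by fun_prop) fun t ht => by
      have h2 := mul_nonneg hl.le ht.1
      have h3 : t * lam ^ 2 ≤ T := (le_div_iff₀ hl).1 ht.2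
      exact ⟨by linarith, by linarith⟩
  have h0 : ContinuousOn (fun t : ℝ => ν ^ 2 * t) (Icc 0 (T / lam ^ 2)) := by fun_prop
  have h2 := (continuous_freeFlow (d := d)).comp_continuousOn (h0.prodMk h1)
  exact h2

theorem rapidDecay_exp_mul_polyWeight :
    RapidDecay fun ξ : E d => ((Real.exp (-‖ξ‖) * polyWeight ξ : ℝ) : ℂ) :=
  rapidDecay_of_norm_le_exp (C := 1) (by fun_prop) fun ξ => by
    rw [Complex.norm_real, Real.norm_of_nonneg (mul_pos (Real.exp_pos _) (polyWeight_pos ξ)).le,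
      one_mul]
    exact mul_le_of_le_one_right (Real.exp_pos _).le (polyWeight_le_one ξ)

/-- Half of the exponential weight goes into the operator `K` from `Spec d` to L², half into the
wave at `x = 0`. Bounded operators then carry the derivative in `Spec d` to one in L², whose two
terms are the Laplacian and the cubic term up to the factor `i`. -/
theorem IsInteractionCurve.isL2Solution (hp : IsInteractionCurve θ T p p') (hlam : 0 < lam)
    (hν : 0 < ν) (hθ : θ * lam ^ 2 = ν ^ 2) :
    ∃ Y : ℝ → L2 d, IsL2Solution (T / lam ^ 2) Y ∧ ∀ t, Y t =ᵐ[volume] scaledSol lam ν p t := by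
  have hl : 0 < lam ^ 2 := by positivity
  have hmem : ∀ t ∈ Icc 0 (T / lam ^ 2), lam ^ 2 * t ∈ Icc 0 T := fun t ht =>
    ⟨mul_nonneg hl.le ht.1, by rw [mul_comm]; exact (le_div_iff₀ hl).1 ht.2⟩
  have hk := (rapidDecay_exp_mul_polyWeight.dilate (d := d) lam hν).memLp_two
  set K : Spec d →L[ℂ] L2 d := specL2 hk ν⁻¹
  set W : ℝ → Spec d := fun t => mulOp (wave (ν ^ 2 * t, 0)) (p (lam ^ 2 * t))
  have hKW : ∀ (t : ℝ) (a : Spec d), K (mulOp (wave (ν ^ 2 * t, 0)) a)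
      =ᵐ[volume] dilate lam ν (density (freeFlow (ν ^ 2 * t) a)) := fun t a => by
    filter_upwards [coeFn_specL2 hk ν⁻¹ (mulOp (wave (ν ^ 2 * t, 0)) a)] with ξ hξ
    rw [hξ, dilate, dilate, density, freeFlow_apply, mulOp_apply, wave_eq, inner_zero_right,
      ← exp_mul_exp_mul_polyWeight]
    push_cast
    rw [mul_zero, mul_zero, Complex.exp_zero]
    ring
  set F : L2 d →L[ℂ] L2 d :=
    (Lp.fourierTransformₗᵢ (E d) ℂ).symm.toContinuousLinearEquiv.toContinuousLinearMap
  have hF : ∀ g, F g = 𝓕⁻ g := fun g => rfl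
  have hY : ∀ t, (F (K (W t)) : L2 d) =ᵐ[volume] scaledSol lam ν p t := fun t => by
    rw [hF, scaledSol_eq_fourierInv lam hν]
    exact ((rapidDecay_density _).dilate lam hν).coeFn_fourierInv (hKW t _)
  have hder : ∀ t ∈ Icc 0 (T / lam ^ 2), HasDerivAt (fun t => F (K (W t)))
      (F (K (mulOp (waveDeriv (ν ^ 2 * t, 0) (ν ^ 2, 0)) (p (lam ^ 2 * t))))
        + F (((lam ^ 2 : ℝ) : ℂ) • K (mulOp (wave (ν ^ 2 * t, 0)) (p' (lam ^ 2 * t))))) t := by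
    intro t ht
    have ht' := hmem t ht
    have h1 := hp.hasDerivAt_wave_mul (lam := lam) (ν := ν) (t := t)
      ⟨by linarith [ht'.1], by linarith [ht'.2]⟩ 0
    have h2 := ((F.comp K).restrictScalars ℝ).hasFDerivAt.comp_hasDerivAt t h1
    refine h2.congr_deriv ?_
    change F (K _) = _
    rw [map_add, map_add, map_smul]
  refine ⟨fun t => F (K (W t)), ⟨fun t ht => (hder t ht).continuousAt.continuousWithinAt,
    fun t ht => ?_, ?_⟩, hY⟩
  · have ht' := Ico_subset_Icc_self ht
    refine ⟨-Complex.I • F (K (mulOp (waveDeriv (ν ^ 2 * t, 0) (ν ^ 2, 0)) (p (lam ^ 2 * t)))),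
      -Complex.I • F (((lam ^ 2 : ℝ) : ℂ) • K (mulOp (wave (ν ^ 2 * t, 0)) (p' (lam ^ 2 * t)))),
      ?_, ?_, ?_⟩
    · refine ((hder t ht').hasDerivWithinAt).congr_deriv ?_
      rw [← smul_add, smul_smul, mul_neg, Complex.I_mul_I, neg_neg, one_smul]
    · have h1 : 𝓕 (-Complex.I • F (K (mulOp (waveDeriv (ν ^ 2 * t, 0) (ν ^ 2, 0))
          (p (lam ^ 2 * t))))) = K (-Complex.I • mulOp (waveDeriv (ν ^ 2 * t, 0) (ν ^ 2, 0))
          (p (lam ^ 2 * t))) := by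
        rw [← map_smul, hF, FourierTransform.fourier_fourierInv_eq, map_smul]
      have h2 : 𝓕 (F (K (W t))) = K (W t) := by
        rw [hF, FourierTransform.fourier_fourierInv_eq]
      rw [h1, h2]
      filter_upwards [coeFn_specL2 hk ν⁻¹ (-Complex.I • mulOp (waveDeriv (ν ^ 2 * t, 0)
        (ν ^ 2, 0)) (p (lam ^ 2 * t))), coeFn_specL2 hk ν⁻¹ (W t)] with ξ h3 h4
      rw [h3, h4, Spec.smul_apply, mulOp_apply, mulOp_apply, waveDeriv_apply, wavePhase_apply,
        inner_zero_right, norm_smul, Real.norm_of_nonneg (inv_pos.2 hν).le]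
      have h5 : 2 * Real.pi * 0 - 4 * Real.pi ^ 2 * (ν⁻¹ * ‖ξ‖) ^ 2 * ν ^ 2
          = -(4 * Real.pi ^ 2 * ‖ξ‖ ^ 2) := by field_simp; ring
      rw [h5, Complex.ofReal_neg]
      generalize dilate lam ν _ ξ = A
      generalize ((4 * Real.pi ^ 2 * ‖ξ‖ ^ 2 : ℝ) : ℂ) = c
      linear_combination (A * c * wave (ν ^ 2 * t, 0) (ν⁻¹ • ξ) * p (lam ^ 2 * t) (ν⁻¹ • ξ))
        * Complex.I_sq
    · have h1 := hKW t (p' (lam ^ 2 * t))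
      have h2 : θ * (lam ^ 2 * t) = ν ^ 2 * t := by rw [← mul_assoc, hθ]
      rw [hp.equation _ (hmem t ht'), h2] at h1
      have h3 := ((rapidDecay_density _).dilate lam hν).coeFn_fourierInv h1
      rw [hp.equation _ (hmem t ht'), h2, map_smul, smul_smul, hF]
      filter_upwards [h3, hY t, Lp.coeFn_smul (-Complex.I * ((lam ^ 2 : ℝ) : ℂ))
        (𝓕⁻ (K (mulOp (wave (ν ^ 2 * t, 0)) (freeFlow (-(ν ^ 2 * t))
          (specNonlin (freeFlow (ν ^ 2 * t) (p (lam ^ 2 * t))))))) : L2 d)] with x h4 h5 h6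
      rw [h6, Pi.smul_apply, h4, h5, fourierInv_dilate lam hν]
      change _ * (_ * phys _ _) = _
      rw [phys_freeFlow_specNonlin_neg, scaledSol, scaledSpec, norm_mul, Complex.norm_real,
        mul_pow, Real.norm_eq_abs, sq_abs]
      push_cast
      linear_combination (-(lam : ℂ) ^ 3 * (‖phys (freeFlow (ν ^ 2 * t) (p (lam ^ 2 * t))) (ν • x)‖
        : ℂ) ^ 2 * phys (freeFlow (ν ^ 2 * t) (p (lam ^ 2 * t))) (ν • x)) * Complex.I_sq
  · obtain ⟨M, hM⟩ := isCompact_Icc.exists_bound_of_continuousOn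
      (hp.continuousOn_scaledSpec (ν := ν) hlam)
    refine ⟨lam * (M * ∫ ξ : E d, specWeight ξ), fun t ht => ?_⟩
    filter_upwards [hY t] with x hx
    rw [hx, scaledSol, norm_mul, Complex.norm_real, Real.norm_of_nonneg hlam.le]
    refine mul_le_mul_of_nonneg_left ((norm_phys_le _ _).trans
      (mul_le_mul_of_nonneg_right (hM t ht) ?_)) hlam.le
    exact integral_nonneg fun ξ => (specWeight_pos ξ).le

end


/-! ### Norm inflation -/

noncomputable section

open scoped FourierTransform BoundedContinuousFunction

variable {d : ℕ}

theorem norm_density_freeFlow (τ : ℝ) (a : Spec d) (ξ : E d) :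
    ‖density (freeFlow τ a) ξ‖ = ‖density a ξ‖ := by
  rw [norm_density, norm_density, freeFlow_apply, norm_mul, norm_cexp_I_mul_ofReal, one_mul]

theorem norm_homSpecL2_freeFlow (s : ℕ) (τ : ℝ) (a : Spec d) :
    ‖homSpecL2 d s (freeFlow τ a)‖ = ‖homSpecL2 d s a‖ := by
  rw [← sq_eq_sq₀ (norm_nonneg _) (norm_nonneg _), norm_sq_homSpecL2, norm_sq_homSpecL2]
  simp only [norm_density_freeFlow]

theorem integrable_besselSymbol_sq_mul (s : ℕ) {ν : ℝ} (hν : 0 < ν) (a : Spec d) :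
    Integrable fun η => besselSymbol s (ν • η) ^ 2 * ‖density a η‖ ^ 2 := by
  have h := ((((rapidDecay_density a).comp_smul (inv_pos.2 hν)).besselSymbol_mul s).comp_smul
    hν).memLp_two
  refine ((memLp_two_iff_integrable_sq_norm h.aestronglyMeasurable).1 h).congr
    (Eventually.of_forall fun η => ?_)
  simp only [NNReal.coe_natCast]
  rw [inv_smul_smul₀ hν.ne', norm_mul, Complex.norm_real,
    Real.norm_of_nonneg (besselSymbol_pos _ _).le, mul_pow]

theorem le_integral_besselSymbol_sq_mul (s : ℕ) {ν : ℝ} (hν : 0 < ν) (a : Spec d) :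
    ν ^ (2 * s) * ‖homSpecL2 d s a‖ ^ 2
      ≤ ∫ η, besselSymbol s (ν • η) ^ 2 * ‖density a η‖ ^ 2 := by
  rw [norm_sq_homSpecL2, ← integral_const_mul]
  refine integral_mono ((integrable_pow_mul_norm_sq_density s a).const_mul _)
    (integrable_besselSymbol_sq_mul s hν a) fun η => ?_
  simp only
  rw [← mul_assoc, besselSymbol_sq, norm_smul, Real.norm_of_nonneg hν.le, ← mul_pow, pow_mul]
  gcongr
  linarith

/-- For `ν ≥ 1` one has `1 + ν²|η|² ≤ ν²(1 + |η|²)`, so the inhomogeneous norm scales from above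
like the homogeneous one. -/
theorem integral_besselSymbol_sq_mul_le (s : ℕ) {ν : ℝ} (hν : 1 ≤ ν) (a : Spec d) :
    ∫ η, besselSymbol s (ν • η) ^ 2 * ‖density a η‖ ^ 2
      ≤ ν ^ (2 * s) * ∫ η, besselSymbol s η ^ 2 * ‖density a η‖ ^ 2 := by
  have h0 := integrable_besselSymbol_sq_mul s one_pos a
  simp only [one_smul] at h0
  rw [← integral_const_mul]
  refine integral_mono (integrable_besselSymbol_sq_mul s (by linarith) a) (h0.const_mul _)
    fun η => ?_
  simp only
  rw [← mul_assoc, besselSymbol_sq, besselSymbol_sq, norm_smul,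
    Real.norm_of_nonneg (by linarith), pow_mul, ← mul_pow]
  have h1 : 1 ≤ ν ^ 2 := one_le_pow₀ hν
  gcongr
  rw [mul_pow, mul_add, mul_one]
  gcongr

/-- Norm inflation: solutions that become large in `H^s` in a short time from small data. -/
theorem exists_norm_inflation {s : ℕ} (hs : 0 < s) (hsd : 2 * s + 3 ≤ d) {ε : ℝ} (hε : 0 < ε) :
    ∃ (t₀ : ℝ) (ht : 0 < t₀) (u : ℝ → E d → ℂ) (U : C(Icc 0 t₀, H d (s : ℝ≥0)))
      (Y : ℝ → L2 d), t₀ ≤ ε ∧ IsSmoothSolution u U ∧ ‖U ⟨0, left_mem_Icc.2 ht.le⟩‖ ≤ ε ∧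
      ε⁻¹ ≤ ‖U ⟨t₀, right_mem_Icc.2 ht.le⟩‖ ∧
      (∀ σ : ℝ≥0, ∃ v : H d σ, v.toL2 = (U ⟨0, left_mem_Icc.2 ht.le⟩).toL2) ∧
      IsL2Solution t₀ Y ∧ ∀ t : Icc 0 t₀, (U t).toL2 = Y t := by
  set C₀ : ℝ := ∫ η, besselSymbol s η ^ 2 * ‖density (gaussian d) η‖ ^ 2 with hC₀_def
  have hC₀ : 0 ≤ C₀ := integral_nonneg fun η => by positivity
  -- The squared initial norm will be at most `κ² C₀`, hence at most `ε²`.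
  set κ : ℝ := ε / (C₀ + 1) with hκ_def
  have hκ : 0 < κ := by positivity
  -- The final norm will be at least `κ` times the Ḣ^s norm at time `T`; the extra 1 pays for
  -- replacing the profile by the true trajectory, and `η` below is chosen accordingly.
  obtain ⟨T, hT1, hT⟩ := ((tendsto_norm_homSpecL2_profile (d := d) (by omega) hs).eventually_ge_atTop
    (κ⁻¹ * ε⁻¹ + 1)).and (eventually_gt_atTop 0) |>.exists
  set η : ℝ := (‖homSpecL2 d s‖ + 1)⁻¹ with hη_def
  have hη : 0 < η := by positivity
  obtain ⟨C, hC, hN⟩ := exists_norm_specNonlin_sub_le d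
  obtain ⟨θ₀, hθ₀, h⟩ := exists_trajectory_near (S := fun τ (a : Spec d) => freeFlow τ a)
    continuous_freeFlow (fun τ a b => by rw [← freeFlow_sub, norm_freeFlow]) norm_freeFlow
    freeFlow_zero hC specNonlin_zero hN hasDerivAt_profile hT hη
  -- The two summands ensure that the dispersion is at most `θ₀` and that the lifespan `T / lam ^ 2`
  -- is at most `ε`.
  set m : ℝ := 1 + (θ₀⁻¹ + T / ε) / κ ^ 2 with hm_def
  have hm : 1 ≤ m := le_add_of_nonneg_right (by positivity)
  have hm0 : 0 < m := by linarith
  have hm2 : θ₀⁻¹ + T / ε ≤ κ ^ 2 * m ^ 2 := by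
    have h1 : (θ₀⁻¹ + T / ε) / κ ^ 2 ≤ m ^ 2 :=
      (show _ ≤ m by linarith).trans (le_self_pow₀ hm two_ne_zero)
    rw [div_le_iff₀ (by positivity)] at h1
    linarith
  obtain ⟨e, rfl⟩ : ∃ e, d = e + 2 * s := ⟨d - 2 * s, by omega⟩
  have he : 3 ≤ e := by omega
  set ν : ℝ := m ^ 2 with hν_def
  have hν1 : 1 ≤ ν := one_le_pow₀ hm
  have hν : 0 < ν := by positivity
  set lam : ℝ := κ * m ^ e with hlam_def
  have hlam : 0 < lam := by positivity
  have hl : 0 < lam ^ 2 := by positivity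
  -- Here `e = d - 2s ≥ 3` enters: `ν² = m⁴`, and `lam² = κ² m^{2e}` exceeds it by a factor of at
  -- least `κ² m²`.
  have hlam_ge : κ ^ 2 * m ^ 2 * m ^ 4 ≤ lam ^ 2 := by
    rw [hlam_def, mul_pow, ← pow_mul, mul_assoc, ← pow_add]
    gcongr
    omega
  have hθ : ν ^ 2 / lam ^ 2 ≤ θ₀ := by
    rw [div_le_iff₀ hl]
    have h1 : θ₀⁻¹ ≤ κ ^ 2 * m ^ 2 := by linarith [div_pos hT hε]
    calc ν ^ 2 = θ₀ * (θ₀⁻¹ * m ^ 4) := by rw [mul_inv_cancel_left₀ hθ₀.ne', hν_def]; ring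
      _ ≤ θ₀ * (κ ^ 2 * m ^ 2 * m ^ 4) := by gcongr
      _ ≤ _ := by gcongr
  have ht₀ : T / lam ^ 2 ≤ ε := by
    rw [div_le_iff₀ hl, ← div_le_iff₀' hε]
    have h1 : T / ε ≤ κ ^ 2 * m ^ 2 := by linarith [inv_pos.2 hθ₀]
    refine (h1.trans ?_).trans hlam_ge
    exact le_mul_of_one_le_right (by positivity) (one_le_pow₀ hm)
  -- The squared factor by which the rescaling changes the Ḣ^s norm does not depend on `m`.
  have hscale : lam ^ 2 * (ν ^ (e + 2 * s))⁻¹ * ν ^ (2 * s) = κ ^ 2 := by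
    have h1 : lam ^ 2 = κ ^ 2 * ν ^ e := by
      rw [hlam_def, hν_def, mul_pow, ← pow_mul, ← pow_mul, mul_comm e]
    rw [h1, pow_add]
    field_simp
  obtain ⟨p, p', hp0, hpc, hpd, hpe, hpT⟩ := h (ν ^ 2 / lam ^ 2) ⟨by positivity, hθ⟩
  have hp : IsInteractionCurve (ν ^ 2 / lam ^ 2) T p p' := ⟨hpc, hpd, hpe⟩
  have hθl : ν ^ 2 / lam ^ 2 * lam ^ 2 = ν ^ 2 := div_mul_cancel₀ _ hl.ne'
  obtain ⟨J, hJc, hJ, hJn⟩ := exists_continuous_toH (d := e + 2 * s) (s : ℝ≥0) lam hν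
  rw [NNReal.coe_natCast] at hJn
  obtain ⟨Y, hY, hYs⟩ := hp.isL2Solution hlam hν hθl
  let U : C(Icc 0 (T / lam ^ 2), H (e + 2 * s) (s : ℝ≥0)) :=
    ⟨fun t => J (scaledSpec lam ν p t),
      hJc.comp (continuousOn_iff_continuous_domRestrict.1 (hp.continuousOn_scaledSpec hlam))⟩
  have hU0 : scaledSpec lam ν p 0 = gaussian _ := by
    rw [scaledSpec, mul_zero, mul_zero, freeFlow_zero, hp0, profile_zero]
  refine ⟨T / lam ^ 2, div_pos hT hl, scaledSol lam ν p, U, Y, ht₀,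
    hp.isSmoothSolution hlam hν hθl hT hJ U fun _ => rfl, ?_, ?_, fun σ => ?_, hY, fun t => ?_⟩
  · change ‖J (scaledSpec lam ν p 0)‖ ≤ ε
    rw [hU0, ← sq_le_sq₀ (norm_nonneg _) hε.le, hJn]
    calc _ ≤ lam ^ 2 * (ν ^ (e + 2 * s))⁻¹ * (ν ^ (2 * s) * C₀) := by
          gcongr
          exact integral_besselSymbol_sq_mul_le s hν1 _
      _ = κ ^ 2 * C₀ := by rw [← mul_assoc, hscale]
      _ ≤ κ ^ 2 * (C₀ + 1) ^ 2 := by gcongr; nlinarith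
      _ = ε ^ 2 := by rw [← mul_pow, hκ_def, div_mul_cancel₀ _ (by positivity)]
  · change ε⁻¹ ≤ ‖J (scaledSpec lam ν p (T / lam ^ 2))‖
    have h1 : κ⁻¹ * ε⁻¹ ≤ ‖homSpecL2 (e + 2 * s) s (p T)‖ := by
      have h2 : ‖homSpecL2 (e + 2 * s) s (p T - profile T)‖ ≤ 1 := by
        refine (ContinuousLinearMap.le_opNorm _ _).trans ?_
        calc _ ≤ (‖homSpecL2 (e + 2 * s) s‖ + 1) * η := by gcongr; linarith
          _ = 1 := mul_inv_cancel₀ (by positivity)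
      rw [map_sub] at h2
      have h3 := norm_sub_norm_le (homSpecL2 (e + 2 * s) s (profile T))
        (homSpecL2 (e + 2 * s) s (p T))
      rw [norm_sub_rev] at h3
      linarith
    have h4 : ‖homSpecL2 (e + 2 * s) s (scaledSpec lam ν p (T / lam ^ 2))‖
        = ‖homSpecL2 (e + 2 * s) s (p T)‖ := by
      rw [scaledSpec, norm_homSpecL2_freeFlow, mul_div_cancel₀ _ hl.ne']
    rw [← sq_le_sq₀ (by positivity) (norm_nonneg _), hJn]
    calc ε⁻¹ ^ 2 = κ ^ 2 * (κ⁻¹ * ε⁻¹) ^ 2 := by field_simp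
      _ ≤ κ ^ 2 * ‖homSpecL2 (e + 2 * s) s (p T)‖ ^ 2 := by gcongr
      _ = lam ^ 2 * (ν ^ (e + 2 * s))⁻¹ * (ν ^ (2 * s)
          * ‖homSpecL2 (e + 2 * s) s (scaledSpec lam ν p (T / lam ^ 2))‖ ^ 2) := by
        rw [h4, ← mul_assoc _ (ν ^ (2 * s)), hscale]
      _ ≤ _ := by
        gcongr
        exact le_integral_besselSymbol_sq_mul s hν _
  · obtain ⟨Jσ, -, hJσ, -⟩ := exists_continuous_toH (d := e + 2 * s) σ lam hν
    exact ⟨Jσ (scaledSpec lam ν p 0), Lp.ext ((hJσ _).trans (hJ _).symm)⟩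
  · exact Lp.ext ((hJ _).trans (hYs t).symm)

end


/-! ### Uniqueness of bounded solutions in L² -/

noncomputable section

open scoped FourierTransform SchwartzMap

variable {d : ℕ}

theorem norm_cubic_sub_le {a b : ℂ} {M : ℝ} (ha : ‖a‖ ≤ M) (hb : ‖b‖ ≤ M) :
    ‖((‖a‖ ^ 2 : ℝ) : ℂ) * a - (‖b‖ ^ 2 : ℝ) * b‖ ≤ 3 * M ^ 2 * ‖a - b‖ := by
  have h1 : ((‖a‖ ^ 2 : ℝ) : ℂ) * a - (‖b‖ ^ 2 : ℝ) * b
      = (‖a‖ ^ 2 : ℝ) * (a - b) + ((‖a‖ + ‖b‖) * (‖a‖ - ‖b‖) : ℝ) * b := by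
    push_cast; ring
  have hM : 0 ≤ M := (norm_nonneg a).trans ha
  rw [h1]
  refine (norm_add_le _ _).trans ?_
  rw [norm_mul, norm_mul, Complex.norm_real, Complex.norm_real, Real.norm_of_nonneg (by positivity),
    norm_mul, Real.norm_of_nonneg (by positivity)]
  calc ‖a‖ ^ 2 * ‖a - b‖ + (‖a‖ + ‖b‖) * ‖‖a‖ - ‖b‖‖ * ‖b‖
      ≤ M ^ 2 * ‖a - b‖ + (M + M) * ‖a - b‖ * M := by
        gcongr
        exact abs_norm_sub_norm_le a b
    _ = _ := by ring

/-- The Laplacian is symmetric. -/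
theorem re_inner_I_smul_laplacian {D L : L2 d}
    (h : ∀ᵐ ξ, (𝓕 L : L2 d) ξ = -(4 * Real.pi ^ 2 * ‖ξ‖ ^ 2 : ℝ) * (𝓕 D : L2 d) ξ) :
    (inner ℂ D (Complex.I • L)).re = 0 := by
  have h1 : inner ℂ D L = ((∫ ξ, -(4 * Real.pi ^ 2 * ‖ξ‖ ^ 2) * ‖(𝓕 D : L2 d) ξ‖ ^ 2 : ℝ) : ℂ) := by
    rw [← Lp.inner_fourier_eq, L2.inner_def, ← integral_complex_ofReal]
    refine integral_congr_ae ?_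
    filter_upwards [h] with ξ hξ
    rw [hξ, RCLike.inner_apply, mul_assoc, Complex.mul_conj, Complex.normSq_eq_norm_sq]
    push_cast
    ring
  rw [inner_smul_right, h1]
  simp

/-- Bounded solutions in `L²` are determined by their initial values. -/
theorem IsL2Solution.eqOn {t₀ : ℝ} {Y W : ℝ → L2 d} (hY : IsL2Solution t₀ Y)
    (hW : IsL2Solution t₀ W) (h0 : Y 0 = W 0) : EqOn Y W (Icc 0 t₀) := by
  obtain ⟨M₁, hM₁⟩ := hY.bounded
  obtain ⟨M₂, hM₂⟩ := hW.bounded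
  set M := max M₁ M₂
  -- Energy estimate for the difference `D`: the Laplacian contributes nothing to the derivative of
  -- `‖D‖²`, and on functions bounded by `M` the cubic map is Lipschitz with constant `3M²`.
  -- Grönwall then applies from `D = 0`.
  have h : ∀ t ∈ Ico 0 t₀, ∃ e' : ℝ,
      HasDerivWithinAt (fun t => ‖Y t - W t‖ ^ 2) e' (Ici t) t ∧
      ‖e'‖ ≤ 2 * (3 * M ^ 2) * ‖‖Y t - W t‖ ^ 2‖ := by
    intro t ht
    obtain ⟨L₁, N₁, hd₁, hL₁, hN₁⟩ := hY.equation t ht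
    obtain ⟨L₂, N₂, hd₂, hL₂, hN₂⟩ := hW.equation t ht
    have ht' := Ico_subset_Icc_self ht
    set D := Y t - W t with hD
    have hd : HasDerivWithinAt (fun t => Y t - W t)
        (Complex.I • (L₁ - L₂) + Complex.I • (N₁ - N₂)) (Ici t) t := by
      refine (hd₁.sub hd₂).congr_deriv ?_
      rw [← smul_sub, ← smul_add]
      congr 1
      abel
    have hL : (inner ℂ D (Complex.I • (L₁ - L₂))).re = 0 := re_inner_I_smul_laplacian (by
      have e1 : 𝓕 (L₁ - L₂) = 𝓕 L₁ - 𝓕 L₂ := map_sub (Lp.fourierTransformₗᵢ (E d) ℂ) _ _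
      have e2 : 𝓕 D = 𝓕 (Y t) - 𝓕 (W t) := map_sub (Lp.fourierTransformₗᵢ (E d) ℂ) _ _
      rw [e1, e2]
      filter_upwards [hL₁, hL₂, Lp.coeFn_sub (𝓕 L₁) (𝓕 L₂), Lp.coeFn_sub (𝓕 (Y t)) (𝓕 (W t))]
        with ξ h1 h2 h3 h4
      rw [h3, h4, Pi.sub_apply, Pi.sub_apply, h1, h2, mul_sub])
    have hN : ‖N₁ - N₂‖ ≤ 3 * M ^ 2 * ‖D‖ := by
      refine Lp.norm_le_mul_norm_of_ae_le_mul ?_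
      filter_upwards [hN₁, hN₂, hM₁ t ht', hM₂ t ht', Lp.coeFn_sub N₁ N₂,
        Lp.coeFn_sub (Y t) (W t)] with x h1 h2 h3 h4 h5 h6
      rw [h5, h6, Pi.sub_apply, Pi.sub_apply, h1, h2]
      exact norm_cubic_sub_le (h3.trans (le_max_left _ _)) (h4.trans (le_max_right _ _))
    have hn : ∀ t, ‖Y t - W t‖ ^ 2 = (inner ℂ (Y t - W t) (Y t - W t)).re := fun t => by
      rw [inner_self_eq_norm_sq_to_K]
      norm_cast
    have hi := Complex.reCLM.hasFDerivAt.comp_hasDerivWithinAt t (hd.inner ℂ hd)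
    have hre : ∀ a b : L2 d, (inner ℂ a b).re = (inner ℂ b a).re := fun a b => by
      rw [← inner_conj_symm, Complex.conj_re]
    refine ⟨_, (hi.congr (fun t _ => hn t) (hn t)), ?_⟩
    change ‖(inner ℂ D (Complex.I • (L₁ - L₂) + Complex.I • (N₁ - N₂))
      + inner ℂ (Complex.I • (L₁ - L₂) + Complex.I • (N₁ - N₂)) D).re‖ ≤ _
    rw [Complex.add_re, hre _ D, inner_add_right, Complex.add_re, hL, zero_add, ← two_mul, norm_mul,
      Real.norm_two, norm_pow, norm_norm]
    have h3 : ‖(inner ℂ D (Complex.I • (N₁ - N₂))).re‖ ≤ ‖D‖ * (3 * M ^ 2 * ‖D‖) := by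
      refine (Complex.abs_re_le_norm _).trans ((norm_inner_le_norm _ _).trans ?_)
      rw [norm_smul, Complex.norm_I, one_mul]
      gcongr
    calc _ ≤ 2 * (‖D‖ * (3 * M ^ 2 * ‖D‖)) := by gcongr
      _ = _ := by ring
  choose! e' he' hb using h
  intro t ht
  have h1 := eq_zero_of_abs_deriv_le_mul_abs_self_of_eq_zero_right
    ((hY.continuousOn.sub hW.continuousOn).norm.pow 2) he' (by simp [h0]) hb t ht
  have h2 : ‖Y t - W t‖ = 0 := by simpa using h1
  exact sub_eq_zero.1 (norm_eq_zero.1 h2)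

end


/-! ### Regular weak solutions are strong solutions in L² -/

noncomputable section

open scoped FourierTransform SchwartzMap

variable {d : ℕ}

theorem memLp_mul_of_bounded {k : E d → ℂ} (hk : Continuous k) {C : ℝ} (hC : ∀ ξ, ‖k ξ‖ ≤ C)
    (g : L2 d) : MemLp (fun ξ => k ξ * g ξ) 2 :=
  MemLp.of_le_mul (c := C) (Lp.memLp g)
    (hk.aestronglyMeasurable.mul (Lp.aestronglyMeasurable g))
    (Eventually.of_forall fun ξ => by
      rw [norm_mul]
      exact mul_le_mul_of_nonneg_right (hC ξ) (norm_nonneg _))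

/-- Multiplication by a bounded continuous function on `L²`. -/
def mulL2 {k : E d → ℂ} (hk : Continuous k) {C : ℝ} (hC : ∀ ξ, ‖k ξ‖ ≤ C) : L2 d →L[ℂ] L2 d :=
  LinearMap.mkContinuous
    { toFun := fun g => (memLp_mul_of_bounded hk hC g).toLp _
      map_add' := fun a b => by
        rw [← MemLp.toLp_add]
        refine MemLp.toLp_congr _ _ ?_
        filter_upwards [Lp.coeFn_add a b] with ξ h
        rw [h, Pi.add_apply, Pi.add_apply, mul_add]
      map_smul' := fun c a => by
        rw [RingHom.id_apply, ← MemLp.toLp_const_smul]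
        refine MemLp.toLp_congr _ _ ?_
        filter_upwards [Lp.coeFn_smul c a] with ξ h
        rw [h, Pi.smul_apply, Pi.smul_apply, smul_eq_mul, smul_eq_mul, mul_left_comm] }
    C (fun g => by
      refine Lp.norm_le_mul_norm_of_ae_le_mul ?_
      filter_upwards [(memLp_mul_of_bounded hk hC g).coeFn_toLp] with ξ h
      refine (congrArg norm h).le.trans ?_
      rw [norm_mul]
      exact mul_le_mul_of_nonneg_right (hC ξ) (norm_nonneg _))

theorem coeFn_mulL2 {k : E d → ℂ} (hk : Continuous k) {C : ℝ} (hC : ∀ ξ, ‖k ξ‖ ≤ C) (g : L2 d) :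
    mulL2 hk hC g =ᵐ[volume] fun ξ => k ξ * g ξ := (memLp_mul_of_bounded hk hC g).coeFn_toLp

theorem besselSymbol_neg_mul (s : ℝ) (ξ : E d) : besselSymbol (-s) ξ * besselSymbol s ξ = 1 := by
  rw [besselSymbol, besselSymbol, ← Real.rpow_add (by positivity), neg_div, neg_add_cancel,
    Real.rpow_zero]

theorem besselSymbol_neg_le_one {s : ℝ} (hs : 0 ≤ s) (ξ : E d) : besselSymbol (-s) ξ ≤ 1 :=
  Real.rpow_le_one_of_one_le_of_nonpos (le_add_of_nonneg_right (by positivity)) (by linarith)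

theorem norm_sq_mul_besselSymbol_neg_le_one {s : ℝ} (hs : 2 ≤ s) (ξ : E d) :
    ‖ξ‖ ^ 2 * besselSymbol (-s) ξ ≤ 1 := by
  have h1 : (1 : ℝ) ≤ 1 + ‖ξ‖ ^ 2 := le_add_of_nonneg_right (by positivity)
  have h2 : ‖ξ‖ ^ 2 ≤ besselSymbol s ξ := by
    calc ‖ξ‖ ^ 2 ≤ (1 + ‖ξ‖ ^ 2) ^ (1 : ℝ) := by rw [Real.rpow_one]; linarith
      _ ≤ _ := Real.rpow_le_rpow_of_exponent_le h1 (by linarith)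
  calc ‖ξ‖ ^ 2 * besselSymbol (-s) ξ ≤ besselSymbol s ξ * besselSymbol (-s) ξ := by
        have := (besselSymbol_pos (-s) ξ).le
        gcongr
    _ = 1 := by rw [mul_comm, besselSymbol_neg_mul]

theorem memLp_besselSymbol_neg {s : ℝ} (hs : (d : ℝ) < 2 * s) :
    MemLp (fun ξ : E d => (besselSymbol (-s) ξ : ℂ)) 2 := by
  have hc : Continuous fun ξ : E d => (besselSymbol (-s) ξ : ℂ) := by fun_prop
  rw [memLp_two_iff_integrable_sq_norm hc.aestronglyMeasurable]
  have h := integrable_rpow_neg_one_add_norm_sq (E := E d) (μ := volume) (r := 2 * s)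
    (by rwa [finrank_euclideanSpace_fin])
  refine h.congr (Eventually.of_forall fun ξ => ?_)
  simp only
  rw [Complex.norm_real, Real.norm_of_nonneg (besselSymbol_pos _ _).le, besselSymbol,
    ← Real.rpow_mul_natCast (by positivity)]
  congr 1
  push_cast
  ring

namespace H

variable {σ : ℝ≥0}

theorem fourier_toL2 (f : H d σ) :
    ∀ᵐ ξ, (𝓕 (toL2 f) : L2 d) ξ = besselSymbol (-σ) ξ * (𝓕 f.bessel : L2 d) ξ := by
  filter_upwards [fourier_bessel f] with ξ h
  rw [h, ← mul_assoc, ← Complex.ofReal_mul, besselSymbol_neg_mul, Complex.ofReal_one, one_mul]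

/-- Functions in `H^σ` are bounded for `σ > d/2`. -/
theorem exists_ae_norm_le (hσ : (d : ℝ) < 2 * σ) :
    ∃ A : ℝ, ∀ f : H d σ, ∀ᵐ x, ‖f.fn x‖ ≤ A + ‖f‖ ^ 2 := by
  have hm := memLp_besselSymbol_neg hσ
  have hmi := (memLp_two_iff_integrable_sq_norm hm.aestronglyMeasurable).1 hm
  refine ⟨∫ ξ : E d, ‖(besselSymbol (-σ) ξ : ℂ)‖ ^ 2, fun f => ?_⟩
  set b : L2 d := 𝓕 f.bessel
  have hbi := (memLp_two_iff_integrable_sq_norm (Lp.aestronglyMeasurable b)).1 (Lp.memLp b)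
  have hbn : ∫ ξ, ‖b ξ‖ ^ 2 = ‖f‖ ^ 2 := by
    rw [← norm_sq_toLp (Lp.memLp b), Lp.toLp_coeFn, norm_def]
    congr 1
    exact (Lp.fourierTransformₗᵢ (E d) ℂ).norm_map _
  set G : E d → ℂ := fun ξ => besselSymbol (-σ) ξ * b ξ
  have hG : Integrable G := hm.integrable_mul (Lp.memLp b)
  have hG2 : MemLp G 2 := memLp_mul_of_bounded (C := 1)
    (k := fun ξ => (besselSymbol (-σ) ξ : ℂ)) (by fun_prop)
    (fun ξ => by
      rw [Complex.norm_real, Real.norm_of_nonneg (besselSymbol_pos _ _).le]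
      exact besselSymbol_neg_le_one σ.2 ξ) b
  have h1 : toL2 f = 𝓕⁻ (hG2.toLp G) := by
    have h0 : 𝓕⁻ (𝓕 (toL2 f) : L2 d) = toL2 f := FourierTransform.fourierInv_fourier_eq _
    refine h0.symm.trans (congrArg _ (Lp.ext ?_))
    exact EventuallyEq.trans (fourier_toL2 f) hG2.coeFn_toLp.symm
  have h2 := coeFn_fourierInv_toLp hG hG2
  rw [← h1] at h2
  filter_upwards [h2] with x hx
  rw [fn, hx, Real.fourierInv_eq', ← hbn, ← integral_add hmi hbi]
  refine norm_integral_le_of_norm_le (hmi.add hbi) (Eventually.of_forall fun ξ => ?_)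
  rw [norm_smul, Complex.norm_exp_ofReal_mul_I, one_mul, norm_mul]
  -- The crude `xy ≤ x² + y²` replaces Cauchy–Schwarz; boundedness on bounded sets of H^σ is all
  -- that matters, which explains the form `A + ‖f‖ ^ 2`.
  nlinarith [sq_nonneg (‖(besselSymbol (-σ) ξ : ℂ)‖ - ‖b ξ‖), sq_nonneg ‖b ξ‖,
    sq_nonneg ‖(besselSymbol (-σ) ξ : ℂ)‖]

theorem continuous_fourier_bessel : Continuous fun f : H d σ => (𝓕 f.bessel : L2 d) :=
  (Lp.fourierTransformₗᵢ (E d) ℂ).continuous.comp (isometry_bessel d σ).continuous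

/-- A multiplier of order at most `σ` acts boundedly from H^σ to L². It serves with `k = 1` for the
embedding and with the symbol of the Laplacian. -/
theorem exists_continuous_of_multiplier {k : E d → ℂ} (hk : Continuous k) {C : ℝ}
    (hC : ∀ ξ, ‖k ξ * besselSymbol (-σ) ξ‖ ≤ C) : ∃ L : H d σ → L2 d, Continuous L ∧
      ∀ f, ∀ᵐ ξ, (𝓕 (L f) : L2 d) ξ = k ξ * (𝓕 (toL2 f) : L2 d) ξ := by
  have hkc : Continuous fun ξ => k ξ * besselSymbol (-σ) ξ := by fun_prop
  refine ⟨fun f => 𝓕⁻ (mulL2 hkc hC (𝓕 f.bessel)), ?_, fun f => ?_⟩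
  · exact (Lp.fourierTransformₗᵢ (E d) ℂ).symm.continuous.comp
      ((mulL2 hkc hC).continuous.comp continuous_fourier_bessel)
  · rw [FourierTransform.fourier_fourierInv_eq]
    filter_upwards [coeFn_mulL2 hkc hC (𝓕 f.bessel), fourier_toL2 f] with ξ h1 h2
    rw [h1, h2, mul_assoc]

theorem continuous_toL2 : Continuous (toL2 : H d σ → L2 d) := by
  obtain ⟨L, hL, h⟩ := exists_continuous_of_multiplier (σ := σ) (k := fun _ : E d => 1) (C := 1)
    continuous_const fun ξ => by
      rw [one_mul, Complex.norm_real, Real.norm_of_nonneg (besselSymbol_pos _ _).le]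
      exact besselSymbol_neg_le_one σ.2 ξ
  have h1 : L = toL2 := funext fun f => by
    have h2 : 𝓕 (L f) = 𝓕 (toL2 f) := Lp.ext ((h f).mono fun ξ hξ => by rw [hξ, one_mul])
    exact (Lp.fourierTransformₗᵢ (E d) ℂ).injective h2
  exact h1 ▸ hL

end H

/-- Under a uniform pointwise bound the cubic map is Lipschitz for the L² norm. Continuity in time
of the cubic term is what allows the integral equation to be differentiated. -/
theorem exists_continuous_cubic {X : Type*} [TopologicalSpace X] {Y : X → L2 d}
    (hY : Continuous Y) {M : ℝ} (hM : ∀ t, ∀ᵐ x, ‖Y t x‖ ≤ M) :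
    ∃ N : X → L2 d, Continuous N ∧ ∀ t, ∀ᵐ x, N t x = (‖Y t x‖ ^ 2 : ℝ) * Y t x := by
  have h : ∀ t, MemLp (fun x => ((‖Y t x‖ ^ 2 : ℝ) : ℂ) * Y t x) 2 := fun t =>
    MemLp.of_le_mul (c := M ^ 2) (Lp.memLp (Y t))
      ((Complex.continuous_ofReal.comp_aestronglyMeasurable
        ((Lp.aestronglyMeasurable (Y t)).norm.pow 2)).mul (Lp.aestronglyMeasurable (Y t))) (by
      filter_upwards [hM t] with x hx
      rw [norm_mul, Complex.norm_real, norm_pow, norm_norm]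
      gcongr)
  refine ⟨fun t => (h t).toLp _, ?_, fun t => (h t).coeFn_toLp⟩
  refine continuous_iff_continuousAt.2 fun t => ?_
  rw [ContinuousAt, tendsto_iff_norm_sub_tendsto_zero]
  have h1 : Tendsto (fun r => 3 * M ^ 2 * ‖Y r - Y t‖) (𝓝 t) (𝓝 0) := by
    have : Continuous fun r => 3 * M ^ 2 * ‖Y r - Y t‖ := by fun_prop
    have h2 := this.tendsto t
    simpa using h2
  refine squeeze_zero (fun r => norm_nonneg _) (fun r => ?_) h1
  refine Lp.norm_le_mul_norm_of_ae_le_mul ?_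
  filter_upwards [(h r).coeFn_toLp, (h t).coeFn_toLp, Lp.coeFn_sub ((h r).toLp _) ((h t).toLp _),
    Lp.coeFn_sub (Y r) (Y t), hM r, hM t] with x h1 h2 h3 h4 h5 h6
  rw [h3, h4, Pi.sub_apply, Pi.sub_apply, h1, h2]
  exact norm_cubic_sub_le h5 h6

/-- Integration by parts with the Laplacian in `L²`. -/
theorem integral_mul_laplacian_eq {f L : L2 d}
    (hL : ∀ᵐ ξ, (𝓕 L : L2 d) ξ = -(4 * Real.pi ^ 2 * ‖ξ‖ ^ 2 : ℝ) * (𝓕 f : L2 d) ξ)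
    {φ : E d → ℂ} (hφ : ContDiff ℝ ∞ φ) (hφs : HasCompactSupport φ) :
    ∫ x, f x * Δ φ x = ∫ x, L x * φ x := by
  set φs : 𝓢(E d, ℂ) := hφs.toSchwartzMap hφ
  set c : ℂ := -(4 * (Real.pi : ℂ) ^ 2)⁻¹ with hc
  have hpi : (Real.pi : ℂ) ≠ 0 := by exact_mod_cast Real.pi_ne_zero
  have h1 : TemperedDistribution.fourierMultiplierCLM ℂ
      (fun ξ : E d => Complex.ofReal (‖ξ‖ ^ 2)) (toDistr d f) = toDistr d (c • L) := by
    have h2 : ∀ᵐ ξ, (c • 𝓕 L : L2 d) ξ = Complex.ofReal (‖ξ‖ ^ 2) * (𝓕 f : L2 d) ξ := by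
      filter_upwards [hL, Lp.coeFn_smul c (𝓕 L)] with ξ h3 h4
      rw [h4, Pi.smul_apply, h3, hc, smul_eq_mul]
      push_cast
      field_simp
    rw [TemperedDistribution.fourierMultiplierCLM_apply, ← toDistr_fourier,
      smulLeftCLM_toDistr (by fun_prop) h2, ← toDistr_fourierInv]
    congr 1
    have h3 : 𝓕⁻ (c • 𝓕 L) = c • 𝓕⁻ (𝓕 L) :=
      map_smul (Lp.fourierTransformₗᵢ (E d) ℂ).symm c (𝓕 L)
    rw [h3, FourierTransform.fourierInv_fourier_eq]
  have h2 := TemperedDistribution.laplacian_apply_apply (toDistr d f) φs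
  rw [TemperedDistribution.laplacian_eq_fourierMultiplierCLM, h1, map_smul] at h2
  have h3 : (-(2 * Real.pi) ^ 2 • c • toDistr d L) φs = toDistr d L φs := by
    change (-(2 * Real.pi) ^ 2) • c • (toDistr d L φs) = _
    rw [Complex.real_smul, smul_eq_mul, hc]
    push_cast
    field_simp
    ring
  rw [h3, toDistr_apply, toDistr_apply] at h2
  simp only [SchwartzMap.laplacian_apply] at h2
  have h4 : (φs : E d → ℂ) = φ := rfl
  rw [h4] at h2
  simp only [mul_comm _ (φ _), mul_comm _ (Δ φ _)]
  exact h2.symm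

theorem exists_pairing {φ : E d → ℂ} (hφ : MemLp φ 2) :
    ∃ ℓ : L2 d →L[ℂ] ℂ, ∀ f : L2 d, ℓ f = ∫ x, f x * φ x := by
  have hφ' : MemLp (fun x => starRingEnd ℂ (φ x)) 2 := hφ.star
  refine ⟨innerSL ℂ (hφ'.toLp _), fun f => ?_⟩
  rw [innerSL_apply_apply, L2.inner_def]
  refine integral_congr_ae ?_
  filter_upwards [hφ'.coeFn_toLp] with x hx
  rw [hx, RCLike.inner_apply, Complex.conj_conj]

/-- Weak solutions with values in `H^σ`, `σ` large, are bounded solutions in `L²`. -/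
theorem IsWeakSolution.isL2Solution {s σ : ℝ≥0} {T : ℝ} {hT : 0 < T}
    {u : C(Icc (-T) T, H d s)} {u₀ : H d s} (hu : IsWeakSolution hT u u₀)
    (hσ : (d : ℝ) + 2 ≤ σ) (v : C(Icc (-T) T, H d σ)) (hv : ∀ t, (v t).toL2 = (u t).toL2)
    {t₀ : ℝ} (ht₀ : t₀ ≤ T) :
    IsL2Solution t₀ fun t => (IccExtend (neg_le_self hT.le) u t).toL2 := by
  have hd0 : (0 : ℝ) ≤ d := Nat.cast_nonneg d
  obtain ⟨-, hu0, heq⟩ := hu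
  set V : ℝ → H d σ := IccExtend (neg_le_self hT.le) v with hV_def
  have hV : Continuous V := v.continuous.Icc_extend'
  set Y : ℝ → L2 d := fun t => (IccExtend (neg_le_self hT.le) u t).toL2 with hY_def
  have hYV : ∀ t, Y t = (V t).toL2 := fun t => (hv _).symm
  have hYc : Continuous Y := (H.continuous_toL2.comp hV).congr fun t => (hYV t).symm
  obtain ⟨R, hR⟩ : ∃ R, ∀ t, ‖V t‖ ≤ R := by
    obtain ⟨R, hR⟩ := isCompact_univ.exists_bound_of_continuousOn v.continuous.continuousOn
    exact ⟨R, fun t => hR _ (mem_univ _)⟩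
  -- The choice `σ ≥ d + 2` meets both needs: `2σ > d` for boundedness and `σ ≥ 2` for the Laplacian
  -- to be in L².
  obtain ⟨A, hA⟩ := H.exists_ae_norm_le (d := d) (σ := σ) (by linarith)
  have hM : ∀ t, ∀ᵐ x, ‖Y t x‖ ≤ A + R ^ 2 := fun t => by
    filter_upwards [hA (V t)] with x hx
    rw [hYV]
    refine hx.trans ?_
    gcongr
    exact hR t
  obtain ⟨N, hNc, hN⟩ := exists_continuous_cubic hYc hM
  obtain ⟨L₀, hL₀c, hL₀⟩ := H.exists_continuous_of_multiplier (d := d) (σ := σ)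
    (k := fun ξ => -((4 * Real.pi ^ 2 * ‖ξ‖ ^ 2 : ℝ) : ℂ)) (C := 4 * Real.pi ^ 2) (by fun_prop)
    fun ξ => by
      have h1 := norm_sq_mul_besselSymbol_neg_le_one (s := σ) (by linarith) ξ
      have h2 := (besselSymbol_pos (-σ) ξ).le
      rw [norm_mul, norm_neg, Complex.norm_real, Complex.norm_real, Real.norm_of_nonneg h2,
        Real.norm_of_nonneg (by positivity), mul_assoc]
      exact mul_le_of_le_one_right (by positivity) h1
  set L : ℝ → L2 d := fun t => L₀ (V t)
  have hL : ∀ t, ∀ᵐ ξ, (𝓕 (L t) : L2 d) ξ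
      = -(4 * Real.pi ^ 2 * ‖ξ‖ ^ 2 : ℝ) * (𝓕 (Y t) : L2 d) ξ := fun t => by
    rw [hYV]; exact hL₀ (V t)
  set G : ℝ → L2 d := fun t => L t + N t
  have hG : Continuous G := (hL₀c.comp hV).add hNc
  have hu₀ : u₀.fn = Y 0 := by
    rw [← hu0]
    simp only [hY_def]
    rw [IccExtend_of_mem _ _ (show (0 : ℝ) ∈ Icc (-T) T by simp [hT.le])]
    rfl
  -- The weak form becomes an equation between L² functions: pairing with a test function is a
  -- continuous functional, hence commutes with the Bochner integral, and test functions separate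
  -- points of L².
  have hint : ∀ t ∈ Icc (-T) T, Complex.I • (Y t - Y 0) + ∫ τ in (0 : ℝ)..t, G τ = 0 := by
    intro t ht
    refine Lp.ext (EventuallyEq.trans (g := fun _ => (0 : ℂ)) ?_ (Lp.coeFn_zero ℂ 2 volume).symm)
    refine ae_eq_of_integral_contDiff_smul_eq ((Lp.memLp _).locallyIntegrable one_le_two)
      (locallyIntegrable_const 0) fun g hg hgs => ?_
    set φ : E d → ℂ := fun x => (g x : ℂ)
    have hφ : ContDiff ℝ ∞ φ := Complex.ofRealCLM.contDiff.comp hg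
    have hφs : HasCompactSupport φ := hgs.comp_left Complex.ofReal_zero
    obtain ⟨ℓ, hℓ⟩ := exists_pairing (hφ.continuous.memLp_of_hasCompactSupport hφs (p := 2))
    have h1 := heq φ hφ hφs t ht
    have h2 : ∀ τ, (∫ x, Y τ x * Δ φ x) + ∫ x, ((‖Y τ x‖ ^ 2 : ℝ) : ℂ) * Y τ x * φ x
        = ℓ (G τ) := fun τ => by
      rw [map_add, hℓ, hℓ, integral_mul_laplacian_eq (hL τ) hφ hφs]
      congr 1
      refine integral_congr_ae ?_
      filter_upwards [hN τ] with x hx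
      rw [hx]
    have h3 : Complex.I * (ℓ (Y t) - ℓ (Y 0)) + ∫ τ in (0 : ℝ)..t, ℓ (G τ) = 0 := by
      rw [hu₀] at h1
      rw [hℓ, hℓ]
      simp only [← h2]
      exact h1
    rw [ℓ.intervalIntegral_comp_comm (hG.intervalIntegrable _ _), ← map_sub, ← smul_eq_mul,
      ← map_smul, ← map_add, hℓ] at h3
    simp only [smul_zero, integral_zero]
    refine Eq.trans ?_ h3
    congr 1; ext x
    rw [Complex.real_smul, mul_comm]
  have hYint : ∀ t ∈ Icc (-T) T, Y t = Y 0 + Complex.I • ∫ τ in (0 : ℝ)..t, G τ := fun t ht => by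
    have h1 := congrArg (fun z => -Complex.I • z) (hint t ht)
    simp only [smul_add, smul_smul, smul_zero] at h1
    rw [neg_mul, Complex.I_mul_I, neg_neg, one_smul, neg_smul] at h1
    rw [← sub_eq_zero, ← h1]
    abel
  refine ⟨hYc.continuousOn, fun t ht => ⟨L t, N t, ?_, hL t, hN t⟩, A + R ^ 2, fun t _ => hM t⟩
  have h1 : HasDerivAt (fun t => Y 0 + Complex.I • ∫ τ in (0 : ℝ)..t, G τ)
      (Complex.I • G t) t :=
    ((intervalIntegral.integral_hasDerivAt_right (hG.intervalIntegrable _ _)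
      (hG.stronglyMeasurableAtFilter _ _) hG.continuousAt).const_smul Complex.I).const_add (Y 0)
  refine h1.hasDerivWithinAt.congr_of_eventuallyEq ?_ (hYint t ⟨by linarith [ht.1], by linarith [ht.2]⟩)
  -- The integral equation is known up to `T` only; a right neighbourhood of `t < t₀ ≤ T` suffices
  -- for the right derivative.
  filter_upwards [Ico_mem_nhdsGE (show t < T by linarith [ht.2])] with r hr
  exact hYint r ⟨by linarith [ht.1, hr.1], hr.2.le⟩

end


/-! ### Ill-posedness and the main theorem -/

variable {d : ℕ}

/-- A bounded solution in `L²` agrees with a regular weak solution with the same data. -/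
theorem IsWeakSolution.toL2_eq {s σ : ℝ≥0} {T : ℝ} {hT : 0 < T} {u : C(Icc (-T) T, H d s)}
    {u₀ : H d s} (hu : IsWeakSolution hT u u₀) (hσ : (d : ℝ) + 2 ≤ σ) (v : C(Icc (-T) T, H d σ))
    (hv : ∀ t, (v t).toL2 = (u t).toL2) {t₀ : ℝ} (ht₀ : 0 ≤ t₀)
    (ht₀T : t₀ ∈ Icc (-T) T) {Y : ℝ → L2 d}
    (hY : IsL2Solution t₀ Y) (hY0 : Y 0 = u₀.toL2) :
    Y t₀ = (u ⟨t₀, ht₀T⟩).toL2 := by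
  have h0 : IccExtend (neg_le_self hT.le) u 0 = u₀ := by
    rw [IccExtend_of_mem _ _ (show (0 : ℝ) ∈ Icc (-T) T by simp [hT.le])]
    exact hu.2.1
  have h1 := hY.eqOn (hu.isL2Solution hσ v hv ht₀T.2) (hY0.trans (congrArg H.toL2 h0.symm)) (right_mem_Icc.2 ht₀)
  exact h1.trans (congrArg H.toL2 (IccExtend_of_mem _ _ ht₀T))

/-- On the unit ball a well-posed flow has a single lifespan `T`, longer than the inflation times
for large `n`. Propagation of regularity identifies its solutions with the inflating ones, while
continuity at the zero datum bounds their norms uniformly in time. -/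
theorem not_wellPosed {s : ℕ} (hs : 0 < s) (hsd : 2 * s + 3 ≤ d) : ¬ WellPosed d (s : ℝ≥0) := by
  intro h
  obtain ⟨T, hT, X, _, _, _, j, Φ, -, hsol, hcont, hreg⟩ :=
    h (Metric.closedBall 0 1) Metric.isBounded_closedBall
  have hε : ∀ n : ℕ, (0 : ℝ) < 1 / (n + 1) := fun n => by positivity
  choose t ht u U Y hte hU hU0 hUt hUσ hY hUY using fun n : ℕ =>
    exists_norm_inflation hs hsd (hε n)
  have hε0 : Tendsto (fun n : ℕ => 1 / ((n : ℝ) + 1)) atTop (𝓝 0) :=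
    tendsto_one_div_add_atTop_nhds_zero_nat
  have hmem : ∀ n, U n ⟨0, left_mem_Icc.2 (ht n).le⟩ ∈ Metric.closedBall (0 : H d (s : ℝ≥0)) 1 :=
    fun n => by
      rw [mem_closedBall_zero_iff]
      refine (hU0 n).trans ?_
      rw [div_le_one (by positivity)]
      linarith [Nat.cast_nonneg (α := ℝ) n]
  let b : ℕ → Metric.closedBall (0 : H d (s : ℝ≥0)) 1 := fun n => ⟨_, hmem n⟩
  have hb : Tendsto b atTop (𝓝 ⟨0, Metric.mem_closedBall_self zero_le_one⟩) := by
    rw [tendsto_subtype_rng]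
    exact squeeze_zero_norm hU0 hε0
  have hlim := (hcont.tendsto _).comp hb
  set c := ‖j (Φ ⟨0, Metric.mem_closedBall_self zero_le_one⟩)‖
  -- Convergence to the solution with zero data is used only through this bound; that solution need
  -- not be identified.
  have hev : ∀ᶠ n in atTop, ‖j (Φ (b n))‖ < c + 1 :=
    hlim.norm.eventually_lt_const (lt_add_one _)
  have hTev : ∀ᶠ n : ℕ in atTop, 1 / ((n : ℝ) + 1) < T := hε0.eventually_lt_const hT
  have hnev : ∀ᶠ n : ℕ in atTop, c + 1 ≤ n := tendsto_natCast_atTop_atTop.eventually_ge_atTop _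
  obtain ⟨n, h1, h2, h3⟩ := (hev.and (hTev.and hnev)).exists
  -- The exponent is at least `s`, as propagation of regularity requires, and at least `d + 2`, as
  -- uniqueness requires.
  obtain ⟨v, hv⟩ := hreg (b n) ((d + 2 + s : ℕ) : ℝ≥0) (by exact_mod_cast Nat.le_add_left _ _)
    (hUσ n _)
  have hσ : (d : ℝ) + 2 ≤ (((d + 2 + s : ℕ) : ℝ≥0) : ℝ) := by
    push_cast
    linarith [Nat.cast_nonneg (α := ℝ) s]
  have htT : t n ∈ Icc (-T) T := ⟨by linarith [ht n], (hte n).trans h2.le⟩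
  have h4 := (hsol (b n)).1.toL2_eq hσ v hv (ht n).le htT (hY n)
    (hUY n ⟨0, left_mem_Icc.2 (ht n).le⟩).symm
  rw [← hUY n ⟨t n, right_mem_Icc.2 (ht n).le⟩] at h4
  have h5 := H.toL2_injective h4
  have h6 := hUt n
  rw [h5, one_div, inv_inv] at h6
  have h7 := (j (Φ (b n))).norm_coe_le_norm ⟨t n, htT⟩
  linarith

end CubicNLS

theorem mainTheorem4 (d : ℕ) (hd : 5 ≤ d) :
    (∀ s : ℕ, 0 < s → (s : ℝ) < ((d : ℝ) - 2) / 2 →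
      (∃ (t : ℕ → ℝ) (ht : ∀ n, 0 < t n) (u : ℕ → ℝ → CubicNLS.E d → ℂ)
          (U : ∀ n, C(Icc 0 (t n), CubicNLS.H d (s : ℝ≥0))),
        Tendsto t atTop (𝓝 0) ∧
        (∀ n, CubicNLS.IsSmoothSolution (u n) (U n)) ∧
        Tendsto (fun n => ‖U n ⟨0, left_mem_Icc.2 (ht n).le⟩‖) atTop (𝓝 0) ∧
        Tendsto (fun n => ‖U n ⟨t n, right_mem_Icc.2 (ht n).le⟩‖) atTop atTop) ∧
      ¬ CubicNLS.WellPosed d (s : ℝ≥0)) ∧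
    ¬ CubicNLS.WellPosed d 1 := by
  refine ⟨fun s hs hsd => ?_, ?_⟩
  -- For integers, `s < (d - 2)/2` means `d - 2s ≥ 3`.
  · have hsd' : 2 * s + 3 ≤ d := by
      have h1 : 2 * (s : ℝ) + 2 < d := by linarith
      have h2 : 2 * s + 2 < d := by exact_mod_cast h1
      omega
    refine ⟨?_, CubicNLS.not_wellPosed hs hsd'⟩
    choose t ht u U Y hte hU hU0 hUt _ _ _ using fun n : ℕ =>
      CubicNLS.exists_norm_inflation hs hsd' (ε := 1 / ((n : ℝ) + 1)) (by positivity)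
    have hε0 : Tendsto (fun n : ℕ => 1 / ((n : ℝ) + 1)) atTop (𝓝 0) :=
      tendsto_one_div_add_atTop_nhds_zero_nat
    refine ⟨t, ht, u, U, squeeze_zero (fun n => (ht n).le) hte hε0, hU,
      squeeze_zero (fun n => norm_nonneg _) hU0 hε0, tendsto_atTop_mono hUt ?_⟩
    simp only [one_div, inv_inv]
    exact tendsto_atTop_add_const_right _ _ tendsto_natCast_atTop_atTop
  · have h := CubicNLS.not_wellPosed (d := d) (s := 1) one_pos (by omega)
    rwa [Nat.cast_one] at h
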